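/- Let $\Omega\subset\mathbb R^n$ be a bounded open set (for instance a bounded Lipschitz domain), let $p:\Omega\to[1,p_+]$, $p_+<\infty$, be measurable and $Y$-semicontinuous, that is, $p(x_0)=1$ whenever $x_k\to x_0$ in $\Omega$ and $p(x_k)\to1$, and let $Y=\{x\in\Omega: p(x)=1\}$. For $u\in BV(\Omega)^N$ let $TV(u)$ be the total variation measure of the matrix-valued measure $\nabla u$, taken with respect to the Frobenius norm $|\cdot|$. Let $\Psi: L^2(\Omega)^N\to[0,+\infty]$ be given by $$\Psi(u)=TV(u)(Y)+\int_{\Omega\setminus Y}\frac{|\nabla u|^{p(x)}}{p(x)}\,dx$$ if $u\in BV(\Omega)^N$ and $u$ has a weak gradient $\nabla u\in L^{p(\cdot)}(\Omega\setminus Y)$ on the open set $\Omega\setminus Y$, and $\Psi(u)=+\infty$ otherwise. (If $p\le 2$ on $\Omega$, then $\Psi(u)<+\infty$ holds exactly for $u\in BV^{p(\cdot)}(\Omega)^N\cap L^2(\Omega)^N$, where $BV^{p(\cdot)}(\Omega)=BV(\Omega)\cap W^{1,p(\cdot)}(\Omega\setminus Y)$.) For $u\in L^2(\Omega)^N$ let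 $\partial\Psi(u)$ be the set of all $w\in L^2(\Omega)^N$ with $\Psi(u+h)\ge\Psi(u)+(w,h)$ for all $h\in L^2(\Omega)^N$. **Theorem.** The functional $\Psi$ is proper, convex and lower semicontinuous and has dense domain in $L^2(\Omega)^N$. For every $u_0\in L^2(\Omega)^N$ there is a unique semigroup solution of the critical $p(x)$-Laplacian flow $\partial_t u=\operatorname{div}(|\nabla u|^{p(x)-2}\nabla u)$ with homogeneous Neumann boundary condition, that is, a unique function $u\in W^{1,\infty}_{loc}((0,\infty);L^2(\Omega)^N)\cap C([0,\infty);L^2(\Omega)^N)$ such that $\partial\Psi(u(t))\ne\varnothing$ for all $t>0$, $0\in u'(t)+\partial\Psi(u(t))$ for almost all $t>0$, and $u(0)=u_0$. -/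

import Mathlib

open MeasureTheory Set Filter Topology
open scoped ENNReal

noncomputable section

namespace CriticalFlow

/-- Real `N × n` matrices; the Euclidean norm on them is the Frobenius norm. -/
abbrev Mat (N n : ℕ) : Type := EuclideanSpace ℝ (Fin N × Fin n)

/-- The Hilbert space `L²(Ω)^N`. -/
abbrev L2 {n : ℕ} (N : ℕ) (Ω : Set (EuclideanSpace ℝ (Fin n))) : Type :=
  Lp (EuclideanSpace ℝ (Fin N)) 2 ((volume : Measure (EuclideanSpace ℝ (Fin n))).restrict Ω)

/-- `φ` is a `C¹` function whose support is a compact subset of `V`. -/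
structure IsTest {E F : Type*} [NormedAddCommGroup E] [NormedSpace ℝ E]
    [NormedAddCommGroup F] [NormedSpace ℝ F] (V : Set E) (φ : E → F) : Prop where
  contDiff : ContDiff ℝ 1 φ
  hasCompactSupport : HasCompactSupport φ
  tsupport_subset : tsupport φ ⊆ V

section Space

variable {n N : ℕ}

/-- The partial derivative `∂φ/∂x_j`. -/
def partialDeriv {F : Type*} [NormedAddCommGroup F] [NormedSpace ℝ F] (j : Fin n)
    (φ : EuclideanSpace ℝ (Fin n) → F) (x : EuclideanSpace ℝ (Fin n)) : F :=
  fderiv ℝ φ x (EuclideanSpace.single j 1)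

/-- The row-wise divergence `(div Φ)_i = ∑_j ∂Φ_{ij}/∂x_j`. -/
def matDiv (Φ : EuclideanSpace ℝ (Fin n) → Mat N n) (x : EuclideanSpace ℝ (Fin n)) :
    EuclideanSpace ℝ (Fin N) :=
  WithLp.toLp 2 (fun i => ∑ j, partialDeriv j Φ x (i, j))

/-! ### Functions of bounded variation -/

/-- The total variation
`TV(u) = sup {∫_Ω u · div Φ : Φ ∈ C¹_c(Ω; ℝ^{N×n}), |Φ| ≤ 1}`. -/
def totalVar (Ω : Set (EuclideanSpace ℝ (Fin n)))
    (u : EuclideanSpace ℝ (Fin n) → EuclideanSpace ℝ (Fin N)) : ℝ≥0∞ :=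
  ⨆ (Φ : EuclideanSpace ℝ (Fin n) → Mat N n) (_ : IsTest Ω Φ) (_ : ∀ x, ‖Φ x‖ ≤ 1),
    ENNReal.ofReal (∫ x in Ω, inner ℝ (u x) (matDiv Φ x))

/-- `u ∈ BV(Ω)^N`. -/
def MemBV (Ω : Set (EuclideanSpace ℝ (Fin n)))
    (u : EuclideanSpace ℝ (Fin n) → EuclideanSpace ℝ (Fin N)) : Prop :=
  IntegrableOn u Ω ∧ totalVar Ω u < ∞

/-- The matrix-valued measure `μ` represents the distributional Jacobi matrix of `u` in `Ω`:
`∫ φ dμ_{ij} = - ∫_Ω u_i ∂_j φ` for all test functions `φ` on `Ω`. -/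
def IsGradMeasure (Ω : Set (EuclideanSpace ℝ (Fin n)))
    (u : EuclideanSpace ℝ (Fin n) → EuclideanSpace ℝ (Fin N))
    (μ : VectorMeasure (EuclideanSpace ℝ (Fin n)) (Mat N n)) : Prop :=
  ∀ φ : EuclideanSpace ℝ (Fin n) → ℝ, IsTest Ω φ → ∀ (i : Fin N) (j : Fin n),
    (∫ᵛ x, φ x ∂•μ) (i, j) = - ∫ x in Ω, u x i * partialDeriv j φ x

open Classical in
/-- The distributional Jacobi matrix of a function of bounded variation, a matrix-valued measure
on `Ω` (it is unique; the value is `0` if there is none). -/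
def gradMeasure (Ω : Set (EuclideanSpace ℝ (Fin n)))
    (u : EuclideanSpace ℝ (Fin n) → EuclideanSpace ℝ (Fin N)) :
    VectorMeasure (EuclideanSpace ℝ (Fin n)) (Mat N n) :=
  if h : ∃ μ, IsGradMeasure Ω u μ then h.choose.restrict Ω else 0

/-- The total variation measure `TV(u)(E) = sup ∑_k |∇u(E_k)|` over the measurable partitions
`(E_k)` of `E`. -/
def totalVarMeasure (Ω : Set (EuclideanSpace ℝ (Fin n)))
    (u : EuclideanSpace ℝ (Fin n) → EuclideanSpace ℝ (Fin N)) :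
    Measure (EuclideanSpace ℝ (Fin n)) :=
  (gradMeasure Ω u).variation

/-! ### Weak gradients and variable exponents -/

/-- `G` is the weak Jacobi matrix of `u` in the open set `V`. -/
def IsWeakGrad (V : Set (EuclideanSpace ℝ (Fin n)))
    (u : EuclideanSpace ℝ (Fin n) → EuclideanSpace ℝ (Fin N))
    (G : EuclideanSpace ℝ (Fin n) → Mat N n) : Prop :=
  LocallyIntegrableOn G V ∧
    ∀ φ : EuclideanSpace ℝ (Fin n) → ℝ, IsTest V φ → ∀ (i : Fin N) (j : Fin n),
      ∫ x in V, φ x * G x (i, j) = - ∫ x in V, u x i * partialDeriv j φ x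

open Classical in
/-- The weak Jacobi matrix of `u` in `V` (it is unique up to null sets; the value is `0` if there
is none). -/
def weakGrad (V : Set (EuclideanSpace ℝ (Fin n)))
    (u : EuclideanSpace ℝ (Fin n) → EuclideanSpace ℝ (Fin N)) :
    EuclideanSpace ℝ (Fin n) → Mat N n :=
  if h : ∃ G, IsWeakGrad V u G then h.choose else 0

/-- `|f| ∈ L^{p(·)}(V)`: the modular `∫_V (|f|/l)^{p(x)} dx` is finite for some `l > 0`. -/
def MemLpVar {F : Type*} [NormedAddCommGroup F] (V : Set (EuclideanSpace ℝ (Fin n)))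
    (p : EuclideanSpace ℝ (Fin n) → ℝ) (f : EuclideanSpace ℝ (Fin n) → F) : Prop :=
  AEStronglyMeasurable f (volume.restrict V) ∧
    ∃ l : ℝ, 0 < l ∧ ∫⁻ x in V, ENNReal.ofReal ((‖f x‖ / l) ^ p x) < ∞

/-- The weak gradient of `u` in `V` exists and belongs to `L^{p(·)}(V)`. -/
def HasGradLpVar (V : Set (EuclideanSpace ℝ (Fin n))) (p : EuclideanSpace ℝ (Fin n) → ℝ)
    (u : EuclideanSpace ℝ (Fin n) → EuclideanSpace ℝ (Fin N)) : Prop :=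
  ∃ G, IsWeakGrad V u G ∧ MemLpVar V p G

/-- `p` is `Y`-semicontinuous: `p(x₀) = 1` whenever `x_k → x₀` in `Ω` and `p(x_k) → 1`. -/
def YSemicontinuous (Ω : Set (EuclideanSpace ℝ (Fin n))) (p : EuclideanSpace ℝ (Fin n) → ℝ) :
    Prop :=
  ∀ x₀ ∈ Ω, ∀ x : ℕ → EuclideanSpace ℝ (Fin n), (∀ k, x k ∈ Ω) →
    Tendsto x atTop (𝓝 x₀) → Tendsto (fun k => p (x k)) atTop (𝓝 1) → p x₀ = 1

/-- The critical set `Y`. -/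
def critSet (Ω : Set (EuclideanSpace ℝ (Fin n))) (p : EuclideanSpace ℝ (Fin n) → ℝ) :
    Set (EuclideanSpace ℝ (Fin n)) :=
  {x | x ∈ Ω ∧ p x = 1}

/-- `u ∈ BV^{p(·)}(Ω)^N = BV(Ω)^N ∩ W^{1,p(·)}(Ω ∖ Y)^N`. -/
def MemBVVar (Ω : Set (EuclideanSpace ℝ (Fin n))) (p : EuclideanSpace ℝ (Fin n) → ℝ)
    (u : EuclideanSpace ℝ (Fin n) → EuclideanSpace ℝ (Fin N)) : Prop :=
  MemBV Ω u ∧ MemLpVar (Ω \ critSet Ω p) p u ∧ HasGradLpVar (Ω \ critSet Ω p) p u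

/-- `TV(u)(Y) + ∫_{Ω ∖ Y} |∇u|^{p(x)} / p(x) dx`. -/
def energy (Ω : Set (EuclideanSpace ℝ (Fin n))) (p : EuclideanSpace ℝ (Fin n) → ℝ)
    (u : EuclideanSpace ℝ (Fin n) → EuclideanSpace ℝ (Fin N)) : ℝ≥0∞ :=
  totalVarMeasure Ω u (critSet Ω p) +
    ∫⁻ x in Ω \ critSet Ω p, ENNReal.ofReal (‖weakGrad (Ω \ critSet Ω p) u x‖ ^ p x / p x)

open Classical in
/-- The functional `Ψ` on `L²(Ω)^N`: the energy of `u` if `u ∈ BV(Ω)^N` and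
`∇u ∈ L^{p(·)}(Ω ∖ Y)`, and `+∞` otherwise. -/
def Psi (Ω : Set (EuclideanSpace ℝ (Fin n))) (p : EuclideanSpace ℝ (Fin n) → ℝ)
    (u : L2 N Ω) : EReal :=
  if MemBV Ω u ∧ HasGradLpVar (Ω \ critSet Ω p) p u then (energy Ω p u : EReal) else ⊤

open Classical in
/-- The functional that equals the energy on `BV^{p(·)}(Ω)^N ∩ L²(Ω)^N` and `+∞` elsewhere. The
only difference from `Psi` is that `u ∈ L^{p(·)}(Ω ∖ Y)` is required for finiteness. -/
def PsiBV (Ω : Set (EuclideanSpace ℝ (Fin n))) (p : EuclideanSpace ℝ (Fin n) → ℝ)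
    (u : L2 N Ω) : EReal :=
  if MemBVVar Ω p u then (energy Ω p u : EReal) else ⊤

end Space

/-! ### Convex functionals and gradient flows in a Hilbert space -/

section Hilbert

variable {H : Type*} [NormedAddCommGroup H] [InnerProductSpace ℝ H]

/-- `Φ : H → ℝ ∪ {+∞}` is proper: it does not take the value `-∞` and is not identically `+∞`. -/
def IsProper (Φ : H → EReal) : Prop :=
  (∀ u, Φ u ≠ ⊥) ∧ ∃ u, Φ u ≠ ⊤

/-- Convexity of an extended-real-valued functional. -/
def IsConvex (Φ : H → EReal) : Prop :=
  ∀ u v : H, ∀ t : ℝ, 0 < t → t < 1 →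
    Φ ((1 - t) • u + t • v) ≤ ((1 - t : ℝ) : EReal) * Φ u + (t : EReal) * Φ v

/-- The subdifferential `∂Φ(u) = {w : Φ(u + h) ≥ Φ(u) + (w, h) for all h}`. -/
def subdiff (Φ : H → EReal) (u : H) : Set H :=
  {w | ∀ h : H, Φ u + ((inner ℝ w h : ℝ) : EReal) ≤ Φ (u + h)}

/-- `u ∈ W^{1,∞}_loc((0,∞); H)` with weak derivative `u'`, for a function `u` that is continuous
on `[0,∞)`: `u'` is strongly measurable, essentially bounded on the compact subintervals of
`(0,∞)`, and `∫ η' u = - ∫ η u'` for all `η ∈ C¹_c((0,∞))`. -/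
structure HasWeakDerivLoc (u u' : ℝ → H) : Prop where
  aestronglyMeasurable : AEStronglyMeasurable u' (volume.restrict (Ioi (0 : ℝ)))
  locallyBounded : ∀ a b : ℝ, 0 < a → a < b → ∃ C : ℝ, ∀ᵐ t ∂volume.restrict (Icc a b), ‖u' t‖ ≤ C
  integral_eq : ∀ η : ℝ → ℝ, IsTest (Ioi (0 : ℝ)) η →
    ∫ t in Ioi (0 : ℝ), deriv η t • u t = - ∫ t in Ioi (0 : ℝ), η t • u' t

/-- `u` is a semigroup solution of `0 ∈ u' + ∂Φ(u)`, `u(0) = u₀`, on `[0,∞)`. (Values of `u` at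
negative times play no role.) -/
structure IsSemigroupSolution (Φ : H → EReal) (u₀ : H) (u : ℝ → H) : Prop where
  continuousOn : ContinuousOn u (Ici 0)
  mem_dom : ∀ t : ℝ, 0 < t → (subdiff Φ (u t)).Nonempty
  inclusion : ∃ u' : ℝ → H, HasWeakDerivLoc u u' ∧
    ∀ᵐ t ∂volume.restrict (Ioi (0 : ℝ)), - u' t ∈ subdiff Φ (u t)
  initial : u 0 = u₀

end Hilbert

end CriticalFlow

end

/-! The proof separates an abstract part, on gradient flows in a Hilbert space, from a concrete
part, which shows that `Psi` fits the abstract setting summarised in `IsEnergy`.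

Concrete part. With q the conjugate exponent of p, Ψ(u) is the supremum of -∫ u · div Φ - ∫_{Ω∖Y}
|Φ|^q/q over the C¹ fields Φ of compact support in Ω with |Φ| ≤ 1 on Y and finite conjugate modular
(`psi_eq_iSup`). Each of these expressions is a continuous affine function of u ∈ L², so convexity
and lower semicontinuity come for free. That dual values do not exceed the energy is Young's
inequality on Ω∖Y and |Φ| ≤ 1 on Y (`dualVal_le_energy`). Conversely, suppose that the dual values
are bounded by M (`energy_le`). Fields with |Φ| ≤ 1 give u ∈ BV, so Riesz representation and polar
decomposition write ∇u = τ·TV(u) with |τ| = 1. A bounded field on a compact part of Ω∖Y can be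
combined with τ on Y and approximated by admissible fields (`critSet_add_integral_le`);
Y-semicontinuity enters here, since it makes Ω∖Y open and keeps p away from 1, hence q bounded, on
compact subsets. Large multiples of τ on Lebesgue null sets show that ∇u is absolutely continuous on
Ω∖Y, and the equality case |G|^(p-1) τ of Young's inequality, where G is the density, recovers the
modular. The domain is dense because test functions have finite energy.

Abstract part. Minimising Φ(v) + ‖v - y‖²/(2l) gives the resolvent of ∂Φ. Kobayashi's estimate
(`kobayashi`) compares implicit Euler schemes with different steps, so they converge to a
contraction semigroup, the Crandall-Liggett theorem. A discrete Lyapunov function gives the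
smoothing bound ‖x‖/t for the Yosida approximations along the flow (`norm_yosida_iterate_le`). Hence
at positive times the flow lies in the domain of ∂Φ, and its right derivative is minus the element
of minimal norm of ∂Φ. For uniqueness, the monotonicity of ∂Φ makes the distance of two solutions
nonincreasing. -/

noncomputable section

namespace CriticalFlow

/-! ### Subdifferentials of convex functionals and solvability of the resolvent equation -/

section Resolvent

variable {H : Type*} [NormedAddCommGroup H] [InnerProductSpace ℝ H]

/-- Convex, lower semicontinuous, densely defined functionals with minimal value `Φ 0 = 0`. -/
structure IsEnergy (Φ : H → EReal) : Prop where
  nonneg : ∀ u, 0 ≤ Φ u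
  zero : Φ 0 = 0
  convex : IsConvex Φ
  lsc : LowerSemicontinuous Φ
  dense : Dense {u | Φ u ≠ ⊤}

namespace IsEnergy

variable {Φ : H → EReal}

lemma coe_toReal (hΦ : IsEnergy Φ) {u : H} (hu : Φ u ≠ ⊤) : ((Φ u).toReal : EReal) = Φ u :=
  EReal.coe_toReal hu (ne_bot_of_le_ne_bot EReal.zero_ne_bot (hΦ.nonneg u))

lemma toReal_nonneg (hΦ : IsEnergy Φ) (u : H) : 0 ≤ (Φ u).toReal :=
  EReal.toReal_nonneg (hΦ.nonneg u)

lemma ne_top_of_mem_subdiff (hΦ : IsEnergy Φ) {u w : H} (hw : w ∈ subdiff Φ u) : Φ u ≠ ⊤ := by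
  intro h
  have h1 := hw (-u)
  rw [h, add_neg_cancel, hΦ.zero, EReal.top_add_coe] at h1
  exact absurd h1 (by simp)

lemma mem_subdiff_iff (hΦ : IsEnergy Φ) {u w : H} :
    w ∈ subdiff Φ u ↔ Φ u ≠ ⊤ ∧
      ∀ v, Φ v ≠ ⊤ → (Φ u).toReal + inner ℝ w (v - u) ≤ (Φ v).toReal := by
  constructor
  · intro hw
    refine ⟨hΦ.ne_top_of_mem_subdiff hw, fun v hv => ?_⟩
    have h1 := hw (v - u)
    rw [add_sub_cancel, ← hΦ.coe_toReal hv, ← hΦ.coe_toReal (hΦ.ne_top_of_mem_subdiff hw)] at h1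
    exact_mod_cast h1
  · rintro ⟨hu, h⟩ k
    by_cases hv : Φ (u + k) = ⊤
    · rw [hv]; exact le_top
    · have h1 := h (u + k) hv
      rw [add_sub_cancel_left] at h1
      rw [← hΦ.coe_toReal hv, ← hΦ.coe_toReal hu]
      exact_mod_cast h1

lemma zero_mem_dom (hΦ : IsEnergy Φ) : Φ 0 ≠ ⊤ := by simp [hΦ.zero]

lemma le_inner_of_mem_subdiff (hΦ : IsEnergy Φ) {u w : H} (hw : w ∈ subdiff Φ u) :
    (Φ u).toReal ≤ inner ℝ w u := by
  have h := (hΦ.mem_subdiff_iff.1 hw).2 0 hΦ.zero_mem_dom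
  rw [hΦ.zero] at h
  simp only [zero_sub, inner_neg_right, EReal.toReal_zero] at h
  linarith

lemma subdiff_monotone (hΦ : IsEnergy Φ) {u w v z : H} (hw : w ∈ subdiff Φ u)
    (hz : z ∈ subdiff Φ v) : 0 ≤ inner ℝ (w - z) (u - v) := by
  rw [hΦ.mem_subdiff_iff] at hw hz
  have h1 := hw.2 v hz.1
  have h2 := hz.2 u hw.1
  rw [← neg_sub u v, inner_neg_right] at h1
  rw [inner_sub_left]
  linarith

lemma convex_real (hΦ : IsEnergy Φ) {u v : H} (hu : Φ u ≠ ⊤) (hv : Φ v ≠ ⊤) {t : ℝ}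
    (h0 : 0 < t) (h1 : t < 1) : Φ ((1 - t) • u + t • v) ≠ ⊤ ∧
      (Φ ((1 - t) • u + t • v)).toReal ≤ (1 - t) * (Φ u).toReal + t * (Φ v).toReal := by
  have h := hΦ.convex u v t h0 h1
  rw [← hΦ.coe_toReal hu, ← hΦ.coe_toReal hv, ← EReal.coe_mul, ← EReal.coe_mul,
    ← EReal.coe_add] at h
  have h2 : Φ ((1 - t) • u + t • v) ≠ ⊤ := ne_top_of_le_ne_top (EReal.coe_ne_top _) h
  refine ⟨h2, ?_⟩
  rw [← hΦ.coe_toReal h2] at h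
  exact_mod_cast h

/-- Sequential lower semicontinuity for the real values. Finiteness at the limit is part of the
conclusion because `toReal` sends the value ⊤ to 0. -/
lemma le_of_tendsto (hΦ : IsEnergy Φ) {x : ℕ → H} {y : H} {a : ℕ → ℝ} {b : ℝ}
    (hx : Tendsto x atTop (𝓝 y)) (ha : Tendsto a atTop (𝓝 b)) (h : ∀ k, Φ (x k) ≠ ⊤)
    (hle : ∀ k, (Φ (x k)).toReal ≤ a k) : Φ y ≠ ⊤ ∧ (Φ y).toReal ≤ b := by
  have key : Φ y ≤ (b : EReal) := by
    by_contra hlt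
    rw [not_le] at hlt
    obtain ⟨c, hbc, hcy⟩ := EReal.lt_iff_exists_real_btwn.1 hlt
    have h1 := hx.eventually (hΦ.lsc y c hcy)
    have h2 := ha.eventually (gt_mem_nhds (EReal.coe_lt_coe_iff.1 hbc))
    obtain ⟨k, hk1, hk2⟩ := (h1.and h2).exists
    rw [← hΦ.coe_toReal (h k)] at hk1
    have := EReal.coe_lt_coe_iff.1 hk1
    linarith [hle k]
  have h2 : Φ y ≠ ⊤ := ne_top_of_le_ne_top (EReal.coe_ne_top _) key
  refine ⟨h2, ?_⟩
  rw [← hΦ.coe_toReal h2] at key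
  exact_mod_cast key

/-- The graph of the subdifferential is closed. -/
lemma subdiff_closed (hΦ : IsEnergy Φ) {x w : ℕ → H} {y z : H} (hx : Tendsto x atTop (𝓝 y))
    (hw : Tendsto w atTop (𝓝 z)) (h : ∀ k, w k ∈ subdiff Φ (x k)) : z ∈ subdiff Φ y := by
  rw [hΦ.mem_subdiff_iff]
  have key : ∀ v, Φ v ≠ ⊤ → Φ y ≠ ⊤ ∧ (Φ y).toReal ≤ (Φ v).toReal - inner ℝ z (v - y) := by
    intro v hv
    refine hΦ.le_of_tendsto hx (a := fun k => (Φ v).toReal - inner ℝ (w k) (v - x k))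
      (tendsto_const_nhds.sub (hw.inner (tendsto_const_nhds.sub hx)))
      (fun k => hΦ.ne_top_of_mem_subdiff (h k)) fun k => ?_
    have := (hΦ.mem_subdiff_iff.1 (h k)).2 v hv
    linarith
  exact ⟨(key 0 hΦ.zero_mem_dom).1, fun v hv => by linarith [(key v hv).2]⟩

/-- The parallelogram law. It expresses the strong convexity that makes minimising sequences of the
regularised functional Cauchy, so that no weak compactness is needed. -/
lemma norm_midpoint_sq (v w y : H) :
    ‖(1 - (1 / 2 : ℝ)) • v + (1 / 2 : ℝ) • w - y‖ ^ 2 =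
      (‖v - y‖ ^ 2 + ‖w - y‖ ^ 2) / 2 - ‖v - w‖ ^ 2 / 4 := by
  have e1 : (1 - (1 / 2 : ℝ)) • v + (1 / 2 : ℝ) • w - y = (1 / 2 : ℝ) • ((v - y) + (w - y)) := by
    module
  have e2 : v - w = (v - y) - (w - y) := by abel
  rw [e1, norm_smul, mul_pow, norm_add_sq_real, e2, norm_sub_sq_real (v - y) (w - y)]
  norm_num
  ring

variable [CompleteSpace H]

/-- The range condition for the subdifferential. -/
lemma exists_resolvent (hΦ : IsEnergy Φ) {l : ℝ} (hl : 0 < l) (y : H) :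
    ∃ x, l⁻¹ • (y - x) ∈ subdiff Φ x := by
  -- The minimiser x of F is the solution: the Euler-Lagrange inclusion of F at x is l⁻¹(y - x) ∈
  -- ∂Φ(x).
  set F : H → ℝ := fun v => (Φ v).toReal + ‖v - y‖ ^ 2 / (2 * l) with hF
  set m := sInf (F '' {v | Φ v ≠ ⊤}) with hm
  have hFnn : ∀ v, 0 ≤ F v := fun v => add_nonneg (hΦ.toReal_nonneg v) (by positivity)
  have hbdd : BddBelow (F '' {v | Φ v ≠ ⊤}) := ⟨0, by rintro _ ⟨v, -, rfl⟩; exact hFnn v⟩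
  have hne : (F '' {v | Φ v ≠ ⊤}).Nonempty := ⟨_, 0, hΦ.zero_mem_dom, rfl⟩
  have hmle : ∀ v, Φ v ≠ ⊤ → m ≤ F v := fun v hv => csInf_le hbdd ⟨v, hv, rfl⟩
  have hex : ∀ k : ℕ, ∃ v, Φ v ≠ ⊤ ∧ F v < m + 1 / ((k : ℝ) + 1) := by
    intro k
    obtain ⟨_, ⟨v, hv, rfl⟩, h⟩ := exists_lt_of_csInf_lt hne
      (show m < m + 1 / ((k : ℝ) + 1) by linarith [Nat.one_div_pos_of_nat (α := ℝ) (n := k)])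
    exact ⟨v, hv, h⟩
  choose v hv hvF using hex
  -- The midpoint of two almost minimisers has value at least m, so the gain ‖v j - v k‖²/(8l) from
  -- strong convexity is at most the mean of their errors.
  have hdist : ∀ j k, ‖v j - v k‖ ^ 2 ≤ 4 * l * (1 / ((j : ℝ) + 1) + 1 / ((k : ℝ) + 1)) := by
    intro j k
    have hc := hΦ.convex_real (hv j) (hv k) (t := 1 / 2) (by norm_num) (by norm_num)
    have h1 := hmle _ hc.1
    have h2 : F ((1 - (1 / 2 : ℝ)) • v j + (1 / 2 : ℝ) • v k) ≤
        (F (v j) + F (v k)) / 2 - ‖v j - v k‖ ^ 2 / (8 * l) := by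
      simp only [hF]
      rw [norm_midpoint_sq]
      have : ((‖v j - y‖ ^ 2 + ‖v k - y‖ ^ 2) / 2 - ‖v j - v k‖ ^ 2 / 4) / (2 * l) =
        (‖v j - y‖ ^ 2 / (2 * l) + ‖v k - y‖ ^ 2 / (2 * l)) / 2 - ‖v j - v k‖ ^ 2 / (8 * l) := by
        field_simp; ring
      rw [this]
      linarith [hc.2]
    have h3 : ‖v j - v k‖ ^ 2 / (8 * l) ≤ (1 / ((j : ℝ) + 1) + 1 / ((k : ℝ) + 1)) / 2 := by
      linarith [hvF j, hvF k]
    rw [div_le_iff₀ (by positivity)] at h3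
    linarith
  have hcauchy : CauchySeq v := by
    rw [Metric.cauchySeq_iff']
    intro ε hε
    have ht : Tendsto (fun k : ℕ => 8 * l * (1 / ((k : ℝ) + 1))) atTop (𝓝 (8 * l * 0)) :=
      tendsto_one_div_add_atTop_nhds_zero_nat.const_mul _
    rw [mul_zero] at ht
    obtain ⟨K, hK⟩ := (ht.eventually (gt_mem_nhds (show 0 < ε ^ 2 by positivity))).exists
    refine ⟨K, fun j hj => ?_⟩
    rw [dist_eq_norm]
    refine lt_of_pow_lt_pow_left₀ 2 hε.le (lt_of_le_of_lt (hdist j K) (lt_of_le_of_lt ?_ hK))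
    have : 1 / ((j : ℝ) + 1) ≤ 1 / ((K : ℝ) + 1) := Nat.one_div_le_one_div hj
    nlinarith
  obtain ⟨x, hx⟩ := cauchySeq_tendsto_of_complete hcauchy
  have hxF : Φ x ≠ ⊤ ∧ (Φ x).toReal ≤ m - ‖x - y‖ ^ 2 / (2 * l) := by
    refine hΦ.le_of_tendsto hx
      (a := fun k : ℕ => m + 1 / ((k : ℝ) + 1) - ‖v k - y‖ ^ 2 / (2 * l)) ?_ hv fun k => ?_
    · have h1 : Tendsto (fun k : ℕ => m + 1 / ((k : ℝ) + 1)) atTop (𝓝 (m + 0)) :=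
        tendsto_const_nhds.add tendsto_one_div_add_atTop_nhds_zero_nat
      rw [add_zero] at h1
      exact h1.sub ((((hx.sub_const y).norm).pow 2).div_const _)
    · have := hvF k
      simp only [hF] at this
      linarith
  refine ⟨x, hΦ.mem_subdiff_iff.2 ⟨hxF.1, fun z hz => ?_⟩⟩
  -- Comparison of the minimiser with (1 - t)x + tz, divided by t. The quadratic remainder keeps one
  -- factor t and disappears as t → 0.
  have key : ∀ t : ℝ, 0 < t → t < 1 →
      (Φ x).toReal + inner ℝ (l⁻¹ • (y - x)) (z - x) ≤
        (Φ z).toReal + t * (‖z - x‖ ^ 2 / (2 * l)) := by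
    intro t h0 h1
    have hc := hΦ.convex_real hxF.1 hz h0 h1
    have h2 := hmle _ hc.1
    simp only [hF] at h2
    have e1 : (1 - t) • x + t • z - y = (x - y) + t • (z - x) := by module
    rw [e1, norm_add_sq_real, norm_smul, inner_smul_right, Real.norm_of_nonneg h0.le] at h2
    have e2 : inner ℝ (l⁻¹ • (y - x)) (z - x) = - (l⁻¹ * inner ℝ (x - y) (z - x)) := by
      rw [← neg_sub x y, smul_neg, inner_neg_left, real_inner_smul_left]
    rw [e2]
    have e3 : (‖x - y‖ ^ 2 + 2 * (t * inner ℝ (x - y) (z - x)) + (t * ‖z - x‖) ^ 2) / (2 * l) =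
        ‖x - y‖ ^ 2 / (2 * l) + t * (l⁻¹ * inner ℝ (x - y) (z - x)) +
          t * (t * (‖z - x‖ ^ 2 / (2 * l))) := by
      field_simp
    rw [e3] at h2
    have h3 : 0 ≤ t * ((Φ z).toReal + t * (‖z - x‖ ^ 2 / (2 * l)) -
        ((Φ x).toReal + -(l⁻¹ * inner ℝ (x - y) (z - x)))) := by
      nlinarith [hxF.2, hc.2]
    have := nonneg_of_mul_nonneg_right h3 h0
    linarith
  -- The choice t = 1/(k + 2) keeps t strictly below 1 also for k = 0.
  have hlim : Tendsto (fun k : ℕ => (Φ z).toReal + (1 / ((k : ℝ) + 1 + 1)) * (‖z - x‖ ^ 2 / (2 * l)))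
      atTop (𝓝 ((Φ z).toReal + 0 * (‖z - x‖ ^ 2 / (2 * l)))) := by
    have h1 := (tendsto_one_div_add_atTop_nhds_zero_nat (𝕜 := ℝ)).comp (tendsto_add_atTop_nat 1)
    have h2 : Tendsto (fun k : ℕ => 1 / ((k : ℝ) + 1 + 1)) atTop (𝓝 0) := by
      refine h1.congr fun k => ?_
      simp
    exact tendsto_const_nhds.add (h2.mul_const _)
  rw [zero_mul, add_zero] at hlim
  refine ge_of_tendsto' hlim fun k => key _ (by positivity) ?_
  rw [div_lt_one (by positivity)]
  linarith [Nat.cast_nonneg (α := ℝ) k]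

end IsEnergy

end Resolvent

/-! ### The implicit Euler scheme: contraction, Kobayashi's estimate, smoothing -/

section Euler

variable {H : Type*} [NormedAddCommGroup H] [InnerProductSpace ℝ H]

open Classical in
/-- The resolvent `(I + l ∂Φ)⁻¹`. -/
def resolvent (Φ : H → EReal) (l : ℝ) (y : H) : H :=
  if h : ∃ x, l⁻¹ • (y - x) ∈ subdiff Φ x then h.choose else 0

/-- The Yosida approximation of `∂Φ`. -/
def yosida (Φ : H → EReal) (l : ℝ) (y : H) : H := l⁻¹ • (y - resolvent Φ l y)

/-- The approximation of the flow by the implicit Euler scheme with step size `1 / (k + 1)`. -/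
def euler (Φ : H → EReal) (k : ℕ) (t : ℝ) (x : H) : H :=
  (resolvent Φ (1 / ((k : ℝ) + 1)))^[⌊t * ((k : ℝ) + 1)⌋₊] x

/-- The semigroup generated by `-∂Φ`. -/
def flow (Φ : H → EReal) (t : ℝ) (x : H) : H :=
  @limUnder _ _ _ ⟨0⟩ atTop (fun k => euler Φ k t x)

/-- The element of minimal norm of the subdifferential. -/
def minSection (Φ : H → EReal) (y : H) : H :=
  @limUnder _ _ _ ⟨0⟩ atTop (fun k : ℕ => yosida Φ (1 / ((k : ℝ) + 1)) y)

lemma abs_floor_step_sub_le {t : ℝ} (ht : 0 ≤ t) (k : ℕ) :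
    |(⌊t * ((k : ℝ) + 1)⌋₊ : ℝ) * (1 / ((k : ℝ) + 1)) - t| ≤ 1 / ((k : ℝ) + 1) := by
  have hk : (0 : ℝ) < (k : ℝ) + 1 := by positivity
  have h1 := Nat.floor_le (show 0 ≤ t * ((k : ℝ) + 1) by positivity)
  have h2 := Nat.lt_floor_add_one (t * ((k : ℝ) + 1))
  rw [mul_one_div, abs_le]
  constructor
  · rw [neg_le_sub_iff_le_add, ← add_div, le_div_iff₀ hk]; exact h2.le
  · rw [sub_le_iff_le_add]
    refine le_trans ((div_le_iff₀ hk).2 h1) ?_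
    have : 0 ≤ 1 / ((k : ℝ) + 1) := by positivity
    linarith

lemma tendsto_step : Tendsto (fun k : ℕ => 1 / ((k : ℝ) + 1)) atTop (𝓝 0) :=
  tendsto_one_div_add_atTop_nhds_zero_nat

lemma tendsto_floor_step {t : ℝ} (ht : 0 ≤ t) :
    Tendsto (fun k : ℕ => (⌊t * ((k : ℝ) + 1)⌋₊ : ℝ) * (1 / ((k : ℝ) + 1))) atTop (𝓝 t) := by
  rw [tendsto_iff_dist_tendsto_zero]
  exact squeeze_zero (fun _ => dist_nonneg) (fun k => abs_floor_step_sub_le ht k) tendsto_step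

lemma floor_step_le {t : ℝ} (ht : 0 ≤ t) (k : ℕ) :
    (⌊t * ((k : ℝ) + 1)⌋₊ : ℝ) * (1 / ((k : ℝ) + 1)) ≤ t := by
  have hk : (0 : ℝ) < (k : ℝ) + 1 := by positivity
  rw [mul_one_div]
  exact (div_le_iff₀ hk).2 (Nat.floor_le (show 0 ≤ t * ((k : ℝ) + 1) by positivity))

namespace IsEnergy

variable {Φ : H → EReal} [CompleteSpace H]

lemma yosida_mem (hΦ : IsEnergy Φ) {l : ℝ} (hl : 0 < l) (y : H) :
    yosida Φ l y ∈ subdiff Φ (resolvent Φ l y) := by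
  have h := hΦ.exists_resolvent hl y
  simp only [yosida, resolvent, dif_pos h]
  exact h.choose_spec

omit [CompleteSpace H] in
lemma sub_resolvent {l : ℝ} (hl : 0 < l) (y : H) : y - resolvent Φ l y = l • yosida Φ l y := by
  rw [yosida, smul_smul, mul_inv_cancel₀ hl.ne', one_smul]

omit [CompleteSpace H] in
lemma resolvent_eq {l : ℝ} (hl : 0 < l) (y : H) : resolvent Φ l y = y - l • yosida Φ l y := by
  rw [← sub_resolvent hl, sub_sub_cancel]

/-- Monotonicity of the subdifferential, paired with x - y and multiplied by lm, gives (l + m)‖x -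
y‖² ≤ m⟨a - y, x - y⟩ + l⟨x - b, x - y⟩; then 2⟨c, d⟩ ≤ ‖c‖² + ‖d‖². The right side is a convex
combination in which only one of the two schemes has advanced, which is the recursion behind
Kobayashi's estimate. -/
lemma resolvent_dist_sq_le (hΦ : IsEnergy Φ) {l m : ℝ} (hl : 0 < l) (hm : 0 < m) (a b : H) :
    ‖resolvent Φ l a - resolvent Φ m b‖ ^ 2 ≤
      m / (l + m) * ‖a - resolvent Φ m b‖ ^ 2 + l / (l + m) * ‖resolvent Φ l a - b‖ ^ 2 := by
  set x := resolvent Φ l a with hx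
  set y := resolvent Φ m b with hy
  have hmono := hΦ.subdiff_monotone (hΦ.yosida_mem hl a) (hΦ.yosida_mem hm b)
  rw [← hx, ← hy] at hmono
  have e1 : l • yosida Φ l a = (a - y) - (x - y) := by rw [← sub_resolvent hl, ← hx]; abel
  have e2 : m • yosida Φ m b = (x - y) - (x - b) := by rw [← sub_resolvent hm, ← hy]; abel
  have h1 : 0 ≤ m * inner ℝ (l • yosida Φ l a) (x - y) - l * inner ℝ (m • yosida Φ m b) (x - y) := by
    rw [real_inner_smul_left, real_inner_smul_left]
    rw [inner_sub_left] at hmono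
    have : 0 ≤ l * m * (inner ℝ (yosida Φ l a) (x - y) - inner ℝ (yosida Φ m b) (x - y)) := by
      positivity
    linarith
  rw [e1, e2, inner_sub_left (a - y), inner_sub_left (x - y) (x - b),
    real_inner_self_eq_norm_sq] at h1
  have h2 : 2 * inner ℝ (a - y) (x - y) ≤ ‖a - y‖ ^ 2 + ‖x - y‖ ^ 2 := by
    have := norm_sub_sq_real (a - y) (x - y)
    nlinarith [sq_nonneg ‖a - y - (x - y)‖]
  have h3 : 2 * inner ℝ (x - b) (x - y) ≤ ‖x - b‖ ^ 2 + ‖x - y‖ ^ 2 := by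
    have := norm_sub_sq_real (x - b) (x - y)
    nlinarith [sq_nonneg ‖x - b - (x - y)‖]
  rw [div_mul_eq_mul_div, div_mul_eq_mul_div, ← add_div, le_div_iff₀ (by positivity)]
  nlinarith [mul_le_mul_of_nonneg_left h2 hm.le, mul_le_mul_of_nonneg_left h3 hl.le]

lemma norm_resolvent_sub_le (hΦ : IsEnergy Φ) {l : ℝ} (hl : 0 < l) (a b : H) :
    ‖resolvent Φ l a - resolvent Φ l b‖ ≤ ‖a - b‖ := by
  set x := resolvent Φ l a with hx
  set y := resolvent Φ l b with hy
  have hmono := hΦ.subdiff_monotone (hΦ.yosida_mem hl a) (hΦ.yosida_mem hl b)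
  rw [← hx, ← hy] at hmono
  have e1 : l • (yosida Φ l a - yosida Φ l b) = (a - b) - (x - y) := by
    rw [smul_sub, ← sub_resolvent hl, ← sub_resolvent hl, ← hx, ← hy]; abel
  have h1 : 0 ≤ inner ℝ ((a - b) - (x - y)) (x - y) := by
    rw [← e1, real_inner_smul_left]; positivity
  rw [inner_sub_left, real_inner_self_eq_norm_sq] at h1
  have h2 := real_inner_le_norm (a - b) (x - y)
  by_contra hlt
  push Not at hlt
  nlinarith [norm_nonneg (x - y), norm_nonneg (a - b)]

lemma continuous_yosida (hΦ : IsEnergy Φ) {l : ℝ} (hl : 0 < l) : Continuous (yosida Φ l) := by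
  have h : LipschitzWith 1 (resolvent Φ l) :=
    LipschitzWith.of_dist_le_mul fun a b => by
      simpa [dist_eq_norm] using hΦ.norm_resolvent_sub_le hl a b
  exact (continuous_id.sub h.continuous).const_smul _

lemma norm_iterate_sub_le (hΦ : IsEnergy Φ) {l : ℝ} (hl : 0 < l) (n : ℕ) (a b : H) :
    ‖(resolvent Φ l)^[n] a - (resolvent Φ l)^[n] b‖ ≤ ‖a - b‖ := by
  induction n with
  | zero => simp
  | succ n ih =>
    rw [Function.iterate_succ_apply', Function.iterate_succ_apply']
    exact (hΦ.norm_resolvent_sub_le hl _ _).trans ih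

/-- Monotonicity between x and its resolvent, whose difference is l times the Yosida approximation
A, gives ‖A‖² ≤ ⟨w, A⟩. -/
lemma norm_yosida_le (hΦ : IsEnergy Φ) {l : ℝ} (hl : 0 < l) {x w : H} (hw : w ∈ subdiff Φ x) :
    ‖yosida Φ l x‖ ≤ ‖w‖ := by
  have h := hΦ.subdiff_monotone hw (hΦ.yosida_mem hl x)
  rw [sub_resolvent hl, real_inner_smul_right] at h
  have h1 := nonneg_of_mul_nonneg_right h hl
  rw [inner_sub_left, real_inner_self_eq_norm_sq] at h1
  have h2 := real_inner_le_norm w (yosida Φ l x)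
  by_contra hlt
  push Not at hlt
  nlinarith [norm_nonneg (yosida Φ l x), norm_nonneg w]

/-- Contractivity bounds every step of the scheme by the first one, which has length at most l‖w‖.
-/
lemma norm_iterate_sub_self_le (hΦ : IsEnergy Φ) {l : ℝ} (hl : 0 < l) {x w : H}
    (hw : w ∈ subdiff Φ x) (n : ℕ) : ‖(resolvent Φ l)^[n] x - x‖ ≤ n * l * ‖w‖ := by
  induction n with
  | zero => simp
  | succ n ih =>
    have h1 : ‖(resolvent Φ l)^[n + 1] x - (resolvent Φ l)^[n] x‖ ≤ l * ‖w‖ := by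
      rw [Function.iterate_succ_apply]
      refine (hΦ.norm_iterate_sub_le hl n _ _).trans ?_
      rw [norm_sub_rev, sub_resolvent hl, norm_smul, Real.norm_of_nonneg hl.le]
      gcongr
      exact hΦ.norm_yosida_le hl hw
    calc ‖(resolvent Φ l)^[n + 1] x - x‖
        ≤ ‖(resolvent Φ l)^[n + 1] x - (resolvent Φ l)^[n] x‖ + ‖(resolvent Φ l)^[n] x - x‖ :=
          norm_sub_le_norm_sub_add_norm_sub _ _ _
      _ ≤ l * ‖w‖ + n * l * ‖w‖ := add_le_add h1 ih
      _ = _ := by push_cast; ring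

/-- Kobayashi's estimate for implicit Euler schemes of different step sizes. -/
lemma kobayashi (hΦ : IsEnergy Φ) {l m : ℝ} (hl : 0 < l) (hm : 0 < m) {x w : H}
    (hw : w ∈ subdiff Φ x) (i j : ℕ) :
    ‖(resolvent Φ l)^[i] x - (resolvent Φ m)^[j] x‖ ^ 2 ≤
      ‖w‖ ^ 2 * ((i * l - j * m) ^ 2 + i * l ^ 2 + j * m ^ 2) := by
  induction i generalizing j with
  | zero =>
    have h := hΦ.norm_iterate_sub_self_le hm hw j
    rw [Function.iterate_zero, id, norm_sub_rev]
    calc _ ≤ (j * m * ‖w‖) ^ 2 := by gcongr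
      _ ≤ _ := by
        have : 0 ≤ ‖w‖ ^ 2 * (j * m ^ 2) := by positivity
        push_cast; nlinarith
  | succ i ih =>
    induction j with
    | zero =>
      have h := hΦ.norm_iterate_sub_self_le hl hw (i + 1)
      rw [Function.iterate_zero, id]
      calc _ ≤ (((i + 1 : ℕ) : ℝ) * l * ‖w‖) ^ 2 := by gcongr
        _ ≤ _ := by
          have : 0 ≤ ‖w‖ ^ 2 * (((i + 1 : ℕ) : ℝ) * l ^ 2) := by positivity
          push_cast at *; nlinarith
    -- The double induction closes because the quadratic expression in i and j solves the recursion
    -- of `resolvent_dist_sq_le` with equality; the variance terms i l² + j m² are what this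
    -- requires.
    | succ j ihj =>
      have h1 := ih (j + 1)
      rw [Function.iterate_succ_apply' _ i, Function.iterate_succ_apply' _ j] at *
      have h2 := hΦ.resolvent_dist_sq_le hl hm ((resolvent Φ l)^[i] x) ((resolvent Φ m)^[j] x)
      refine h2.trans ?_
      calc _ ≤ m / (l + m) * (‖w‖ ^ 2 * ((i * l - ((j + 1 : ℕ) : ℝ) * m) ^ 2 + i * l ^ 2 +
              ((j + 1 : ℕ) : ℝ) * m ^ 2)) + l / (l + m) * (‖w‖ ^ 2 *
              ((((i + 1 : ℕ) : ℝ) * l - j * m) ^ 2 + ((i + 1 : ℕ) : ℝ) * l ^ 2 + j * m ^ 2)) := by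
            gcongr
        _ = _ := by
          push_cast
          field_simp
          ring

/-- Smoothing effect of the implicit Euler scheme. -/
lemma norm_yosida_iterate_le (hΦ : IsEnergy Φ) {s : ℝ} (hs : 0 < s) {l : ℝ} (hl : 0 < l) (x : H)
    (n : ℕ) : (n * s) * (n * s - s) * ‖yosida Φ l ((resolvent Φ s)^[n] x)‖ ^ 2 ≤ ‖x‖ ^ 2 := by
  set u : ℕ → H := fun k => (resolvent Φ s)^[k] x with hu
  set w : ℕ → H := fun k => yosida Φ s (u k) with hwdef
  have hmem : ∀ k, w k ∈ subdiff Φ (u (k + 1)) := fun k => by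
    simp only [hu, Function.iterate_succ_apply']
    exact hΦ.yosida_mem hs _
  have hstep : ∀ k, u (k + 1) = u k - s • w k := fun k => by
    simp only [hu, hwdef, Function.iterate_succ_apply']
    exact resolvent_eq hs _
  have hanti : ∀ k, ‖w (k + 1)‖ ≤ ‖w k‖ := fun k => hΦ.norm_yosida_le hs (hmem k)
  have hen : ∀ k, (Φ (u (k + 2))).toReal + s * ‖w (k + 1)‖ ^ 2 ≤ (Φ (u (k + 1))).toReal := by
    intro k
    have h := (hΦ.mem_subdiff_iff.1 (hmem (k + 1))).2 (u (k + 1))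
      (hΦ.ne_top_of_mem_subdiff (hmem k))
    rw [hstep (k + 1), sub_sub_cancel, inner_smul_right, real_inner_self_eq_norm_sq,
      ← hstep (k + 1)] at h
    exact h
  have hnorm : ∀ k, ‖u (k + 1)‖ ^ 2 + 2 * s * (Φ (u (k + 1))).toReal ≤ ‖u k‖ ^ 2 := by
    intro k
    have h1 := hΦ.le_inner_of_mem_subdiff (hmem k)
    have h2 : u k = u (k + 1) + s • w k := by rw [hstep k, sub_add_cancel]
    rw [h2, norm_add_sq_real, inner_smul_right, real_inner_comm]
    nlinarith [sq_nonneg ‖s • w k‖]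
  -- Discrete form of the Lyapunov function ‖u‖² + 2tΦ(u) + t²‖w‖². The induction uses k(k + 1) +
  -- 2(k + 1) = (k + 1)(k + 2), where 2(k + 1) is the energy dissipated in the step, and the fact
  -- that ‖w k‖ does not increase.
  have key : ∀ k : ℕ, ‖u (k + 1)‖ ^ 2 + 2 * s * ((k + 1 : ℝ) * (Φ (u (k + 1))).toReal) +
      (k : ℝ) * (k + 1) * s ^ 2 * ‖w k‖ ^ 2 ≤ ‖x‖ ^ 2 := by
    intro k
    induction k with
    | zero => simpa [hu] using hnorm 0
    | succ k ih =>
      have h1 := hen k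
      have h2 := hnorm (k + 1)
      have h3 : ‖w (k + 1)‖ ^ 2 ≤ ‖w k‖ ^ 2 := by gcongr; exact hanti k
      have h4 : (k : ℝ) * (k + 1) * s ^ 2 * ‖w (k + 1)‖ ^ 2 ≤
          (k : ℝ) * (k + 1) * s ^ 2 * ‖w k‖ ^ 2 := by gcongr
      have h5 : 2 * s * (k + 1 : ℝ) * ((Φ (u (k + 2))).toReal + s * ‖w (k + 1)‖ ^ 2) ≤
          2 * s * (k + 1 : ℝ) * (Φ (u (k + 1))).toReal := by gcongr
      push_cast
      have e : u (k + 1 + 1) = u (k + 2) := rfl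
      rw [e] at *
      nlinarith
  rcases n with _ | n
  · simp
  · have h1 := key n
    have h2 : ‖yosida Φ l (u (n + 1))‖ ^ 2 ≤ ‖w n‖ ^ 2 := by
      gcongr; exact hΦ.norm_yosida_le hl (hmem n)
    have h3 : (n : ℝ) * (n + 1) * s ^ 2 * ‖yosida Φ l (u (n + 1))‖ ^ 2 ≤
        (n : ℝ) * (n + 1) * s ^ 2 * ‖w n‖ ^ 2 := by gcongr
    have h4 : 0 ≤ 2 * s * ((n + 1 : ℝ) * (Φ (u (n + 1))).toReal) := by
      have := hΦ.toReal_nonneg (u (n + 1)); positivity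
    push_cast
    have h5 := sq_nonneg ‖u (n + 1)‖
    change ((n : ℝ) + 1) * s * (((n : ℝ) + 1) * s - s) * ‖yosida Φ l (u (n + 1))‖ ^ 2 ≤ _
    nlinarith

end IsEnergy

end Euler

/-! ### Convergence of the Euler scheme and the semigroup -/

section Flow

variable {H : Type*} [NormedAddCommGroup H] [InnerProductSpace ℝ H]

namespace IsEnergy

variable {Φ : H → EReal} [CompleteSpace H]

/-- If Φ(x) is finite, the subgradient inequality at the resolvent J x, tested with x, gives ‖J x -
x‖² ≤ lΦ(x). Hence resolvents with l → 0 approximate every point of the dense domain of Φ. -/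
lemma dense_dom_subdiff (hΦ : IsEnergy Φ) : Dense {x | (subdiff Φ x).Nonempty} := by
  refine dense_closure.1 (hΦ.dense.mono fun x hx => ?_)
  refine mem_closure_of_tendsto (f := fun k : ℕ => resolvent Φ (1 / ((k : ℝ) + 1)) x)
    (b := atTop) ?_ (Eventually.of_forall fun k => ⟨_, hΦ.yosida_mem (by positivity) x⟩)
  rw [tendsto_iff_norm_sub_tendsto_zero]
  have hle : ∀ k : ℕ, ‖resolvent Φ (1 / ((k : ℝ) + 1)) x - x‖ ≤
      Real.sqrt (1 / ((k : ℝ) + 1) * (Φ x).toReal) := by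
    intro k
    have hk : (0 : ℝ) < 1 / ((k : ℝ) + 1) := by positivity
    refine Real.le_sqrt_of_sq_le ?_
    have h := (hΦ.mem_subdiff_iff.1 (hΦ.yosida_mem hk x)).2 x hx
    rw [yosida, real_inner_smul_left, real_inner_self_eq_norm_sq] at h
    have h2 := hΦ.toReal_nonneg (resolvent Φ (1 / ((k : ℝ) + 1)) x)
    have h3 : (1 / ((k : ℝ) + 1))⁻¹ * ‖x - resolvent Φ (1 / ((k : ℝ) + 1)) x‖ ^ 2 ≤
      (Φ x).toReal := by linarith
    rw [norm_sub_rev]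
    rwa [inv_mul_le_iff₀ hk] at h3
  refine squeeze_zero (fun _ => norm_nonneg _) hle ?_
  have := (tendsto_step.mul_const (Φ x).toReal).sqrt
  simpa using this

lemma norm_euler_sub_le (hΦ : IsEnergy Φ) (k : ℕ) (t : ℝ) (x y : H) :
    ‖euler Φ k t x - euler Φ k t y‖ ≤ ‖x - y‖ :=
  hΦ.norm_iterate_sub_le (by positivity) _ _ _

/-- In Kobayashi's estimate the elapsed time of each scheme differs from t by at most one step l,
and the variance term is at most t·l. -/
lemma cauchySeq_euler_of_mem (hΦ : IsEnergy Φ) {t : ℝ} (ht : 0 ≤ t) {x w : H}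
    (hw : w ∈ subdiff Φ x) : CauchySeq fun k => euler Φ k t x := by
  have hle : ∀ j k, ‖euler Φ j t x - euler Φ k t x‖ ^ 2 ≤
      ‖w‖ ^ 2 * ((1 / ((j : ℝ) + 1) + 1 / ((k : ℝ) + 1)) ^ 2 + t * (1 / ((j : ℝ) + 1)) +
        t * (1 / ((k : ℝ) + 1))) := by
    intro j k
    refine (hΦ.kobayashi (by positivity) (by positivity) hw _ _).trans ?_
    gcongr ?_ * (?_ + ?_ + ?_)
    · rw [sq_le_sq]
      have h1 := abs_floor_step_sub_le ht j
      have h2 := abs_floor_step_sub_le ht k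
      rw [abs_of_nonneg (show 0 ≤ 1 / ((j : ℝ) + 1) + 1 / ((k : ℝ) + 1) by positivity)]
      refine (abs_sub_le _ t _).trans (add_le_add h1 ?_)
      rwa [abs_sub_comm]
    · rw [pow_two, ← mul_assoc]
      gcongr
      exact floor_step_le ht j
    · rw [pow_two, ← mul_assoc]
      gcongr
      exact floor_step_le ht k
  rw [Metric.cauchySeq_iff']
  intro ε hε
  have hlim : Tendsto (fun k : ℕ => ‖w‖ ^ 2 * ((1 / ((k : ℝ) + 1) + 1 / ((k : ℝ) + 1)) ^ 2 +
      t * (1 / ((k : ℝ) + 1)) + t * (1 / ((k : ℝ) + 1)))) atTop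
      (𝓝 (‖w‖ ^ 2 * ((0 + 0) ^ 2 + t * 0 + t * 0))) :=
    tendsto_const_nhds.mul (((((tendsto_step.add tendsto_step).pow 2)).add
      (tendsto_step.const_mul t)).add (tendsto_step.const_mul t))
  norm_num only at hlim
  rw [mul_zero, add_zero, add_zero, mul_zero] at hlim
  obtain ⟨K, hK⟩ := (hlim.eventually (gt_mem_nhds (show 0 < ε ^ 2 by positivity))).exists
  refine ⟨K, fun j hj => ?_⟩
  rw [dist_eq_norm]
  refine lt_of_pow_lt_pow_left₀ 2 hε.le (lt_of_le_of_lt ((hle j K).trans ?_) hK)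
  have : 1 / ((j : ℝ) + 1) ≤ 1 / ((K : ℝ) + 1) := Nat.one_div_le_one_div hj
  gcongr

/-- An ε/3 argument: the Euler maps are uniformly contractive, and convergence is known on the dense
domain of the subdifferential. -/
lemma cauchySeq_euler (hΦ : IsEnergy Φ) {t : ℝ} (ht : 0 ≤ t) (x : H) :
    CauchySeq fun k => euler Φ k t x := by
  rw [Metric.cauchySeq_iff']
  intro ε hε
  obtain ⟨z, ⟨w, hw⟩, hz⟩ := Metric.mem_closure_iff.1 (hΦ.dense_dom_subdiff x) (ε / 3)
    (by positivity)
  obtain ⟨K, hK⟩ := Metric.cauchySeq_iff'.1 (hΦ.cauchySeq_euler_of_mem ht hw) (ε / 3)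
    (by positivity)
  refine ⟨K, fun j hj => ?_⟩
  have h1 := hΦ.norm_euler_sub_le j t x z
  have h2 := hΦ.norm_euler_sub_le K t z x
  rw [← dist_eq_norm, ← dist_eq_norm] at h1 h2
  rw [dist_comm z x] at h2
  have h3 := dist_triangle4 (euler Φ j t x) (euler Φ j t z) (euler Φ K t z) (euler Φ K t x)
  linarith [hK j hj]

lemma tendsto_euler (hΦ : IsEnergy Φ) {t : ℝ} (ht : 0 ≤ t) (x : H) :
    Tendsto (fun k => euler Φ k t x) atTop (𝓝 (flow Φ t x)) :=
  (hΦ.cauchySeq_euler ht x).tendsto_limUnder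

lemma norm_flow_sub_le (hΦ : IsEnergy Φ) {t : ℝ} (ht : 0 ≤ t) (x y : H) :
    ‖flow Φ t x - flow Φ t y‖ ≤ ‖x - y‖ :=
  le_of_tendsto' ((hΦ.tendsto_euler ht x).sub (hΦ.tendsto_euler ht y)).norm
    fun k => hΦ.norm_euler_sub_le k t x y

lemma continuous_flow (hΦ : IsEnergy Φ) {t : ℝ} (ht : 0 ≤ t) : Continuous (flow Φ t) :=
  (LipschitzWith.of_dist_le_mul (K := 1) fun a b => by
    simpa [dist_eq_norm] using hΦ.norm_flow_sub_le ht a b).continuous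

/-- Limit of Kobayashi's estimate with equal steps at two times; the variance terms vanish and (t -
s)²‖w‖² is left. -/
lemma norm_flow_sub_flow_le (hΦ : IsEnergy Φ) {s t : ℝ} (hs : 0 ≤ s) (ht : 0 ≤ t) {x w : H}
    (hw : w ∈ subdiff Φ x) : ‖flow Φ t x - flow Φ s x‖ ≤ ‖w‖ * |t - s| := by
  have hlim : Tendsto (fun k : ℕ => ‖w‖ ^ 2 * (((⌊t * ((k : ℝ) + 1)⌋₊ : ℝ) * (1 / ((k : ℝ) + 1)) -
      (⌊s * ((k : ℝ) + 1)⌋₊ : ℝ) * (1 / ((k : ℝ) + 1))) ^ 2 +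
      (⌊t * ((k : ℝ) + 1)⌋₊ : ℝ) * (1 / ((k : ℝ) + 1)) ^ 2 +
      (⌊s * ((k : ℝ) + 1)⌋₊ : ℝ) * (1 / ((k : ℝ) + 1)) ^ 2)) atTop
      (𝓝 (‖w‖ ^ 2 * ((t - s) ^ 2 + t * 0 + s * 0))) := by
    simp only [pow_two (1 / (_ : ℝ)), ← mul_assoc]
    exact tendsto_const_nhds.mul (((((tendsto_floor_step ht).sub (tendsto_floor_step hs)).pow 2).add
      ((tendsto_floor_step ht).mul tendsto_step)).add ((tendsto_floor_step hs).mul tendsto_step))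
  have h := le_of_tendsto_of_tendsto'
    ((((hΦ.tendsto_euler ht x).sub (hΦ.tendsto_euler hs x)).norm).pow 2) hlim
    fun k => hΦ.kobayashi (by positivity) (by positivity) hw _ _
  rw [mul_zero, mul_zero, add_zero, add_zero, ← sq_abs (t - s), ← mul_pow] at h
  exact le_of_sq_le_sq h (by positivity)

lemma continuousOn_flow (hΦ : IsEnergy Φ) (x : H) : ContinuousOn (fun t => flow Φ t x) (Ici 0) := by
  rw [Metric.continuousOn_iff]
  intro t ht ε hε
  obtain ⟨z, ⟨w, hw⟩, hz⟩ := Metric.mem_closure_iff.1 (hΦ.dense_dom_subdiff x) (ε / 3)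
    (by positivity)
  refine ⟨ε / 3 / (‖w‖ + 1), by positivity, fun s hs hst => ?_⟩
  have h1 := hΦ.norm_flow_sub_le hs x z
  have h2 := hΦ.norm_flow_sub_le ht z x
  have h3 := hΦ.norm_flow_sub_flow_le ht hs hw
  rw [← dist_eq_norm, ← dist_eq_norm] at h1 h2
  rw [dist_comm z x] at h2
  rw [← dist_eq_norm, ← Real.dist_eq] at h3
  have h4 : ‖w‖ * dist s t ≤ ε / 3 := by
    rw [lt_div_iff₀ (by positivity)] at hst
    nlinarith [dist_nonneg (x := s) (y := t)]
  have h5 := dist_triangle4 (flow Φ s x) (flow Φ s z) (flow Φ t z) (flow Φ t x)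
  linarith

lemma flow_zero (hΦ : IsEnergy Φ) (x : H) : flow Φ 0 x = x := by
  refine tendsto_nhds_unique (hΦ.tendsto_euler le_rfl x) ?_
  simp [euler]

/-- The numbers of steps for t and s need not add up to the number for t + s because of rounding.
Kobayashi's estimate with equal step sizes shows that the discrepancy is negligible. -/
lemma flow_add_of_mem (hΦ : IsEnergy Φ) {s t : ℝ} (hs : 0 ≤ s) (ht : 0 ≤ t) {x w : H}
    (hw : w ∈ subdiff Φ x) : flow Φ (t + s) x = flow Φ t (flow Φ s x) := by
  have h1 : Tendsto (fun k => euler Φ k t (euler Φ k s x)) atTop (𝓝 (flow Φ t (flow Φ s x))) := by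
    rw [tendsto_iff_norm_sub_tendsto_zero]
    have h2 := tendsto_iff_norm_sub_tendsto_zero.1 (hΦ.tendsto_euler hs x)
    have h3 := tendsto_iff_norm_sub_tendsto_zero.1 (hΦ.tendsto_euler ht (flow Φ s x))
    refine squeeze_zero (fun _ => norm_nonneg _) (fun k => ?_) (by simpa using h2.add h3)
    exact (norm_sub_le_norm_sub_add_norm_sub _ (euler Φ k t (flow Φ s x)) _).trans
      (add_le_add (hΦ.norm_euler_sub_le k t _ _) le_rfl)
  refine tendsto_nhds_unique (hΦ.tendsto_euler (add_nonneg ht hs) x) ?_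
  refine h1.congr_dist ?_
  have hle : ∀ k : ℕ, ‖euler Φ k t (euler Φ k s x) - euler Φ k (t + s) x‖ ^ 2 ≤
      ‖w‖ ^ 2 * ((((⌊t * ((k : ℝ) + 1)⌋₊ : ℝ) * (1 / ((k : ℝ) + 1)) +
      (⌊s * ((k : ℝ) + 1)⌋₊ : ℝ) * (1 / ((k : ℝ) + 1))) -
      (⌊(t + s) * ((k : ℝ) + 1)⌋₊ : ℝ) * (1 / ((k : ℝ) + 1))) ^ 2 +
      ((⌊t * ((k : ℝ) + 1)⌋₊ : ℝ) * (1 / ((k : ℝ) + 1)) +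
      (⌊s * ((k : ℝ) + 1)⌋₊ : ℝ) * (1 / ((k : ℝ) + 1))) * (1 / ((k : ℝ) + 1)) +
      (⌊(t + s) * ((k : ℝ) + 1)⌋₊ : ℝ) * (1 / ((k : ℝ) + 1)) * (1 / ((k : ℝ) + 1))) := by
    intro k
    have h := hΦ.kobayashi (l := 1 / ((k : ℝ) + 1)) (m := 1 / ((k : ℝ) + 1)) (by positivity)
      (by positivity) hw (⌊t * ((k : ℝ) + 1)⌋₊ + ⌊s * ((k : ℝ) + 1)⌋₊) ⌊(t + s) * ((k : ℝ) + 1)⌋₊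
    rw [Function.iterate_add_apply] at h
    refine h.trans (le_of_eq ?_)
    push_cast
    ring
  have hts := add_nonneg ht hs
  have hlim := tendsto_const_nhds (x := ‖w‖ ^ 2) (f := atTop (α := ℕ)) |>.mul
    ((((((tendsto_floor_step ht).add (tendsto_floor_step hs)).sub
      (tendsto_floor_step hts)).pow 2).add
      (((tendsto_floor_step ht).add (tendsto_floor_step hs)).mul tendsto_step)).add
      ((tendsto_floor_step hts).mul tendsto_step))
  simp only [sub_self, mul_zero, add_zero, zero_pow two_ne_zero] at hlim
  have hsq := squeeze_zero (fun _ => by positivity) hle hlim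
  have := hsq.sqrt
  simpa [Real.sqrt_sq, dist_eq_norm] using this

lemma flow_add (hΦ : IsEnergy Φ) {s t : ℝ} (hs : 0 ≤ s) (ht : 0 ≤ t) (x : H) :
    flow Φ (t + s) x = flow Φ t (flow Φ s x) := by
  have hcl : IsClosed {x | flow Φ (t + s) x = flow Φ t (flow Φ s x)} :=
    isClosed_eq (hΦ.continuous_flow (add_nonneg ht hs))
      ((hΦ.continuous_flow ht).comp (hΦ.continuous_flow hs))
  have hsub : {x | (subdiff Φ x).Nonempty} ⊆ {x | flow Φ (t + s) x = flow Φ t (flow Φ s x)} :=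
    fun x ⟨w, hw⟩ => hΦ.flow_add_of_mem hs ht hw
  exact hcl.closure_subset_iff.2 hsub (hΦ.dense_dom_subdiff x)

/-- Limit of the smoothing estimate: the factor in front of the squared norm tends to t². The bound
does not depend on l, which is what places the flow in the domain of the subdifferential. -/
lemma norm_yosida_flow_le (hΦ : IsEnergy Φ) {t : ℝ} (ht : 0 < t) {l : ℝ} (hl : 0 < l) (x : H) :
    ‖yosida Φ l (flow Φ t x)‖ ≤ ‖x‖ / t := by
  have h1 : Tendsto (fun k => ‖yosida Φ l (euler Φ k t x)‖ ^ 2) atTop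
      (𝓝 (‖yosida Φ l (flow Φ t x)‖ ^ 2)) :=
    (((hΦ.continuous_yosida hl).tendsto _).comp (hΦ.tendsto_euler ht.le x)).norm.pow 2
  have h2 := (((tendsto_floor_step ht.le).mul
    ((tendsto_floor_step ht.le).sub tendsto_step)).mul h1)
  have h3 := le_of_tendsto' h2 fun k => hΦ.norm_yosida_iterate_le (by positivity) hl x _
  rw [sub_zero, ← pow_two, ← mul_pow] at h3
  rw [le_div_iff₀ ht, mul_comm]
  exact le_of_sq_le_sq h3 (norm_nonneg _)

/-! ### The minimal section -/

/-- With A_l, A_m the Yosida approximations, the resolvents differ by (m - l)A_m - l(A_l - A_m), so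
monotonicity yields ⟨A_l - A_m, A_m⟩ ≥ 0. Thus ‖A_l‖² increases as l decreases, and its increments
control the distances; if bounded, the family is Cauchy. -/
lemma norm_yosida_sub_sq_le (hΦ : IsEnergy Φ) {l m : ℝ} (hl : 0 < l) (hlm : l ≤ m) (y : H) :
    ‖yosida Φ l y - yosida Φ m y‖ ^ 2 ≤ ‖yosida Φ l y‖ ^ 2 - ‖yosida Φ m y‖ ^ 2 := by
  have hm := hl.trans_le hlm
  have h := hΦ.subdiff_monotone (hΦ.yosida_mem hl y) (hΦ.yosida_mem hm y)
  rcases hlm.eq_or_lt with rfl | hlt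
  · simp
  have e : resolvent Φ l y - resolvent Φ m y =
      (m - l) • yosida Φ m y - l • (yosida Φ l y - yosida Φ m y) := by
    rw [resolvent_eq hl, resolvent_eq hm]; module
  rw [e, inner_sub_right, inner_smul_right, inner_smul_right, real_inner_self_eq_norm_sq] at h
  have h1 : 0 ≤ (m - l) * inner ℝ (yosida Φ l y - yosida Φ m y) (yosida Φ m y) := by
    nlinarith [mul_nonneg hl.le (sq_nonneg ‖yosida Φ l y - yosida Φ m y‖)]
  have h2 := nonneg_of_mul_nonneg_right h1 (sub_pos.2 hlt)
  rw [inner_sub_left, real_inner_self_eq_norm_sq] at h2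
  rw [norm_sub_sq_real]
  linarith

lemma cauchySeq_yosida (hΦ : IsEnergy Φ) {y : H} {C : ℝ}
    (hC : ∀ l, 0 < l → ‖yosida Φ l y‖ ≤ C) :
    CauchySeq fun k : ℕ => yosida Φ (1 / ((k : ℝ) + 1)) y := by
  have hle : ∀ j k : ℕ, j ≤ k → ‖yosida Φ (1 / ((k : ℝ) + 1)) y - yosida Φ (1 / ((j : ℝ) + 1)) y‖ ^ 2
      ≤ ‖yosida Φ (1 / ((k : ℝ) + 1)) y‖ ^ 2 - ‖yosida Φ (1 / ((j : ℝ) + 1)) y‖ ^ 2 :=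
    fun j k hjk => hΦ.norm_yosida_sub_sq_le (by positivity) (Nat.one_div_le_one_div hjk) y
  have hmono : Monotone fun k : ℕ => ‖yosida Φ (1 / ((k : ℝ) + 1)) y‖ ^ 2 := fun j k hjk => by
    have := hle j k hjk
    have h0 := sq_nonneg ‖yosida Φ (1 / ((k : ℝ) + 1)) y - yosida Φ (1 / ((j : ℝ) + 1)) y‖
    dsimp only
    linarith
  have hbdd : BddAbove (range fun k : ℕ => ‖yosida Φ (1 / ((k : ℝ) + 1)) y‖ ^ 2) := by
    refine ⟨C ^ 2, ?_⟩
    rintro _ ⟨k, rfl⟩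
    exact pow_le_pow_left₀ (norm_nonneg _) (hC _ (by positivity)) 2
  have hcau := (tendsto_atTop_ciSup hmono hbdd).cauchySeq
  rw [Metric.cauchySeq_iff'] at hcau ⊢
  intro ε hε
  obtain ⟨K, hK⟩ := hcau (ε ^ 2) (by positivity)
  refine ⟨K, fun k hk => ?_⟩
  rw [dist_eq_norm]
  refine lt_of_pow_lt_pow_left₀ 2 hε.le (lt_of_le_of_lt (hle K k hk) ?_)
  have := hK k hk
  rw [Real.dist_eq] at this
  exact (le_abs_self _).trans_lt this

lemma tendsto_yosida (hΦ : IsEnergy Φ) {y : H} {C : ℝ}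
    (hC : ∀ l, 0 < l → ‖yosida Φ l y‖ ≤ C) :
    Tendsto (fun k : ℕ => yosida Φ (1 / ((k : ℝ) + 1)) y) atTop (𝓝 (minSection Φ y)) :=
  (hΦ.cauchySeq_yosida hC).tendsto_limUnder

/-- The Yosida approximations are subgradients at the resolvents y - l A_l y, which tend to y by
boundedness; the graph is closed. -/
lemma minSection_mem (hΦ : IsEnergy Φ) {y : H} {C : ℝ}
    (hC : ∀ l, 0 < l → ‖yosida Φ l y‖ ≤ C) : minSection Φ y ∈ subdiff Φ y := by
  have h := hΦ.tendsto_yosida hC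
  refine hΦ.subdiff_closed (x := fun k : ℕ => resolvent Φ (1 / ((k : ℝ) + 1)) y) ?_ h
    fun k => hΦ.yosida_mem (by positivity) y
  have h2 := tendsto_const_nhds (x := y) (f := atTop (α := ℕ)) |>.sub (tendsto_step.smul h)
  rw [zero_smul, sub_zero] at h2
  refine h2.congr fun k => ?_
  rw [resolvent_eq (by positivity)]

lemma norm_minSection_le (hΦ : IsEnergy Φ) {y : H} {C : ℝ}
    (hC : ∀ l, 0 < l → ‖yosida Φ l y‖ ≤ C) : ‖minSection Φ y‖ ≤ C :=
  le_of_tendsto' (hΦ.tendsto_yosida hC).norm fun k => hC _ (by positivity)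

lemma minSection_flow_mem (hΦ : IsEnergy Φ) {t : ℝ} (ht : 0 < t) (x : H) :
    minSection Φ (flow Φ t x) ∈ subdiff Φ (flow Φ t x) :=
  hΦ.minSection_mem fun _ hl => hΦ.norm_yosida_flow_le ht hl x

lemma norm_minSection_flow_le (hΦ : IsEnergy Φ) {t : ℝ} (ht : 0 < t) (x : H) :
    ‖minSection Φ (flow Φ t x)‖ ≤ ‖x‖ / t :=
  hΦ.norm_minSection_le fun _ hl => hΦ.norm_yosida_flow_le ht hl x

/-! ### Differentiability of the flow -/

/-- Discrete form of d/dt ‖S(t)y - v‖² ≤ 2⟨w, v - S(t)y⟩. In the pairing S(t)y is replaced by y, at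
the price of the distance travelled, at most (n s)‖a‖. -/
lemma euler_dist_sq_le (hΦ : IsEnergy Φ) {s : ℝ} (hs : 0 < s) {y a v w : H}
    (ha : a ∈ subdiff Φ y) (hw : w ∈ subdiff Φ v) (n : ℕ) :
    ‖(resolvent Φ s)^[n] y - v‖ ^ 2 ≤
      ‖y - v‖ ^ 2 + 2 * (n * s) * (inner ℝ w (v - y) + ‖w‖ * ((n * s) * ‖a‖)) := by
  suffices h : ∀ m : ℕ, m ≤ n → ‖(resolvent Φ s)^[m] y - v‖ ^ 2 ≤
      ‖y - v‖ ^ 2 + 2 * (m * s) * (inner ℝ w (v - y) + ‖w‖ * ((n * s) * ‖a‖)) from h n le_rfl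
  intro m
  induction m with
  | zero => simp
  | succ m ih =>
    intro hm
    have h0 := ih (Nat.le_of_succ_le hm)
    set z := (resolvent Φ s)^[m] y with hz
    set z' := (resolvent Φ s)^[m + 1] y with hz'
    have hz'e : z' = resolvent Φ s z := by rw [hz', Function.iterate_succ_apply']
    have h1 := hΦ.subdiff_monotone (hΦ.yosida_mem hs z) hw
    rw [← hz'e, inner_sub_left] at h1
    have h2 : z - v = (z' - v) + s • yosida Φ s z := by
      rw [← sub_resolvent hs, ← hz'e]; abel
    have h3 : ‖z' - v‖ ^ 2 + 2 * s * inner ℝ w (z' - v) ≤ ‖z - v‖ ^ 2 := by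
      rw [h2, norm_add_sq_real, inner_smul_right, real_inner_comm (yosida Φ s z)]
      nlinarith [sq_nonneg ‖s • yosida Φ s z‖]
    have h4 : inner ℝ w (v - z') ≤ inner ℝ w (v - y) + ‖w‖ * ((n * s) * ‖a‖) := by
      have e : v - z' = (v - y) - (z' - y) := by abel
      rw [e, inner_sub_right, sub_eq_add_neg]
      gcongr
      refine (neg_le_abs _).trans ((abs_real_inner_le_norm _ _).trans ?_)
      gcongr
      refine (hΦ.norm_iterate_sub_self_le hs ha (m + 1)).trans ?_
      gcongr
    have h5 : inner ℝ w (z' - v) = - inner ℝ w (v - z') := by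
      rw [← inner_neg_right, neg_sub]
    rw [h5] at h3
    push_cast
    nlinarith

lemma flow_dist_sq_le (hΦ : IsEnergy Φ) {h : ℝ} (hh : 0 ≤ h) {y a v w : H}
    (ha : a ∈ subdiff Φ y) (hw : w ∈ subdiff Φ v) :
    ‖flow Φ h y - v‖ ^ 2 ≤ ‖y - v‖ ^ 2 + 2 * h * (inner ℝ w (v - y) + ‖w‖ * (h * ‖a‖)) := by
  refine le_of_tendsto_of_tendsto' (((hΦ.tendsto_euler hh y).sub_const v).norm.pow 2) ?_
    fun k => hΦ.euler_dist_sq_le (by positivity) ha hw _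
  have h1 := tendsto_floor_step hh
  exact tendsto_const_nhds.add ((tendsto_const_nhds.mul h1).mul (tendsto_const_nhds.add
    (tendsto_const_nhds.mul (h1.mul_const _))))

/-- The difference quotients q have norm at most that of the minimal section b, while their pairing
with the Yosida approximation c is at least ‖c‖² up to a small error. As c → b in norm, q is
squeezed towards b. -/
lemma hasDerivWithinAt_flow_zero (hΦ : IsEnergy Φ) {y : H} {C : ℝ}
    (hC : ∀ l, 0 < l → ‖yosida Φ l y‖ ≤ C) :
    Tendsto (fun h : ℝ => h⁻¹ • (y - flow Φ h y)) (𝓝[>] 0) (𝓝 (minSection Φ y)) := by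
  set b := minSection Φ y with hb
  have hbm := hΦ.minSection_mem hC
  rw [← hb] at hbm
  have hq : ∀ h : ℝ, 0 < h → ‖h⁻¹ • (y - flow Φ h y)‖ ≤ ‖b‖ := by
    intro h hh
    have h1 := hΦ.norm_flow_sub_flow_le le_rfl hh.le hbm
    rw [hΦ.flow_zero, sub_zero, abs_of_pos hh] at h1
    rw [norm_smul, norm_inv, Real.norm_of_nonneg hh.le, norm_sub_rev, inv_mul_le_iff₀ hh]
    linarith
  -- The integral inequality is tested with the resolvent of y and its subgradient c, for which y -
  -- v = l c. It gives l(‖c‖² - ⟨c, q⟩) ≤ h‖b‖², and ‖q‖ ≤ ‖b‖ does the rest. Below, l is fixed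
  -- first and h tends to 0 afterwards.
  have hqa : ∀ h l : ℝ, 0 < h → 0 < l → ‖h⁻¹ • (y - flow Φ h y) - yosida Φ l y‖ ^ 2 ≤
      ‖b‖ ^ 2 - ‖yosida Φ l y‖ ^ 2 + 2 * h * ‖b‖ ^ 2 / l := by
    intro h l hh hl
    have h1 := hΦ.flow_dist_sq_le hh.le hbm (hΦ.yosida_mem hl y)
    set q := h⁻¹ • (y - flow Φ h y) with hqd
    set c := yosida Φ l y with hc
    have e1 : flow Φ h y - resolvent Φ l y = (y - resolvent Φ l y) - h • q := by
      rw [hqd, smul_smul, mul_inv_cancel₀ hh.ne', one_smul]; abel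
    rw [e1, norm_sub_sq_real, ← neg_sub y (resolvent Φ l y), sub_resolvent hl y, ← hc,
      inner_neg_right, inner_smul_right _ q, inner_smul_right c c, real_inner_self_eq_norm_sq,
      real_inner_smul_left] at h1
    have hcb : ‖c‖ ≤ ‖b‖ := hΦ.norm_yosida_le hl hbm
    have h2 : h * (l * (‖c‖ ^ 2 - inner ℝ c q)) ≤ h * (‖c‖ * (h * ‖b‖)) := by
      nlinarith [sq_nonneg ‖h • q‖]
    have h3 := le_of_mul_le_mul_left h2 hh
    have h4 : l * (‖c‖ ^ 2 - inner ℝ c q) ≤ h * ‖b‖ ^ 2 := by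
      refine h3.trans ?_
      have : ‖c‖ * (h * ‖b‖) ≤ ‖b‖ * (h * ‖b‖) := by gcongr
      linarith
    have h5 : ‖c‖ ^ 2 - inner ℝ c q ≤ h * ‖b‖ ^ 2 / l := by
      rw [le_div_iff₀ hl]; linarith
    have h6 : ‖q‖ ^ 2 ≤ ‖b‖ ^ 2 := by gcongr; exact hq h hh
    rw [norm_sub_sq_real, real_inner_comm]
    have h7 : 2 * h * ‖b‖ ^ 2 / l = 2 * (h * ‖b‖ ^ 2 / l) := by ring
    rw [h7]
    linarith
  rw [Metric.tendsto_nhds]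
  intro ε hε
  have hy := hΦ.tendsto_yosida hC
  rw [← hb] at hy
  have hy1 := hy.norm.pow 2
  have ev1 := hy.eventually (Metric.ball_mem_nhds b (show 0 < ε / 2 by positivity))
  have ev2 := hy1.eventually (lt_mem_nhds
    (show ‖b‖ ^ 2 - ε ^ 2 / 8 < ‖b‖ ^ 2 by linarith [show 0 < ε ^ 2 by positivity]))
  obtain ⟨k, hk1, hk2⟩ := (ev1.and ev2).exists
  set l : ℝ := 1 / ((k : ℝ) + 1) with hldef
  have hl : 0 < l := by positivity
  have ev3 : ∀ᶠ h : ℝ in 𝓝[>] 0, 2 * h * ‖b‖ ^ 2 / l < ε ^ 2 / 8 := by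
    have : Tendsto (fun h : ℝ => 2 * h * ‖b‖ ^ 2 / l) (𝓝[>] 0) (𝓝 (2 * 0 * ‖b‖ ^ 2 / l)) := by
      refine Tendsto.mono_left ?_ nhdsWithin_le_nhds
      exact (by fun_prop : Continuous fun h : ℝ => 2 * h * ‖b‖ ^ 2 / l).tendsto 0
    refine this.eventually (gt_mem_nhds ?_)
    simp; positivity
  filter_upwards [ev3, self_mem_nhdsWithin] with h hh3 hh0
  have h1 := hqa h l hh0 hl
  have h2 : ‖h⁻¹ • (y - flow Φ h y) - yosida Φ l y‖ < ε / 2 := by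
    refine lt_of_pow_lt_pow_left₀ 2 (by positivity) (h1.trans_lt ?_)
    have : (ε / 2) ^ 2 = ε ^ 2 / 4 := by ring
    rw [this]
    linarith
  rw [← dist_eq_norm] at h2
  have := dist_triangle (h⁻¹ • (y - flow Φ h y)) (yosida Φ l y) b
  linarith

/-- The semigroup property reduces this to time 0, with starting point S(t)x, where the smoothing
bound is available. -/
lemma hasDerivWithinAt_flow (hΦ : IsEnergy Φ) {t : ℝ} (ht : 0 < t) (x : H) :
    HasDerivWithinAt (fun s => flow Φ s x) (- minSection Φ (flow Φ t x)) (Ioi t) t := by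
  rw [hasDerivWithinAt_iff_tendsto_slope' (by simp)]
  have h := (hΦ.hasDerivWithinAt_flow_zero (y := flow Φ t x)
    fun _ hl => hΦ.norm_yosida_flow_le ht hl x).neg
  have hmap : Tendsto (fun s => s - t) (𝓝[>] t) (𝓝[>] 0) := by
    refine tendsto_nhdsWithin_iff.2 ⟨?_, ?_⟩
    · refine Tendsto.mono_left ?_ nhdsWithin_le_nhds
      simpa using (continuous_id.sub continuous_const).tendsto t (f := fun s : ℝ => s - t)
    · filter_upwards [self_mem_nhdsWithin] with s hs using sub_pos.2 (mem_Ioi.1 hs)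
  refine (h.comp hmap).congr' ?_
  filter_upwards [self_mem_nhdsWithin] with s hs
  have hst : 0 ≤ s - t := (sub_pos.2 (mem_Ioi.1 hs)).le
  simp only [Function.comp, slope, vsub_eq_sub]
  rw [← hΦ.flow_add ht.le hst x, sub_add_cancel, ← smul_neg, neg_sub]

end IsEnergy

end Flow

/-! ### Weak derivatives in time: existence and uniqueness of solutions -/

section WeakDeriv

variable {H : Type*} [NormedAddCommGroup H] [InnerProductSpace ℝ H]

lemma IsTest.exists_Ioo {η : ℝ → ℝ} (hη : IsTest (Ioi (0 : ℝ)) η) :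
    ∃ a b : ℝ, 0 < a ∧ a < b ∧ tsupport η ⊆ Ioo a b := by
  have hK : IsCompact (tsupport η) := hη.hasCompactSupport
  rcases (tsupport η).eq_empty_or_nonempty with h | h
  · exact ⟨1, 2, one_pos, one_lt_two, by simp [h]⟩
  · obtain ⟨m, hm, hmin⟩ := hK.exists_isLeast h
    obtain ⟨M, hM, hmax⟩ := hK.exists_isGreatest h
    have hm0 : 0 < m := hη.tsupport_subset hm
    have hmM : m ≤ M := hmin hM
    exact ⟨m / 2, M + 1, by positivity, by linarith,
      fun x hx => ⟨by linarith [hmin hx], by linarith [hmax hx]⟩⟩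

lemma integral_Ioi_eq_intervalIntegral {f : ℝ → H} {a b : ℝ} (ha : 0 < a) (hab : a ≤ b)
    (hf : ∀ x, x ∉ Icc a b → f x = 0) : ∫ t in Ioi (0 : ℝ), f t = ∫ t in a..b, f t := by
  rw [intervalIntegral.integral_of_le hab, ← integral_Icc_eq_integral_Ioc]
  exact setIntegral_eq_of_subset_of_forall_sdiff_eq_zero measurableSet_Ioi
    (fun x hx => lt_of_lt_of_le ha hx.1) fun x hx => hf x hx.2

/-- The weak derivative is minus the minimal section. Integration by parts needs only the
fundamental theorem of calculus for continuous functions with an integrable right derivative, so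
differentiability almost everywhere of Lipschitz curves is not required. -/
lemma IsSemigroupSolution.flow [CompleteSpace H] {Φ : H → EReal} (hΦ : IsEnergy Φ) (x : H) :
    IsSemigroupSolution Φ x (fun t => flow Φ t x) where
  continuousOn := hΦ.continuousOn_flow x
  mem_dom t ht := ⟨_, hΦ.minSection_flow_mem ht x⟩
  initial := hΦ.flow_zero x
  inclusion := by
    have hcont := hΦ.continuousOn_flow x
    have hmeas : AEStronglyMeasurable (fun t => - minSection Φ (CriticalFlow.flow Φ t x))
        (volume.restrict (Ioi (0 : ℝ))) := by
      refine AEStronglyMeasurable.neg ?_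
      -- The minimal section along the flow is a pointwise limit of Yosida approximations, each of
      -- them continuous in t.
      refine aestronglyMeasurable_of_tendsto_ae atTop
        (f := fun k : ℕ => fun t => yosida Φ (1 / ((k : ℝ) + 1)) (CriticalFlow.flow Φ t x)) ?_ ?_
      · intro k
        refine ContinuousOn.aestronglyMeasurable ?_ measurableSet_Ioi
        exact (hΦ.continuous_yosida (by positivity)).comp_continuousOn
          (hcont.mono Ioi_subset_Ici_self)
      · filter_upwards [ae_restrict_mem measurableSet_Ioi] with t ht
        exact hΦ.tendsto_yosida fun _ hl => hΦ.norm_yosida_flow_le ht hl x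
    have hbound : ∀ a b : ℝ, 0 < a → ∀ᵐ t ∂volume.restrict (Icc a b),
        ‖- minSection Φ (CriticalFlow.flow Φ t x)‖ ≤ ‖x‖ / a := by
      intro a b ha
      filter_upwards [ae_restrict_mem measurableSet_Icc] with t ht
      rw [norm_neg]
      refine (hΦ.norm_minSection_flow_le (ha.trans_le ht.1) x).trans ?_
      gcongr
      exact ht.1
    refine ⟨fun t => - minSection Φ (CriticalFlow.flow Φ t x), ⟨hmeas, ?_, ?_⟩, ?_⟩
    · exact fun a b ha _ => ⟨_, hbound a b ha⟩
    · intro η hη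
      obtain ⟨a, b, ha, hab, hsub⟩ := hη.exists_Ioo
      have hz : ∀ r, r ∉ Ioo a b → η r = 0 := fun r hr =>
        image_eq_zero_of_notMem_tsupport fun h => hr (hsub h)
      have hz' : ∀ r, r ∉ Ioo a b → deriv η r = 0 := fun r hr =>
        image_eq_zero_of_notMem_tsupport fun h => hr (hsub ((tsupport_deriv_subset (𝕜 := ℝ)) h))
      have hout : ∀ r, r ∉ Icc a b → r ∉ Ioo a b := fun r hr h => hr (Ioo_subset_Icc_self h)
      rw [integral_Ioi_eq_intervalIntegral ha hab.le (fun r hr => by rw [hz' r (hout r hr), zero_smul]),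
        integral_Ioi_eq_intervalIntegral ha hab.le (fun r hr => by rw [hz r (hout r hr), zero_smul])]
      have hsubI : Icc a b ⊆ Ici (0 : ℝ) := fun r hr => ha.le.trans hr.1
      have hderivc : Continuous (deriv η) := hη.contDiff.continuous_deriv le_rfl
      have hint1 : IntervalIntegrable (fun t => deriv η t • CriticalFlow.flow Φ t x) volume a b := by
        refine ContinuousOn.intervalIntegrable ?_
        rw [uIcc_of_le hab.le]
        exact hderivc.continuousOn.smul (hcont.mono hsubI)
      have hint0 : IntegrableOn (fun t => - minSection Φ (CriticalFlow.flow Φ t x)) (Icc a b) :=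
        IntegrableOn.of_bound measure_Icc_lt_top
          (hmeas.mono_set fun r (hr : r ∈ Icc a b) => ha.trans_le hr.1) _ (hbound a b ha)
      have hint2 : IntervalIntegrable (fun t => η t • - minSection Φ (CriticalFlow.flow Φ t x))
          volume a b := by
        rw [intervalIntegrable_iff_integrableOn_Icc_of_le hab.le]
        exact hint0.continuousOn_smul hη.contDiff.continuous.continuousOn isCompact_Icc
      have hftc := intervalIntegral.integral_eq_sub_of_hasDeriv_right_of_le hab.le
        (f := fun t => η t • CriticalFlow.flow Φ t x)
        (hη.contDiff.continuous.continuousOn.smul (hcont.mono hsubI))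
        (fun r hr => ((hη.contDiff.differentiable one_ne_zero r).hasDerivAt.hasDerivWithinAt).smul
          (hΦ.hasDerivWithinAt_flow (ha.trans hr.1) x)) (hint2.add hint1)
      rw [intervalIntegral.integral_add hint2 hint1, hz a (by simp), hz b (by simp)] at hftc
      simp only [zero_smul, sub_zero] at hftc
      exact eq_neg_of_add_eq_zero_right hftc
    · filter_upwards [ae_restrict_mem measurableSet_Ioi] with t ht
      rw [neg_neg]
      exact hΦ.minSection_flow_mem ht x

/-! ### The fundamental theorem of calculus for weak derivatives -/

lemma deriv_smoothTransition_eq_zero {x : ℝ} (hx : x ∉ Icc (0 : ℝ) 1) :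
    deriv Real.smoothTransition x = 0 := by
  rw [mem_Icc, not_and_or, not_le, not_le] at hx
  rcases hx with hx | hx
  · have : Real.smoothTransition =ᶠ[𝓝 x] fun _ => 0 := by
      filter_upwards [gt_mem_nhds hx] with y hy using Real.smoothTransition.zero_of_nonpos hy.le
    rw [this.deriv_eq, deriv_const]
  · have : Real.smoothTransition =ᶠ[𝓝 x] fun _ => 1 := by
      filter_upwards [lt_mem_nhds hx] with y hy using Real.smoothTransition.one_of_one_le hy.le
    rw [this.deriv_eq, deriv_const]

lemma continuous_deriv_smoothTransition : Continuous (deriv Real.smoothTransition) :=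
  (Real.smoothTransition.contDiff (n := 1)).continuous_deriv le_rfl

/-- The derivatives of steep smooth steps starting at s form an approximate identity to the right of
s. Rescaling turns the integrals into a parameter integral over [0, 1] that is continuous at h = 0.
-/
lemma tendsto_integral_deriv_step [CompleteSpace H] {u : ℝ → H} (hu : ContinuousOn u (Ici 0))
    {s : ℝ} (hs : 0 < s) :
    Tendsto (fun k : ℕ => ∫ r in Ioi (0 : ℝ),
      (((k : ℝ) + 1) * deriv Real.smoothTransition (((k : ℝ) + 1) * (r - s))) • u r) atTop
      (𝓝 (u s)) := by
  set v : ℝ → H := fun r => u (max r 0) with hv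
  have hvc : Continuous v := hu.comp_continuous (by fun_prop) fun r => le_max_right r 0
  set A : ℝ → H := fun h => ∫ y in (0 : ℝ)..1, deriv Real.smoothTransition y • v (s + h * y) with hA
  have hAc : Continuous A := by
    refine intervalIntegral.continuous_parametric_intervalIntegral_of_continuous' ?_ 0 1
    exact (continuous_deriv_smoothTransition.comp continuous_snd).smul
      (hvc.comp (by fun_prop))
  have hA0 : A 0 = u s := by
    simp only [hA, zero_mul, add_zero]
    rw [intervalIntegral.integral_smul_const,
      intervalIntegral.integral_deriv_eq_sub (fun x _ =>
        (Real.smoothTransition.contDiff (n := 1)).differentiable one_ne_zero x)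
        (continuous_deriv_smoothTransition.intervalIntegrable _ _)]
    simp [hv, max_eq_left hs.le]
  have hlim := (hAc.tendsto 0).comp tendsto_step
  rw [hA0] at hlim
  refine hlim.congr fun k => ?_
  have hk : (0 : ℝ) < (k : ℝ) + 1 := by positivity
  have hkk : ((k : ℝ) + 1) * (1 / ((k : ℝ) + 1)) = 1 := by field_simp
  rw [integral_Ioi_eq_intervalIntegral (a := s) (b := s + 1 / ((k : ℝ) + 1)) hs
    (by have : 0 < 1 / ((k : ℝ) + 1) := by positivity
        linarith)]
  · have h1 : ∫ r in s..(s + 1 / ((k : ℝ) + 1)),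
        (((k : ℝ) + 1) * deriv Real.smoothTransition (((k : ℝ) + 1) * (r - s))) • u r =
        ∫ r in s..(s + 1 / ((k : ℝ) + 1)), ((k : ℝ) + 1) • (fun y =>
          deriv Real.smoothTransition y • v (s + 1 / ((k : ℝ) + 1) * y)) (((k : ℝ) + 1) * r -
            ((k : ℝ) + 1) * s) := by
      refine intervalIntegral.integral_congr fun r hr => ?_
      rw [uIcc_of_le (by have : 0 < 1 / ((k : ℝ) + 1) := by positivity
                         linarith)] at hr
      have e : s + 1 / ((k : ℝ) + 1) * (((k : ℝ) + 1) * r - ((k : ℝ) + 1) * s) = r := by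
        field_simp; ring
      dsimp only
      rw [e, hv]
      dsimp only
      rw [max_eq_left (hs.le.trans hr.1), smul_smul, mul_sub]
    rw [h1, intervalIntegral.integral_smul]
    have h2 := intervalIntegral.smul_integral_comp_mul_sub (a := s) (b := s + 1 / ((k : ℝ) + 1))
      (fun y => deriv Real.smoothTransition y • v (s + 1 / ((k : ℝ) + 1) * y)) ((k : ℝ) + 1)
      (((k : ℝ) + 1) * s)
    rw [mul_add, hkk, add_sub_cancel_left, sub_self] at h2
    exact h2.symm
  · intro r hr
    rw [deriv_smoothTransition_eq_zero, mul_zero, zero_smul]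
    rw [mem_Icc] at hr ⊢
    intro h
    refine hr ⟨?_, ?_⟩
    · have := nonneg_of_mul_nonneg_right h.1 hk
      linarith
    · have h3 : r - s ≤ 1 / ((k : ℝ) + 1) := by
        rw [le_div_iff₀ hk, mul_comm]
        exact h.2
      linarith

/-- These test functions are the smoothed indicators of the interval (s, t]. -/
lemma isTest_step {s t : ℝ} (hs : 0 < s) (hst : s ≤ t) (k : ℕ) :
    IsTest (Ioi (0 : ℝ)) fun r => Real.smoothTransition (((k : ℝ) + 1) * (r - s)) -
      Real.smoothTransition (((k : ℝ) + 1) * (r - t)) := by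
  have hk : (0 : ℝ) < (k : ℝ) + 1 := by positivity
  have hsupp : tsupport (fun r => Real.smoothTransition (((k : ℝ) + 1) * (r - s)) -
      Real.smoothTransition (((k : ℝ) + 1) * (r - t))) ⊆ Icc s (t + 1) := by
    refine closure_minimal (fun r hr => ?_) isClosed_Icc
    by_contra hc
    rw [mem_Icc, not_and_or, not_le, not_le] at hc
    refine hr ?_
    dsimp only
    rcases hc with hc | hc
    · rw [Real.smoothTransition.zero_of_nonpos (by nlinarith),
        Real.smoothTransition.zero_of_nonpos (by nlinarith), sub_self]
    · have : (0 : ℝ) ≤ k := Nat.cast_nonneg k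
      rw [Real.smoothTransition.one_of_one_le (by nlinarith),
        Real.smoothTransition.one_of_one_le (by nlinarith), sub_self]
  refine ⟨?_, HasCompactSupport.of_support_subset_isCompact isCompact_Icc
    ((subset_tsupport _).trans hsupp), hsupp.trans fun r hr => hs.trans_le hr.1⟩
  have h := Real.smoothTransition.contDiff (n := 1)
  exact (h.comp (by fun_prop)).sub (h.comp (by fun_prop))

lemma HasWeakDerivLoc.integrableOn {u u' : ℝ → H} (h : HasWeakDerivLoc u u') {a b : ℝ}
    (ha : 0 < a) : IntegrableOn u' (Icc a b) := by
  -- The right end point is enlarged because the local bounds are given on nondegenerate intervals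
  -- only.
  obtain ⟨C, hC⟩ := h.locallyBounded a (max (a + 1) b) ha (by simp)
  refine IntegrableOn.of_bound measure_Icc_lt_top
    (h.aestronglyMeasurable.mono_set fun r (hr : r ∈ Icc a b) => ha.trans_le hr.1) C ?_
  exact ae_mono (Measure.restrict_mono (Icc_subset_Icc_right (le_max_right _ _)) le_rfl) hC

/-- The weak formulation is tested with smoothed indicators of (s, t]: on the left the derivatives
of the two steps concentrate at s and t, on the right dominated convergence applies. -/
lemma HasWeakDerivLoc.integral_eq_sub [CompleteSpace H] {u u' : ℝ → H} (h : HasWeakDerivLoc u u')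
    (hu : ContinuousOn u (Ici 0)) {s t : ℝ} (hs : 0 < s) (hst : s ≤ t) :
    ∫ r in s..t, u' r = u t - u s := by
  set η : ℕ → ℝ → ℝ := fun k r => Real.smoothTransition (((k : ℝ) + 1) * (r - s)) -
      Real.smoothTransition (((k : ℝ) + 1) * (r - t)) with hη
  have hσ := (Real.smoothTransition.contDiff (n := 1)).differentiable one_ne_zero
  have hd : ∀ (k : ℕ) (c r : ℝ), HasDerivAt
      (fun r => Real.smoothTransition (((k : ℝ) + 1) * (r - c)))
      (((k : ℝ) + 1) * deriv Real.smoothTransition (((k : ℝ) + 1) * (r - c))) r := by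
    intro k c r
    have h1 : HasDerivAt (fun r => ((k : ℝ) + 1) * (r - c)) ((k : ℝ) + 1) r := by
      simpa using ((hasDerivAt_id r).sub_const c).const_mul ((k : ℝ) + 1)
    rw [mul_comm]
    exact (hσ _).hasDerivAt.comp r h1
  have hint : ∀ (k : ℕ) (c : ℝ), 0 < c → IntegrableOn (fun r =>
      (((k : ℝ) + 1) * deriv Real.smoothTransition (((k : ℝ) + 1) * (r - c))) • u r) (Ioi 0) := by
    intro k c hc
    have hk : (0 : ℝ) < (k : ℝ) + 1 := by positivity
    have h1 : IntegrableOn (fun r => (((k : ℝ) + 1) *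
        deriv Real.smoothTransition (((k : ℝ) + 1) * (r - c))) • u r) (Icc c (c + 1)) := by
      refine ContinuousOn.integrableOn_Icc ?_
      refine ContinuousOn.smul ?_ (hu.mono fun r hr => hc.le.trans hr.1)
      exact (continuous_const.mul
        (continuous_deriv_smoothTransition.comp (by fun_prop))).continuousOn
    refine h1.of_forall_sdiff_eq_zero measurableSet_Ioi fun r hr => ?_
    rw [deriv_smoothTransition_eq_zero, mul_zero, zero_smul]
    intro hc'
    refine hr.2 ⟨?_, ?_⟩
    · have := nonneg_of_mul_nonneg_right hc'.1 hk
      linarith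
    · have h2 := hc'.2
      have : (0 : ℝ) ≤ k := Nat.cast_nonneg k
      by_contra h3
      nlinarith
  have hL : Tendsto (fun k => ∫ r in Ioi (0 : ℝ), deriv (η k) r • u r) atTop (𝓝 (u s - u t)) := by
    refine ((tendsto_integral_deriv_step hu hs).sub
      (tendsto_integral_deriv_step hu (hs.trans_le hst))).congr fun k => ?_
    rw [← integral_sub (hint k s hs) (hint k t (hs.trans_le hst))]
    refine integral_congr_ae (Eventually.of_forall fun r => ?_)
    have e : deriv (η k) r = _ := ((hd k s r).sub (hd k t r)).deriv
    dsimp only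
    rw [e, sub_smul]
  have hR : Tendsto (fun k => ∫ r in Ioi (0 : ℝ), η k r • u' r) atTop (𝓝 (∫ r in s..t, u' r)) := by
    rw [intervalIntegral.integral_of_le hst]
    have e : ∫ r in Ioc s t, u' r = ∫ r in Ioi (0 : ℝ), (Ioc s t).indicator u' r := by
      rw [setIntegral_indicator measurableSet_Ioc, inter_eq_self_of_subset_right]
      exact fun r hr => hs.trans hr.1
    rw [e]
    refine tendsto_integral_of_dominated_convergence
      (fun r => (Icc s (t + 1)).indicator (fun r => ‖u' r‖) r) (fun k => ?_) ?_ (fun k => ?_) ?_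
    · exact (isTest_step hs hst k).contDiff.continuous.aestronglyMeasurable.smul
        h.aestronglyMeasurable
    · have h1 : IntegrableOn (fun r => ‖u' r‖) (Icc s (t + 1)) := (h.integrableOn hs).norm
      exact (h1.integrable_indicator measurableSet_Icc).integrableOn
    · refine Eventually.of_forall fun r => ?_
      by_cases hr : r ∈ Icc s (t + 1)
      · rw [indicator_of_mem hr, norm_smul]
        refine mul_le_of_le_one_left (norm_nonneg _) ?_
        rw [Real.norm_eq_abs, abs_le]
        have h1 := Real.smoothTransition.nonneg (((k : ℝ) + 1) * (r - s))
        have h2 := Real.smoothTransition.le_one (((k : ℝ) + 1) * (r - s))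
        have h3 := Real.smoothTransition.nonneg (((k : ℝ) + 1) * (r - t))
        have h4 := Real.smoothTransition.le_one (((k : ℝ) + 1) * (r - t))
        constructor <;> simp only [hη] <;> linarith
      · rw [indicator_of_notMem hr]
        have : η k r = 0 := by
          have hk : (0 : ℝ) ≤ k := Nat.cast_nonneg k
          rw [mem_Icc, not_and_or, not_le, not_le] at hr
          simp only [hη]
          rcases hr with hc | hc
          · rw [Real.smoothTransition.zero_of_nonpos (by nlinarith),
              Real.smoothTransition.zero_of_nonpos (by nlinarith), sub_self]
          · rw [Real.smoothTransition.one_of_one_le (by nlinarith),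
              Real.smoothTransition.one_of_one_le (by nlinarith), sub_self]
        rw [this, zero_smul, norm_zero]
    · refine Eventually.of_forall fun r => ?_
      have hev : ∀ c, c < r → ∀ᶠ k : ℕ in atTop,
          Real.smoothTransition (((k : ℝ) + 1) * (r - c)) = 1 := by
        intro c hc
        filter_upwards [tendsto_natCast_atTop_atTop.eventually_ge_atTop (1 / (r - c))] with k hk
        refine Real.smoothTransition.one_of_one_le ?_
        rw [div_le_iff₀ (sub_pos.2 hc)] at hk
        nlinarith
      have hev0 : ∀ c, r ≤ c → ∀ k : ℕ, Real.smoothTransition (((k : ℝ) + 1) * (r - c)) = 0 := by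
        intro c hc k
        refine Real.smoothTransition.zero_of_nonpos ?_
        have hk : (0 : ℝ) ≤ k := Nat.cast_nonneg k
        nlinarith
      refine tendsto_const_nhds.congr' ?_
      rcases le_or_gt r s with h1 | h1
      · refine Eventually.of_forall fun k => ?_
        simp only [hη]
        rw [hev0 s h1, hev0 t (h1.trans hst), sub_self, zero_smul, indicator_of_notMem]
        exact fun hc => absurd hc.1 (not_lt.2 h1)
      · rcases le_or_gt r t with h2 | h2
        · filter_upwards [hev s h1] with k hk
          simp only [hη]
          rw [hk, hev0 t h2, sub_zero, one_smul, indicator_of_mem (mem_Ioc.2 ⟨h1, h2⟩)]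
        · filter_upwards [hev s h1, hev t h2] with k hk hk2
          simp only [hη]
          rw [hk, hk2, sub_self, zero_smul, indicator_of_notMem]
          exact fun hc => absurd hc.2 (not_le.2 h2)
  have heq : ∀ k, ∫ r in Ioi (0 : ℝ), deriv (η k) r • u r = - ∫ r in Ioi (0 : ℝ), η k r • u' r :=
    fun k => h.integral_eq _ (isTest_step hs hst k)
  have := tendsto_nhds_unique (hL.congr heq) hR.neg
  rw [← neg_sub, this, neg_neg]

/-! ### Uniqueness -/

/-- Increments that are quadratically small from above add up to K(b - a)²/(m + 1) over m + 1 equal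
pieces. This replaces differentiating the squared distance of two solutions. -/
lemma le_of_forall_sub_le_sq {f : ℝ → ℝ} {K a b : ℝ} (hab : a ≤ b)
    (h : ∀ s t, a ≤ s → s ≤ t → t ≤ b → f t - f s ≤ K * (t - s) ^ 2) : f b ≤ f a := by
  have key : ∀ m : ℕ, f b - f a ≤ K * (b - a) ^ 2 * (1 / ((m : ℝ) + 1)) := by
    intro m
    have hm : (0 : ℝ) < (m : ℝ) + 1 := by positivity
    set x : ℕ → ℝ := fun i => a + (b - a) * (i / ((m : ℝ) + 1)) with hx
    have hstep : ∀ i ∈ Finset.range (m + 1), f (x (i + 1)) - f (x i) ≤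
        K * ((b - a) / ((m : ℝ) + 1)) ^ 2 := by
      intro i hi
      have hi' : ((i + 1 : ℕ) : ℝ) ≤ (m : ℝ) + 1 := by
        exact_mod_cast Finset.mem_range.1 hi
      have hba : 0 ≤ b - a := sub_nonneg.2 hab
      have e : x (i + 1) - x i = (b - a) / ((m : ℝ) + 1) := by
        simp only [hx]; push_cast; field_simp; ring
      rw [← e]
      refine h _ _ ?_ ?_ ?_
      · simp only [hx]; have : 0 ≤ (b - a) * (i / ((m : ℝ) + 1)) := by positivity
        linarith
      · rw [← sub_nonneg, e]; positivity
      · simp only [hx]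
        have : ((i + 1 : ℕ) : ℝ) / ((m : ℝ) + 1) ≤ 1 := (div_le_one hm).2 hi'
        nlinarith
    have hsum := Finset.sum_le_sum hstep
    rw [Finset.sum_range_sub (fun i => f (x i)), Finset.sum_const, Finset.card_range,
      nsmul_eq_mul] at hsum
    have e1 : x (m + 1) = b := by simp only [hx]; push_cast; rw [div_self hm.ne']; ring
    have e0 : x 0 = a := by simp [hx]
    rw [e1, e0] at hsum
    refine hsum.trans (le_of_eq ?_)
    push_cast
    field_simp
  have hlim := tendsto_step.const_mul (K * (b - a) ^ 2)
  rw [mul_zero] at hlim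
  linarith [ge_of_tendsto' hlim key]

/-- On an interval away from 0, the increment of ‖u - v‖² over [s, t] is the integral of u' - v'
paired with the sum of the end values of u - v. Replacing that sum by 2(u r - v r) costs O(t - s),
and the resulting pairing is nonpositive by monotonicity. So the squared distance does not increase,
and continuity reaches the time 0. -/
lemma IsSemigroupSolution.unique [CompleteSpace H] {Φ : H → EReal} (hΦ : IsEnergy Φ) {x : H}
    {u v : ℝ → H} (hu : IsSemigroupSolution Φ x u) (hv : IsSemigroupSolution Φ x v) {t : ℝ}
    (ht : 0 ≤ t) : v t = u t := by
  obtain ⟨u', hu', hui⟩ := hu.inclusion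
  obtain ⟨v', hv', hvi⟩ := hv.inclusion
  set f : ℝ → ℝ := fun r => ‖u r - v r‖ ^ 2 with hf
  have hanti : ∀ a b, 0 < a → a ≤ b → f b ≤ f a := by
    intro a b ha hab
    obtain ⟨C₁, hC₁⟩ := hu'.locallyBounded a (b + 1) ha (by linarith)
    obtain ⟨C₂, hC₂⟩ := hv'.locallyBounded a (b + 1) ha (by linarith)
    set C := |C₁| + |C₂| with hC
    have hC0 : 0 ≤ C := by positivity
    have hbd : ∀ᵐ r ∂volume.restrict (Icc a b), ‖u' r - v' r‖ ≤ C := by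
      have h1 := ae_mono (Measure.restrict_mono
        (Icc_subset_Icc_right (show b ≤ b + 1 by linarith)) le_rfl) hC₁
      have h2 := ae_mono (Measure.restrict_mono
        (Icc_subset_Icc_right (show b ≤ b + 1 by linarith)) le_rfl) hC₂
      filter_upwards [h1, h2] with r hr1 hr2
      exact (norm_sub_le _ _).trans
        (add_le_add (hr1.trans (le_abs_self _)) (hr2.trans (le_abs_self _)))
    have hii : ∀ s t, a ≤ s → s ≤ t →
        IntervalIntegrable (fun r => u' r - v' r) volume s t := by
      intro s t hs hst
      rw [intervalIntegrable_iff_integrableOn_Icc_of_le hst]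
      exact (hu'.integrableOn (ha.trans_le hs)).sub (hv'.integrableOn (ha.trans_le hs))
    have hw : ∀ s t, a ≤ s → s ≤ t →
        ∫ r in s..t, (u' r - v' r) = (u t - v t) - (u s - v s) := by
      intro s t hs hst
      have h1 : IntervalIntegrable u' volume s t := by
        rw [intervalIntegrable_iff_integrableOn_Icc_of_le hst]
        exact hu'.integrableOn (ha.trans_le hs)
      have h2 : IntervalIntegrable v' volume s t := by
        rw [intervalIntegrable_iff_integrableOn_Icc_of_le hst]
        exact hv'.integrableOn (ha.trans_le hs)
      rw [intervalIntegral.integral_sub h1 h2,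
        hu'.integral_eq_sub hu.continuousOn (ha.trans_le hs) hst,
        hv'.integral_eq_sub hv.continuousOn (ha.trans_le hs) hst]
      abel
    have hlip : ∀ s t, a ≤ s → s ≤ t → t ≤ b →
        ‖(u t - v t) - (u s - v s)‖ ≤ C * (t - s) := by
      intro s t hs hst htb
      rw [← hw s t hs hst, ← abs_of_nonneg (sub_nonneg.2 hst)]
      refine intervalIntegral.norm_integral_le_of_norm_le_const_ae ?_
      rw [uIoc_of_le hst]
      have := (ae_restrict_iff' measurableSet_Icc).1 hbd
      filter_upwards [this] with r hr hrm
      exact hr ⟨hs.trans hrm.1.le, hrm.2.trans htb⟩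
    refine le_of_forall_sub_le_sq (K := 2 * C ^ 2) hab fun s t hs hst htb => ?_
    have h1 : f t - f s = inner ℝ ((u t - v t) + (u s - v s)) ((u t - v t) - (u s - v s)) := by
      rw [inner_sub_right, inner_add_left, inner_add_left, real_inner_self_eq_norm_sq,
        real_inner_self_eq_norm_sq, real_inner_comm]
      simp only [hf]; ring
    rw [h1, ← hw s t hs hst]
    have h2 : inner ℝ ((u t - v t) + (u s - v s)) (∫ r in s..t, (u' r - v' r)) =
        ∫ r in s..t, inner ℝ ((u t - v t) + (u s - v s)) (u' r - v' r) :=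
      ((innerSL ℝ ((u t - v t) + (u s - v s))).intervalIntegral_comp_comm (hii s t hs hst)).symm
    rw [h2]
    have h3 : ∫ r in s..t, inner ℝ ((u t - v t) + (u s - v s)) (u' r - v' r) ≤
        ∫ _ in s..t, 2 * C ^ 2 * (t - s) := by
      refine intervalIntegral.integral_mono_ae_restrict hst ?_ (by simp) ?_
      · exact ⟨((hii s t hs hst).1.const_inner _), ((hii s t hs hst).2.const_inner _)⟩
      · have hsubset : Icc s t ⊆ Icc a b := Icc_subset_Icc hs htb
        have hpos : Icc s t ⊆ Ioi (0 : ℝ) := fun r hr => ha.trans_le (hs.trans hr.1)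
        filter_upwards [ae_mono (Measure.restrict_mono hsubset le_rfl) hbd,
          ae_mono (Measure.restrict_mono hpos le_rfl) hui,
          ae_mono (Measure.restrict_mono hpos le_rfl) hvi,
          ae_restrict_mem measurableSet_Icc] with r hr1 hr2 hr3 hr4
        have hmono := hΦ.subdiff_monotone hr2 hr3
        have e1 : - u' r - - v' r = - (u' r - v' r) := by abel
        rw [e1, inner_neg_left] at hmono
        -- The first two differences are bounded by C(t - r) and C(r - s), while the last term has a
        -- nonpositive pairing with u' r - v' r.
        have e2 : (u t - v t) + (u s - v s) = ((u t - v t) - (u r - v r)) -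
            ((u r - v r) - (u s - v s)) + (2 : ℝ) • (u r - v r) := by module
        rw [e2, inner_add_left, real_inner_smul_left, real_inner_comm (u' r - v' r) (u r - v r)]
        have h5 : inner ℝ (((u t - v t) - (u r - v r)) - ((u r - v r) - (u s - v s)))
            (u' r - v' r) ≤ (C * (t - r) + C * (r - s)) * C := by
          refine (real_inner_le_norm _ _).trans ?_
          have h7 := hlip r t (hs.trans hr4.1) hr4.2 htb
          have h6 := hlip s r hs hr4.1 (hr4.2.trans htb)
          have h8 := (norm_sub_le ((u t - v t) - (u r - v r))
            ((u r - v r) - (u s - v s))).trans (add_le_add h7 h6)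
          exact mul_le_mul h8 hr1 (norm_nonneg _) ((norm_nonneg _).trans h8)
        have hts : 0 ≤ t - s := sub_nonneg.2 hst
        nlinarith [mul_nonneg (sq_nonneg C) hts]
    refine h3.trans (le_of_eq ?_)
    rw [intervalIntegral.integral_const, smul_eq_mul]
    ring
  rcases ht.eq_or_lt with rfl | ht0
  · rw [hu.initial, hv.initial]
  · have hcont : ContinuousOn f (Ici 0) :=
      ((hu.continuousOn.sub hv.continuousOn).norm).pow 2
    have h0 : Tendsto f (𝓝[>] 0) (𝓝 (f 0)) :=
      (hcont 0 self_mem_Ici).mono_left (nhdsWithin_mono _ Ioi_subset_Ici_self)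
    have h1 : f t ≤ f 0 := by
      refine ge_of_tendsto h0 ?_
      filter_upwards [Ioo_mem_nhdsGT ht0] with a ha
      exact hanti a t ha.1 ha.2.le
    have h2 : f 0 = 0 := by simp [hf, hu.initial, hv.initial]
    rw [h2] at h1
    have h3 : ‖u t - v t‖ = 0 := by
      have : ‖u t - v t‖ ^ 2 = 0 := le_antisymm h1 (by positivity)
      exact pow_eq_zero_iff two_ne_zero |>.1 this
    exact (sub_eq_zero.1 (norm_eq_zero.1 h3)).symm

end WeakDeriv

/-! ### Approximation of bounded measurable fields by test fields -/

section Approximation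

variable {E : Type*} [NormedAddCommGroup E] [NormedSpace ℝ E] [FiniteDimensional ℝ E]

lemma exists_compact_exhaustion {V : Set E} (hV : IsOpen V) :
    ∃ L : ℕ → Set E, Monotone L ∧ (∀ k, IsCompact (L k)) ∧ (∀ k, L k ⊆ V) ∧
      ∀ x ∈ V, ∃ k, x ∈ L k := by
  have : LocallyCompactSpace V := hV.locallyCompactSpace
  have : SecondCountableTopology E := secondCountable_of_proper
  have e := CompactExhaustion.choice V
  refine ⟨fun k => Subtype.val '' e k, fun j k hjk => image_mono (e.subset hjk),
    fun k => (e.isCompact k).image continuous_subtype_val, fun k => ?_, fun x hx => ?_⟩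
  · rintro _ ⟨y, -, rfl⟩; exact y.2
  · obtain ⟨k, hk⟩ := e.exists_mem ⟨x, hx⟩
    exact ⟨k, ⟨x, hx⟩, hk, rfl⟩

/-- Bounded measurable functions are almost everywhere limits of test functions with the same
bound. -/
lemma exists_test_approx [MeasurableSpace E] [BorelSpace E] {W : Type*} [NormedAddCommGroup W]
    [NormedSpace ℝ W] (κ : Measure E) [IsFiniteMeasure κ] {V : Set E} (hV : IsOpen V) {F : E → W}
    (hF : AEStronglyMeasurable F κ) {R : ℝ} (hR : ∀ x, ‖F x‖ ≤ R) :
    ∃ φ : ℕ → E → W, (∀ k, IsTest V (φ k)) ∧ (∀ k x, ‖φ k x‖ ≤ R) ∧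
      ∀ᵐ x ∂κ, x ∈ V → Tendsto (fun k => φ k x) atTop (𝓝 (F x)) := by
  have hR0 : 0 ≤ R := (norm_nonneg _).trans (hR 0)
  rcases hR0.eq_or_lt with rfl | hRpos
  · refine ⟨fun _ _ => 0, fun k => ⟨contDiff_const, HasCompactSupport.zero, ?_⟩,
      fun k x => by simp, Eventually.of_forall fun x _ => ?_⟩
    · simp [tsupport, Function.support]
    · have : F x = 0 := norm_le_zero_iff.1 (hR x)
      simp [this]
  have hmem : MemLp F 1 κ := MemLp.of_bound hF R (Eventually.of_forall hR)
  have hex : ∀ k : ℕ, ∃ g : E → W, Continuous g ∧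
      eLpNorm (g - F) 1 κ ≤ ENNReal.ofReal (1 / ((k : ℝ) + 1)) := by
    intro k
    obtain ⟨g, -, h1, h2⟩ := hmem.exist_eLpNorm_sub_le (by simp) le_rfl
      (show 0 < 1 / ((k : ℝ) + 1) by positivity)
    refine ⟨g, h1.continuous, ?_⟩
    rwa [eLpNorm_sub_comm]
  choose g hgc hgle using hex
  have hlim : Tendsto (fun k => eLpNorm (g k - F) 1 κ) atTop (𝓝 0) := by
    refine tendsto_of_tendsto_of_tendsto_of_le_of_le tendsto_const_nhds ?_ (fun _ => zero_le) hgle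
    have := ENNReal.tendsto_ofReal tendsto_step
    simpa using this
  obtain ⟨ns, -, hns⟩ := (tendstoInMeasure_of_tendsto_eLpNorm one_ne_zero
    (fun k => (hgc k).aestronglyMeasurable) hF hlim).exists_seq_tendsto_ae
  obtain ⟨L, hLmono, hLc, hLV, hLex⟩ := exists_compact_exhaustion hV
  choose χ hχ1 hχc hχV hχ01 using fun k =>
    exists_continuousMap_one_of_isCompact_subset_isOpen (hLc k) hV (hLV k)
  -- Shrinking by 1 - θ leaves room for the smoothing error θR, so the final bound is exactly R.
  set θ : ℕ → ℝ := fun k => 1 / ((k : ℝ) + 1) with hθ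
  have hθ0 : ∀ k, 0 < θ k := fun k => by positivity
  have hθ1 : ∀ k, θ k ≤ 1 := fun k => by
    simp only [hθ]
    rw [div_le_one (by positivity)]
    linarith [Nat.cast_nonneg (α := ℝ) k]
  -- The radial retraction onto the ball of radius R. It restores the bound, which approximation in
  -- L¹ may destroy, and fixes the values of F.
  set T : W → W := fun w => (R / max R ‖w‖) • w with hT
  have hmaxpos : ∀ w : W, 0 < max R ‖w‖ := fun w => lt_max_of_lt_left hRpos
  have hTc : Continuous T := by
    refine Continuous.smul (continuous_const.div (by fun_prop) fun w => (hmaxpos w).ne')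
      continuous_id
  have hTle : ∀ w, ‖T w‖ ≤ R := by
    intro w
    simp only [hT]
    rw [norm_smul, Real.norm_of_nonneg (div_nonneg hR0 (hmaxpos w).le), div_mul_eq_mul_div,
      div_le_iff₀ (hmaxpos w)]
    exact mul_le_mul_of_nonneg_left (le_max_right _ _) hR0
  have hTF : ∀ x, T (F x) = F x := by
    intro x
    simp only [hT]
    rw [max_eq_left (hR x), div_self hRpos.ne', one_smul]
  set f : ℕ → E → W := fun k x => ((1 - θ k) * χ k x) • T (g (ns k) x) with hf
  have hfc : ∀ k, Continuous (f k) := fun k =>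
    (continuous_const.mul (χ k).continuous).smul (hTc.comp (hgc _))
  have hfle : ∀ k x, ‖f k x‖ ≤ (1 - θ k) * R := by
    intro k x
    simp only [hf]
    have h1 : 0 ≤ 1 - θ k := sub_nonneg.2 (hθ1 k)
    have h2 := hχ01 k x
    rw [norm_smul, Real.norm_of_nonneg (mul_nonneg h1 h2.1)]
    have h3 : (1 - θ k) * χ k x ≤ 1 - θ k := mul_le_of_le_one_right h1 h2.2
    exact mul_le_mul h3 (hTle _) (norm_nonneg _) h1
  -- The smoothing does not enlarge the support, so the compact support of the cutoff χ is
  -- inherited.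
  choose φ hφ hφd hφs using fun k => (hfc k).exists_contDiff_approx (n := 1)
    (ε := fun _ => θ k * R) continuous_const fun _ => mul_pos (hθ0 k) hRpos
  have hsub : ∀ k, tsupport (φ k) ⊆ tsupport (χ k) := fun k => by
    refine closure_mono ((hφs k).trans fun x hx => ?_)
    intro h0
    exact hx (by simp only [hf]; rw [h0, mul_zero, zero_smul])
  refine ⟨φ, fun k => ⟨hφ k, (hχc k).of_isClosed_subset (isClosed_tsupport _) (hsub k),
    (hsub k).trans (hχV k)⟩, fun k x => ?_, ?_⟩
  · have h1 := hφd k x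
    rw [dist_eq_norm] at h1
    have h2 := norm_le_norm_add_norm_sub' (φ k x) (f k x)
    linarith [hfle k x]
  · filter_upwards [hns] with x hx hxV
    have h1 : Tendsto (fun k => T (g (ns k) x)) atTop (𝓝 (F x)) := by
      have := (hTc.tendsto (F x)).comp hx
      rwa [hTF x] at this
    have h2 : Tendsto (fun k => χ k x) atTop (𝓝 1) := by
      obtain ⟨k₀, hk₀⟩ := hLex x hxV
      refine tendsto_const_nhds.congr' ?_
      filter_upwards [eventually_ge_atTop k₀] with k hk
      exact (hχ1 k (hLmono hk hk₀)).symm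
    have hθlim : Tendsto θ atTop (𝓝 0) := tendsto_step
    have h3 : Tendsto (fun k => f k x) atTop (𝓝 (F x)) := by
      have := (((hθlim.const_sub 1).mul h2).smul h1)
      simpa using this
    refine h3.congr_dist ?_
    refine squeeze_zero (fun _ => dist_nonneg) (fun k => ?_) (by simpa using hθlim.mul_const R)
    rw [dist_comm]
    exact (hφd k x).le

end Approximation

/-! ### Riesz representation of bounded functionals by pairs of finite measures -/

section Riesz

open CompactlySupported CompactlySupportedContinuousMap
open scoped NNReal

variable {X : Type*} [TopologicalSpace X]

lemma exists_nnreal_bound (f : C_c(X, ℝ≥0)) : ∃ a : ℝ≥0, ∀ x, f x ≤ a := by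
  obtain ⟨c, hc⟩ := f.toReal.hasCompactSupport.exists_bound_of_continuous f.toReal.continuous
  refine ⟨c.toNNReal, fun x => ?_⟩
  rw [← NNReal.coe_le_coe]
  refine le_trans ?_ (Real.le_coe_toNNReal c)
  simpa using hc x

/-- The positive part of a linear functional. -/
def posPart (l : C_c(X, ℝ≥0) →ₗ[ℝ≥0] ℝ) (f : C_c(X, ℝ≥0)) : ℝ :=
  ⨆ g : {g : C_c(X, ℝ≥0) // g ≤ f}, l g.1

variable {l : C_c(X, ℝ≥0) →ₗ[ℝ≥0] ℝ} {C : ℝ}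

/-- A linear functional that is bounded by `C` with respect to the supremum norm. -/
def SupBounded (l : C_c(X, ℝ≥0) →ₗ[ℝ≥0] ℝ) (C : ℝ) : Prop :=
  ∀ (f : C_c(X, ℝ≥0)) (a : ℝ≥0), (∀ x, f x ≤ a) → |l f| ≤ C * a

lemma le_posPart (hl : SupBounded l C) {f g : C_c(X, ℝ≥0)} (hg : g ≤ f) : l g ≤ posPart l f := by
  obtain ⟨a, ha⟩ := exists_nnreal_bound f
  have hb : BddAbove (range fun g : {g : C_c(X, ℝ≥0) // g ≤ f} => l g.1) := by
    refine ⟨C * a, ?_⟩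
    rintro _ ⟨g, rfl⟩
    exact (le_abs_self _).trans (hl g.1 a fun x => (g.2 x).trans (ha x))
  exact le_ciSup hb ⟨g, hg⟩

lemma posPart_le {f : C_c(X, ℝ≥0)} {b : ℝ} (h : ∀ g ≤ f, l g ≤ b) : posPart l f ≤ b := by
  have : Nonempty {g : C_c(X, ℝ≥0) // g ≤ f} := ⟨⟨f, le_rfl⟩⟩
  exact ciSup_le fun g => h g.1 g.2

lemma zero_le_cc (f : C_c(X, ℝ≥0)) : 0 ≤ f := fun _ => zero_le

lemma posPart_nonneg (hl : SupBounded l C) (f : C_c(X, ℝ≥0)) : 0 ≤ posPart l f := by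
  simpa using le_posPart hl (zero_le_cc f)

/-- The Riesz decomposition property: if g ≤ f₁ + f₂, then g is the sum of g ⊓ f₁ and a remainder
that is at most f₂. -/
lemma posPart_add (hl : SupBounded l C) (f₁ f₂ : C_c(X, ℝ≥0)) :
    posPart l (f₁ + f₂) = posPart l f₁ + posPart l f₂ := by
  apply le_antisymm
  · refine posPart_le fun g hg => ?_
    obtain ⟨h, hh⟩ := CompactlySupportedContinuousMap.exists_add_of_le (inf_le_left : g ⊓ f₁ ≤ g)
    have h2 : h ≤ f₂ := by
      intro x
      have h1 := congrArg (fun k : C_c(X, ℝ≥0) => k x) hh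
      have h3 := hg x
      change min (g x) (f₁ x) + h x = g x at h1
      change g x ≤ f₁ x + f₂ x at h3
      change h x ≤ f₂ x
      rcases le_total (g x) (f₁ x) with hc | hc
      · rw [min_eq_left hc] at h1
        have : h x = 0 := by simpa using h1
        simp [this]
      · rw [min_eq_right hc] at h1
        rw [← h1] at h3
        exact (add_le_add_iff_left _).1 h3
    rw [← hh, map_add]
    exact add_le_add (le_posPart hl inf_le_right) (le_posPart hl h2)
  · have : posPart l f₁ ≤ posPart l (f₁ + f₂) - posPart l f₂ := by
      refine posPart_le fun g₁ h₁ => ?_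
      have : posPart l f₂ ≤ posPart l (f₁ + f₂) - l g₁ := by
        refine posPart_le fun g₂ h₂ => ?_
        have := le_posPart hl (add_le_add h₁ h₂)
        rw [map_add] at this
        linarith
      linarith
    linarith

lemma posPart_smul (hl : SupBounded l C) (r : ℝ≥0) (f : C_c(X, ℝ≥0)) :
    posPart l (r • f) = r * posPart l f := by
  have key : ∀ (r : ℝ≥0) (f : C_c(X, ℝ≥0)), 0 < r → r * posPart l f ≤ posPart l (r • f) := by
    intro r f hr
    have hr' : (0 : ℝ) < r := hr
    have : posPart l f ≤ (r : ℝ)⁻¹ * posPart l (r • f) := by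
      refine posPart_le fun g hg => ?_
      have h1 : l (r • g) ≤ posPart l (r • f) :=
        le_posPart hl fun x => by
          change r * g x ≤ r * f x
          gcongr
          exact hg x
      rw [map_smul, NNReal.smul_def, smul_eq_mul] at h1
      rw [inv_mul_eq_div, le_div_iff₀ hr']
      linarith
    calc (r : ℝ) * posPart l f ≤ r * ((r : ℝ)⁻¹ * posPart l (r • f)) := by gcongr
      _ = posPart l (r • f) := by field_simp
  rcases eq_or_ne r 0 with rfl | hr
  · rw [zero_smul]
    simp only [NNReal.coe_zero, zero_mul]
    refine le_antisymm (posPart_le fun g hg => ?_) (posPart_nonneg hl 0)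
    rw [le_antisymm hg (zero_le_cc g), map_zero]
  · refine le_antisymm ?_ (key r f (pos_iff_ne_zero.2 hr))
    have h := key r⁻¹ (r • f) (inv_pos.2 (pos_iff_ne_zero.2 hr))
    rw [smul_smul, inv_mul_cancel₀ hr, one_smul, NNReal.coe_inv] at h
    have hr' : (0 : ℝ) < r := NNReal.coe_pos.2 (pos_iff_ne_zero.2 hr)
    rwa [inv_mul_eq_div, div_le_iff₀ hr', mul_comm] at h

variable [T2Space X] [LocallyCompactSpace X] [MeasurableSpace X] [BorelSpace X]

/-- Inner regularity on the whole space reduces finiteness to compact sets, where a cutoff function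
with values in [0, 1] bounds the measure by C. -/
lemma isFiniteMeasure_rieszMeasure {Λ : C_c(X, ℝ≥0) →ₗ[ℝ≥0] ℝ≥0} {C : ℝ≥0}
    (hΛ : ∀ f : C_c(X, ℝ≥0), (∀ x, f x ≤ 1) → Λ f ≤ C) :
    IsFiniteMeasure (NNRealRMK.rieszMeasure Λ) := by
  refine ⟨?_⟩
  rw [isOpen_univ.measure_eq_iSup_isCompact]
  refine lt_of_le_of_lt (iSup_le fun K => iSup_le fun _ => iSup_le fun hK => ?_)
    (ENNReal.coe_lt_top (r := C))
  obtain ⟨χ, hχ1, hχc, -, hχ01⟩ :=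
    exists_continuousMap_one_of_isCompact_subset_isOpen hK isOpen_univ (subset_univ K)
  let f : C_c(X, ℝ≥0) := nnrealPart ⟨χ, hχc⟩
  have hf : ∀ x, f x = (χ x).toNNReal := fun x => rfl
  calc NNRealRMK.rieszMeasure Λ K = ∫⁻ x in K, 1 ∂NNRealRMK.rieszMeasure Λ := by simp
    _ ≤ ∫⁻ x in K, f x ∂NNRealRMK.rieszMeasure Λ := by
        refine setLIntegral_mono' hK.measurableSet fun x hx => ?_
        have := hχ1 hx
        simp only [Pi.one_apply] at this
        rw [hf, this]; simp
    _ ≤ ∫⁻ x, f x ∂NNRealRMK.rieszMeasure Λ := setLIntegral_le_lintegral _ _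
    _ = Λ f := NNRealRMK.lintegral_rieszMeasure Λ f
    _ ≤ C := by
        refine ENNReal.coe_le_coe.2 (hΛ f fun x => ?_)
        rw [hf]
        simpa using (hχ01 x).2

/-- A bounded functional is the difference of the integrals with respect to two finite measures. -/
lemma exists_measures_of_supBounded (hl : SupBounded l C) :
    ∃ μ ν : Measure X, IsFiniteMeasure μ ∧ IsFiniteMeasure ν ∧
      ∀ f : C_c(X, ℝ≥0), l f = ∫ x, (f x : ℝ) ∂μ - ∫ x, (f x : ℝ) ∂ν := by
  let P : C_c(X, ℝ≥0) →ₗ[ℝ≥0] ℝ≥0 :=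
    { toFun := fun f => ⟨posPart l f, posPart_nonneg hl f⟩
      map_add' := fun f g => NNReal.eq (posPart_add hl f g)
      map_smul' := fun r f => NNReal.eq (posPart_smul hl r f) }
  have hPl : ∀ f, 0 ≤ posPart l f - l f := fun f => sub_nonneg.2 (le_posPart hl le_rfl)
  -- The negative part: the positive part dominates l because f itself competes in the supremum.
  let N : C_c(X, ℝ≥0) →ₗ[ℝ≥0] ℝ≥0 :=
    { toFun := fun f => ⟨posPart l f - l f, hPl f⟩
      map_add' := fun f g => NNReal.eq <| by
        change posPart l (f + g) - l (f + g) = (posPart l f - l f) + (posPart l g - l g)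
        rw [posPart_add hl, map_add]; ring
      map_smul' := fun r f => NNReal.eq <| by
        change posPart l (r • f) - l (r • f) = r * (posPart l f - l f)
        rw [posPart_smul hl, map_smul, NNReal.smul_def, smul_eq_mul]; ring }
  have hP1 : ∀ f : C_c(X, ℝ≥0), (∀ x, f x ≤ 1) → posPart l f ≤ C := fun f hf =>
    posPart_le fun g hg => by
      have := hl g 1 fun x => (hg x).trans (hf x)
      simpa using (le_abs_self _).trans this
  refine ⟨NNRealRMK.rieszMeasure P, NNRealRMK.rieszMeasure N,
    isFiniteMeasure_rieszMeasure (C := C.toNNReal) fun f hf => ?_,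
    isFiniteMeasure_rieszMeasure (C := (2 * C).toNNReal) fun f hf => ?_, fun f => ?_⟩
  · exact NNReal.coe_le_coe.1 ((hP1 f hf).trans (Real.le_coe_toNNReal _))
  · refine NNReal.coe_le_coe.1 (le_trans ?_ (Real.le_coe_toNNReal _))
    have h1 := hP1 f hf
    have h2 := hl f 1 hf
    have h3 := neg_abs_le (l f)
    change posPart l f - l f ≤ 2 * C
    simp only [NNReal.coe_one, mul_one] at h2
    linarith
  · rw [NNRealRMK.integral_rieszMeasure, NNRealRMK.integral_rieszMeasure]
    change l f = posPart l f - (posPart l f - l f)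
    ring

/-- Bounded functionals on spaces of bounded continuous functions are represented by measures on
the functions of compact support. -/
lemma exists_measures_of_bounded (S : Submodule ℝ (BoundedContinuousFunction X ℝ))
    (T : S →ₗ[ℝ] ℝ) (hT : ∀ f : S, |T f| ≤ C * ‖f‖) :
    ∃ μ ν : Measure X, IsFiniteMeasure μ ∧ IsFiniteMeasure ν ∧
      ∀ f : S, HasCompactSupport (f : X → ℝ) →
        T f = ∫ x, (f : BoundedContinuousFunction X ℝ) x ∂μ
          - ∫ x, (f : BoundedContinuousFunction X ℝ) x ∂ν := by
  -- By the Hahn-Banach theorem the functional may be given on any subspace, here later the C¹ test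
  -- functions, which is not a lattice; the extension is then restricted to the lattice cone of
  -- nonnegative functions of compact support.
  obtain ⟨g, hg, -⟩ := exists_extension_norm_eq S (T.mkContinuous C hT)
  let b : C_c(X, ℝ) → BoundedContinuousFunction X ℝ := fun f =>
    BoundedContinuousFunction.ofNormedAddCommGroup f f.continuous
      (f.hasCompactSupport.exists_bound_of_continuous f.continuous).choose
      (f.hasCompactSupport.exists_bound_of_continuous f.continuous).choose_spec
  let l : C_c(X, ℝ≥0) →ₗ[ℝ≥0] ℝ :=
    { toFun := fun f => g (b f.toReal)
      map_add' := fun f h => by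
        rw [← map_add]; congr 1; ext x; simp [b]
      map_smul' := fun r f => by
        rw [RingHom.id_apply, NNReal.smul_def, ← map_smul]; congr 1; ext x
        simp [b, NNReal.smul_def] }
  have hl : SupBounded l ‖g‖ := by
    intro f a ha
    refine (g.le_opNorm _).trans ?_
    gcongr
    refine (BoundedContinuousFunction.norm_le a.2).2 fun x => ?_
    simpa [b] using ha x
  obtain ⟨μ, ν, hμ, hν, h⟩ := exists_measures_of_supBounded hl
  refine ⟨μ, ν, hμ, hν, fun f hf => ?_⟩
  let f' : C_c(X, ℝ) := ⟨(f : BoundedContinuousFunction X ℝ).toContinuousMap, hf⟩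
  have hf' : ∀ x, f' x = (f : BoundedContinuousFunction X ℝ) x := fun x => rfl
  have h1 : T f = l (nnrealPart f') - l (nnrealPart (-f')) := by
    have h2 : T f = g f := by rw [hg]; rfl
    rw [h2]
    change g f = g (b (nnrealPart f').toReal) - g (b (nnrealPart (-f')).toReal)
    rw [← map_sub]
    congr 1
    ext x
    simp [b, hf']
  have hint : ∀ (m : Measure X) [IsFiniteMeasure m] (k : C_c(X, ℝ)),
      Integrable (fun x => (k.nnrealPart x : ℝ)) m := by
    intro m _ k
    exact ((b k.nnrealPart.toReal).integrable m).congr (Eventually.of_forall fun x => by simp [b])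
  have h3 : ∀ (m : Measure X) [IsFiniteMeasure m],
      ∫ x, (f : BoundedContinuousFunction X ℝ) x ∂m
        = ∫ x, (nnrealPart f' x : ℝ) ∂m - ∫ x, (nnrealPart (-f') x : ℝ) ∂m := by
    intro m _
    rw [← integral_sub (hint m f') (hint m (-f'))]
    congr 1
    ext x
    simp [hf']
  rw [h1, h, h, h3 μ, h3 ν]
  ring

end Riesz

/-! ### Densities and polar decomposition of vector measures -/

section Polar

variable {X : Type*} [MeasurableSpace X] {ι : Type*} [Fintype ι]

lemma integral_apply_euclidean {ν : Measure X} {σ : X → EuclideanSpace ℝ ι} (hσ : Integrable σ ν)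
    (k : ι) : (∫ x, σ x ∂ν) k = ∫ x, σ x k ∂ν :=
  ((EuclideanSpace.proj (𝕜 := ℝ) k).integral_comp_comm hσ).symm

lemma integrable_euclidean {ν : Measure X} {σ : X → EuclideanSpace ℝ ι}
    (hσ : ∀ k, Integrable (fun x => σ x k) ν) : Integrable σ ν := by
  classical
  have : σ = fun x => ∑ k, (σ x k) • EuclideanSpace.single k (1 : ℝ) := by
    ext x k
    simp [Finset.sum_apply, Pi.single_apply]
  rw [this]
  exact integrable_finsetSum _ fun k _ => (hσ k).smul_const _

/-- Every vector measure with values in a Euclidean space has a density with respect to a finite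
measure. -/
lemma exists_eq_withDensity (μ : VectorMeasure X (EuclideanSpace ℝ ι)) :
    ∃ (ν : Measure X) (σ : X → EuclideanSpace ℝ ι), IsFiniteMeasure ν ∧ Integrable σ ν ∧
      μ = ν.withDensityᵥ σ := by
  let s : ι → SignedMeasure X := fun k =>
    μ.mapRange (EuclideanSpace.proj (𝕜 := ℝ) k).toLinearMap.toAddMonoidHom
      (EuclideanSpace.proj (𝕜 := ℝ) k).continuous
  have hs : ∀ k A, s k A = μ A k := fun k A => rfl
  -- The sum of the total variations of the components dominates each of them, so the density can be
  -- formed componentwise by Radon-Nikodym.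
  let ν : Measure X := ∑ k, (s k).totalVariation
  have hνf : IsFiniteMeasure ν := by infer_instance
  have hac : ∀ k, s k ≪ᵥ ν.toENNRealVectorMeasure := by
    intro k
    refine VectorMeasure.AbsolutelyContinuous.mk fun A hA h0 => ?_
    rw [Measure.toENNRealVectorMeasure_apply_measurable hA, Measure.finsetSum_apply,
      Finset.sum_eq_zero_iff] at h0
    have h1 := h0 k (Finset.mem_univ k)
    have h2 := SignedMeasure.enorm_le_totalVariation (s k) A
    rw [h1] at h2
    simpa using h2
  let σ : X → EuclideanSpace ℝ ι := fun x => WithLp.toLp 2 fun k => (s k).rnDeriv ν x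
  have hσ : Integrable σ ν :=
    integrable_euclidean fun k => SignedMeasure.integrable_rnDeriv (s k) ν
  refine ⟨ν, σ, hνf, hσ, ?_⟩
  ext A hA k
  rw [withDensityᵥ_apply hσ hA, integral_apply_euclidean hσ.integrableOn, ← hs,
    ← SignedMeasure.withDensityᵥ_rnDeriv_eq (s k) ν (hac k),
    withDensityᵥ_apply (SignedMeasure.integrable_rnDeriv (s k) ν) hA]

/-- Both sides are continuous in f with respect to L¹ of the variation and agree on indicator
functions of sets of finite measure; the bound on τ gives the continuity of the right side. -/
lemma integral_vectorMeasure_withDensity {W : Type*} [NormedAddCommGroup W] [NormedSpace ℝ W]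
    [CompleteSpace W] {lam : Measure X} [IsFiniteMeasure lam] {τ : X → W}
    (hτ : AEStronglyMeasurable τ lam) (hτ1 : ∀ x, ‖τ x‖ ≤ 1) {μ : VectorMeasure X W}
    (hμ : μ = lam.withDensityᵥ τ) (hvar : μ.variation = lam) {f : X → ℝ} (hf : Integrable f lam) :
    (∫ᵛ x, f x ∂•μ) = ∫ x, f x • τ x ∂lam := by
  have hint : ∀ {g : X → ℝ}, Integrable g lam → Integrable (fun x => g x • τ x) lam := fun hg =>
    hg.smul_bdd 1 hτ (Eventually.of_forall hτ1)
  have hτi : Integrable τ lam := Integrable.of_bound hτ 1 (Eventually.of_forall hτ1)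
  subst hvar
  refine hf.induction (P := fun f => (∫ᵛ x, f x ∂•μ) = ∫ x, f x • τ x ∂μ.variation) ?_ ?_ ?_ ?_
  · intro c s hs hc
    have : IsFiniteMeasure (μ.variation.restrict s) := ⟨by simp [hc]⟩
    rw [VectorMeasure.integral_indicator_const _ hs]
    have h1 : (fun x => s.indicator (fun _ => c) x • τ x) = s.indicator fun x => c • τ x := by
      ext x
      by_cases hx : x ∈ s <;> simp [hx]
    rw [h1, integral_indicator hs, integral_smul, hμ, withDensityᵥ_apply hτi hs, ← hμ]
    simp
  · intro f g _ hf hg h1 h2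
    simp only [Pi.add_apply]
    rw [VectorMeasure.integral_fun_add hf hg, h1, h2, ← integral_add (hint hf) (hint hg)]
    simp only [add_smul]
  · refine isClosed_eq VectorMeasure.continuous_integral ?_
    refine (LipschitzWith.of_dist_le_mul (K := 1) fun f g => ?_).continuous
    have hf := L1.integrable_coeFn f
    have hg := L1.integrable_coeFn g
    rw [NNReal.coe_one, one_mul, dist_eq_norm, dist_eq_norm, L1.norm_eq_integral_norm,
      ← integral_sub (hint hf) (hint hg)]
    refine (norm_integral_le_integral_norm _).trans ?_
    refine integral_mono_ae (((hint hf).sub (hint hg)).norm) (L1.integrable_coeFn _).norm ?_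
    filter_upwards [Lp.coeFn_sub f g] with x hx
    rw [hx, ← sub_smul, norm_smul, Pi.sub_apply]
    exact mul_le_of_le_one_right (norm_nonneg _) (hτ1 x)
  · intro f g hfg _ h
    rw [← VectorMeasure.integral_congr_ae hfg, h]
    refine integral_congr_ae ?_
    filter_upwards [hfg] with x hx using by rw [hx]

/-- The polar decomposition of a vector measure with a density. -/
lemma polar_withDensity {W : Type*} [NormedAddCommGroup W] [NormedSpace ℝ W]
    [CompleteSpace W] {ν : Measure X} [IsFiniteMeasure ν] {σ : X → W} (hσ : Integrable σ ν)
    {μ : VectorMeasure X W} (hμ : μ = ν.withDensityᵥ σ) :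
    IsFiniteMeasure μ.variation ∧ ∃ τ : X → W, AEStronglyMeasurable τ μ.variation ∧
      (∀ x, ‖τ x‖ ≤ 1) ∧ (∀ᵐ x ∂μ.variation, ‖τ x‖ = 1) ∧
      (∀ f : X → ℝ, ∫ x, f x • τ x ∂μ.variation = ∫ x, f x • σ x ∂ν) ∧
      ∀ f : X → ℝ, Integrable f μ.variation →
        (∫ᵛ x, f x ∂•μ) = ∫ x, f x • τ x ∂μ.variation := by
  have hvar : μ.variation = ν.withDensity fun x => ‖σ x‖ₑ := by
    rw [hμ, Measure.variation_withDensityᵥ hσ]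
  have hfin : IsFiniteMeasure μ.variation := by
    rw [hvar]
    exact isFiniteMeasure_withDensity hσ.2.ne
  -- Since 0⁻¹ = 0, τ vanishes where σ does; this keeps the bound by 1 everywhere, and the variation
  -- does not see that set.
  let τ : X → W := fun x => ‖σ x‖⁻¹ • σ x
  have hac : μ.variation ≪ ν := by
    rw [hvar]; exact withDensity_absolutelyContinuous _ _
  have hm : AEMeasurable (fun x => ‖σ x‖₊) ν := hσ.1.nnnorm.aemeasurable
  have hτσ : ∀ x, ‖σ x‖₊ • τ x = σ x := by
    intro x
    rcases eq_or_ne (σ x) 0 with h | h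
    · simp [h]
    · simp only [τ, NNReal.smul_def, coe_nnnorm, smul_smul]
      rw [mul_inv_cancel₀ (norm_ne_zero_iff.2 h), one_smul]
  have hτ : AEStronglyMeasurable τ μ.variation :=
    ((hσ.1.norm.aemeasurable.inv.aestronglyMeasurable.smul hσ.1).mono_ac hac)
  have hτ1 : ∀ x, ‖τ x‖ ≤ 1 := by
    intro x
    simp only [τ, norm_smul, norm_inv, norm_norm]
    exact inv_mul_le_one
  have hvar' : μ.variation = ν.withDensity fun x => (‖σ x‖₊ : ℝ≥0∞) := hvar
  refine ⟨hfin, τ, hτ, hτ1, ?_, ?_, ?_⟩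
  · rw [hvar', ae_withDensity_iff' hm.coe_nnreal_ennreal]
    refine Eventually.of_forall fun x hx => ?_
    have : σ x ≠ 0 := by simpa using hx
    simp only [τ, norm_smul, norm_inv, norm_norm]
    exact inv_mul_cancel₀ (norm_ne_zero_iff.2 this)
  · intro f
    rw [hvar', integral_withDensity_eq_integral_smul₀ hm]
    refine integral_congr_ae (Eventually.of_forall fun x => ?_)
    simp only
    rw [smul_comm, hτσ]
  · intro f hf
    refine integral_vectorMeasure_withDensity hτ hτ1 ?_ rfl hf
    have h := withDensityᵥ_smul_eq_withDensityᵥ_withDensity (μ := ν) (g := τ) hm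
      (hσ.congr (Eventually.of_forall fun x => (hτσ x).symm))
    rw [hvar', ← h, hμ]
    congr 1
    ext x
    exact (hτσ x).symm

end Polar

/-! ### Operations on test functions -/

section Test

variable {E F G : Type*} [NormedAddCommGroup E] [NormedSpace ℝ E] [NormedAddCommGroup F]
  [NormedSpace ℝ F] [NormedAddCommGroup G] [NormedSpace ℝ G] {V W : Set E} {φ ψ : E → F}

lemma IsTest.zero : IsTest V (fun _ : E => (0 : F)) where
  contDiff := contDiff_const
  hasCompactSupport := HasCompactSupport.zero
  tsupport_subset := by simp [tsupport, Function.support]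

lemma IsTest.add (hφ : IsTest V φ) (hψ : IsTest V ψ) : IsTest V fun x => φ x + ψ x where
  contDiff := hφ.contDiff.add hψ.contDiff
  hasCompactSupport := hφ.hasCompactSupport.add hψ.hasCompactSupport
  tsupport_subset := (tsupport_add φ ψ).trans (union_subset hφ.tsupport_subset hψ.tsupport_subset)

lemma IsTest.mono (hφ : IsTest V φ) (h : V ⊆ W) : IsTest W φ where
  contDiff := hφ.contDiff
  hasCompactSupport := hφ.hasCompactSupport
  tsupport_subset := hφ.tsupport_subset.trans h

lemma IsTest.comp_clm (L : F →L[ℝ] G) (hφ : IsTest V φ) : IsTest V fun x => L (φ x) where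
  contDiff := L.contDiff.comp hφ.contDiff
  hasCompactSupport := hφ.hasCompactSupport.comp_left (map_zero L)
  tsupport_subset := (tsupport_comp_subset (map_zero L) φ).trans hφ.tsupport_subset

lemma IsTest.const_smul (c : ℝ) (hφ : IsTest V φ) : IsTest V fun x => c • φ x :=
  hφ.comp_clm (c • ContinuousLinearMap.id ℝ F)

lemma IsTest.neg (hφ : IsTest V φ) : IsTest V fun x => -φ x :=
  hφ.comp_clm (-ContinuousLinearMap.id ℝ F)

lemma IsTest.exists_bound (hφ : IsTest V φ) : ∃ C, ∀ x, ‖φ x‖ ≤ C :=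
  hφ.hasCompactSupport.exists_bound_of_continuous hφ.contDiff.continuous

lemma IsTest.eq_zero (hφ : IsTest V φ) {x : E} (hx : x ∉ V) : φ x = 0 :=
  image_eq_zero_of_notMem_tsupport fun h => hx (hφ.tsupport_subset h)

end Test

/-! ### Divergence, total variation and the gradient measure of a BV function -/

section Divergence

variable {n N : ℕ} {F : Type*} [NormedAddCommGroup F] [NormedSpace ℝ F]
  {Ω V : Set (EuclideanSpace ℝ (Fin n))}

lemma IsTest.continuous_partialDeriv {φ : EuclideanSpace ℝ (Fin n) → F} (hφ : IsTest V φ)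
    (j : Fin n) : Continuous (partialDeriv j φ) :=
  (hφ.contDiff.continuous_fderiv one_ne_zero).clm_apply continuous_const

lemma IsTest.hasCompactSupport_partialDeriv {φ : EuclideanSpace ℝ (Fin n) → F} (hφ : IsTest V φ)
    (j : Fin n) : HasCompactSupport (partialDeriv j φ) :=
  hφ.hasCompactSupport.fderiv_apply (𝕜 := ℝ) (EuclideanSpace.single j 1)

lemma IsTest.exists_bound_partialDeriv {φ : EuclideanSpace ℝ (Fin n) → F} (hφ : IsTest V φ)
    (j : Fin n) : ∃ C, ∀ x, ‖partialDeriv j φ x‖ ≤ C :=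
  (hφ.hasCompactSupport_partialDeriv j).exists_bound_of_continuous (hφ.continuous_partialDeriv j)

lemma IsTest.partialDeriv_eq_zero {φ : EuclideanSpace ℝ (Fin n) → F} (hφ : IsTest V φ)
    (j : Fin n) {x : EuclideanSpace ℝ (Fin n)} (hx : x ∉ V) : partialDeriv j φ x = 0 := by
  have : fderiv ℝ φ x = 0 := image_eq_zero_of_notMem_tsupport fun h =>
    hx (hφ.tsupport_subset (tsupport_fderiv_subset ℝ h))
  simp [partialDeriv, this]

lemma IsTest.partialDeriv_comp_clm {G : Type*} [NormedAddCommGroup G] [NormedSpace ℝ G]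
    {φ : EuclideanSpace ℝ (Fin n) → F} (hφ : IsTest V φ) (L : F →L[ℝ] G) (j : Fin n)
    (x : EuclideanSpace ℝ (Fin n)) :
    partialDeriv j (fun y => L (φ y)) x = L (partialDeriv j φ x) := by
  have h := L.hasFDerivAt.comp x (hφ.contDiff.differentiable one_ne_zero x).hasFDerivAt
  have h' : HasFDerivAt (fun y => L (φ y)) (L ∘SL fderiv ℝ φ x) x := h
  simp [partialDeriv, h'.fderiv]

lemma IsTest.partialDeriv_add {φ ψ : EuclideanSpace ℝ (Fin n) → F} (hφ : IsTest V φ)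
    (hψ : IsTest V ψ) (j : Fin n) (x : EuclideanSpace ℝ (Fin n)) :
    partialDeriv j (fun y => φ y + ψ y) x = partialDeriv j φ x + partialDeriv j ψ x := by
  have h := ((hφ.contDiff.differentiable one_ne_zero x).hasFDerivAt).fun_add
    (hψ.contDiff.differentiable one_ne_zero x).hasFDerivAt
  simp [partialDeriv, h.fderiv]

/-- The entry `Φ_{ij}` of a matrix-valued function. -/
lemma IsTest.entry {Φ : EuclideanSpace ℝ (Fin n) → Mat N n} (hΦ : IsTest V Φ)
    (k : Fin N × Fin n) : IsTest V fun x => Φ x k :=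
  hΦ.comp_clm (EuclideanSpace.proj k)

lemma IsTest.partialDeriv_entry {Φ : EuclideanSpace ℝ (Fin n) → Mat N n} (hΦ : IsTest V Φ)
    (k : Fin N × Fin n) (j : Fin n) (x : EuclideanSpace ℝ (Fin n)) :
    partialDeriv j (fun y => Φ y k) x = partialDeriv j Φ x k :=
  hΦ.partialDeriv_comp_clm (EuclideanSpace.proj k) j x

lemma matDiv_apply (Φ : EuclideanSpace ℝ (Fin n) → Mat N n) (x : EuclideanSpace ℝ (Fin n))
    (i : Fin N) : matDiv Φ x i = ∑ j, partialDeriv j Φ x (i, j) := rfl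

lemma IsTest.matDiv_single {φ : EuclideanSpace ℝ (Fin n) → ℝ} (hφ : IsTest V φ) (i : Fin N)
    (j : Fin n) (x : EuclideanSpace ℝ (Fin n)) :
    matDiv (fun y => φ y • (EuclideanSpace.single (i, j) (1 : ℝ) : Mat N n)) x
      = EuclideanSpace.single i (partialDeriv j φ x) := by
  have h : ∀ j', partialDeriv j' (fun y => φ y • (EuclideanSpace.single (i, j) (1 : ℝ) : Mat N n)) x
      = partialDeriv j' φ x • (EuclideanSpace.single (i, j) (1 : ℝ) : Mat N n) := fun j' =>
    hφ.partialDeriv_comp_clm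
      ((ContinuousLinearMap.id ℝ ℝ).smulRight (EuclideanSpace.single (i, j) (1 : ℝ) : Mat N n)) j' x
  ext i'
  rw [matDiv_apply]
  simp only [h, PiLp.smul_apply, PiLp.single_apply, Prod.mk.injEq, smul_eq_mul]
  by_cases hi : i' = i <;> simp [hi]

lemma IsTest.matDiv_eq_zero {Φ : EuclideanSpace ℝ (Fin n) → Mat N n} (hΦ : IsTest V Φ)
    {x : EuclideanSpace ℝ (Fin n)} (hx : x ∉ V) : matDiv Φ x = 0 := by
  ext i
  simp [matDiv_apply, hΦ.partialDeriv_eq_zero _ hx]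

lemma IsTest.matDiv_neg {Φ : EuclideanSpace ℝ (Fin n) → Mat N n} (hΦ : IsTest V Φ)
    (x : EuclideanSpace ℝ (Fin n)) : matDiv (fun y => -Φ y) x = -matDiv Φ x := by
  ext i
  have h : ∀ j, partialDeriv j (fun y => -Φ y) x = -partialDeriv j Φ x := fun j =>
    hΦ.partialDeriv_comp_clm (-ContinuousLinearMap.id ℝ (Mat N n)) j x
  simp [matDiv_apply, h]

lemma IsTest.continuous_matDiv {Φ : EuclideanSpace ℝ (Fin n) → Mat N n} (hΦ : IsTest V Φ) :
    Continuous (matDiv Φ) := by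
  refine (PiLp.continuous_toLp 2 _).comp (continuous_pi fun i =>
    continuous_finsetSum _ fun j _ => ?_)
  exact (EuclideanSpace.proj (𝕜 := ℝ) (i, j)).continuous.comp (hΦ.continuous_partialDeriv j)

lemma IsTest.exists_bound_matDiv {Φ : EuclideanSpace ℝ (Fin n) → Mat N n} (hΦ : IsTest V Φ) :
    ∃ C, ∀ x, ‖matDiv Φ x‖ ≤ C := by
  refine HasCompactSupport.exists_bound_of_continuous (f := matDiv Φ) ?_ hΦ.continuous_matDiv
  refine HasCompactSupport.intro hΦ.hasCompactSupport fun x hx => ?_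
  have : IsTest (tsupport Φ) Φ := ⟨hΦ.contDiff, hΦ.hasCompactSupport, subset_rfl⟩
  exact this.matDiv_eq_zero hx

variable {u : EuclideanSpace ℝ (Fin n) → EuclideanSpace ℝ (Fin N)}

lemma IsTest.integrable_mul_partialDeriv (hu : IntegrableOn u Ω)
    {φ : EuclideanSpace ℝ (Fin n) → ℝ} (hφ : IsTest V φ) (i : Fin N) (j : Fin n) :
    IntegrableOn (fun x => u x i * partialDeriv j φ x) Ω := by
  obtain ⟨C, hC⟩ := hφ.exists_bound_partialDeriv j
  exact ((EuclideanSpace.proj (𝕜 := ℝ) i).integrable_comp hu).mul_bdd (c := C)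
    (hφ.continuous_partialDeriv j).aestronglyMeasurable (Eventually.of_forall hC)

lemma inner_matDiv {Φ : EuclideanSpace ℝ (Fin n) → Mat N n} (hΦ : IsTest V Φ)
    (x : EuclideanSpace ℝ (Fin n)) :
    inner ℝ (u x) (matDiv Φ x)
      = ∑ k : Fin N × Fin n, u x k.1 * partialDeriv k.2 (fun y => Φ y k) x := by
  rw [PiLp.inner_apply, Fintype.sum_prod_type]
  refine Finset.sum_congr rfl fun i _ => ?_
  simp only [matDiv_apply, hΦ.partialDeriv_entry]
  rw [← Finset.mul_sum]
  simp [mul_comm]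

lemma integral_inner_matDiv (hu : IntegrableOn u Ω) {Φ : EuclideanSpace ℝ (Fin n) → Mat N n}
    (hΦ : IsTest V Φ) :
    ∫ x in Ω, inner ℝ (u x) (matDiv Φ x)
      = ∑ k : Fin N × Fin n, ∫ x in Ω, u x k.1 * partialDeriv k.2 (fun y => Φ y k) x := by
  rw [← integral_finsetSum _ fun k _ => (hΦ.entry k).integrable_mul_partialDeriv hu k.1 k.2]
  exact integral_congr_ae (Eventually.of_forall fun x => inner_matDiv hΦ x)

lemma integral_inner_matDiv_le (hu : MemBV Ω u) {Φ : EuclideanSpace ℝ (Fin n) → Mat N n}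
    (hΦ : IsTest Ω Φ) (h1 : ∀ x, ‖Φ x‖ ≤ 1) :
    ∫ x in Ω, inner ℝ (u x) (matDiv Φ x) ≤ (totalVar Ω u).toReal := by
  refine (ENNReal.ofReal_le_iff_le_toReal hu.2.ne).1 ?_
  exact le_iSup_of_le Φ (le_iSup_of_le hΦ (le_iSup_of_le h1 le_rfl))

/-- A scalar test function placed in the entry (i, j) of a zero matrix is a competitor for the total
variation. -/
lemma integral_mul_partialDeriv_le (hu : MemBV Ω u) {φ : EuclideanSpace ℝ (Fin n) → ℝ}
    (hφ : IsTest Ω φ) {c : ℝ} (hc : ∀ x, |φ x| ≤ c) (i : Fin N) (j : Fin n) :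
    |∫ x in Ω, u x i * partialDeriv j φ x| ≤ (totalVar Ω u).toReal * c := by
  have key : ∀ ψ : EuclideanSpace ℝ (Fin n) → ℝ, IsTest Ω ψ → (∀ x, |ψ x| ≤ 1) →
      ∫ x in Ω, u x i * partialDeriv j ψ x ≤ (totalVar Ω u).toReal := by
    intro ψ hψ h1
    have h2 := integral_inner_matDiv_le hu (hψ.comp_clm
      ((ContinuousLinearMap.id ℝ ℝ).smulRight (EuclideanSpace.single (i, j) (1 : ℝ) : Mat N n)))
      (fun x => by simpa [norm_smul] using h1 x)
    refine le_of_eq_of_le (integral_congr_ae (Eventually.of_forall fun x => ?_)) h2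
    have h3 := hψ.matDiv_single i j x
    simp only [ContinuousLinearMap.smulRight_apply, ContinuousLinearMap.id_apply]
    rw [h3, EuclideanSpace.inner_single_right]
    simp [mul_comm]
  have hc0 : 0 ≤ c := (abs_nonneg _).trans (hc 0)
  -- Normalising by d > c instead of c avoids division by zero when c = 0; s = ±1 covers both signs.
  have key2 : ∀ s : ℝ, |s| ≤ 1 → ∀ d > c,
      s * ∫ x in Ω, u x i * partialDeriv j φ x ≤ (totalVar Ω u).toReal * d := by
    intro s hs d hd
    have hd0 : 0 < d := hc0.trans_lt hd
    have h := key (fun x => (s / d) • φ x) (hφ.const_smul (s / d)) fun x => by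
      rw [smul_eq_mul, abs_mul, abs_div, abs_of_pos hd0, div_mul_eq_mul_div, div_le_one hd0]
      calc |s| * |φ x| ≤ 1 * c := mul_le_mul hs (hc x) (abs_nonneg _) zero_le_one
        _ ≤ d := by linarith
    have h4 : ∀ x, partialDeriv j (fun x => (s / d) • φ x) x = (s / d) * partialDeriv j φ x :=
      fun x => hφ.partialDeriv_comp_clm ((s / d) • ContinuousLinearMap.id ℝ ℝ) j x
    simp only [h4] at h
    have h5 : ∀ x, u x i * (s / d * partialDeriv j φ x) = s / d * (u x i * partialDeriv j φ x) :=
      fun x => by ring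
    simp only [h5, integral_const_mul] at h
    rw [div_mul_eq_mul_div, div_le_iff₀ hd0] at h
    exact h
  have key3 : ∀ s : ℝ, |s| ≤ 1 →
      s * ∫ x in Ω, u x i * partialDeriv j φ x ≤ (totalVar Ω u).toReal * c := by
    intro s hs
    refine ge_of_tendsto (x := 𝓝[>] c) (f := fun d => (totalVar Ω u).toReal * d) ?_
      (eventually_mem_nhdsWithin.mono fun d hd => key2 s hs d hd)
    exact (tendsto_const_nhds.mul tendsto_id).mono_left nhdsWithin_le_nhds
  refine abs_le.2 ⟨?_, ?_⟩
  · have := key3 (-1) (by simp); linarith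
  · have := key3 1 (by simp); linarith

/-- A function of bounded variation has a distributional gradient that is a measure. -/
lemma exists_isGradMeasure (hu : MemBV Ω u) : ∃ μ, IsGradMeasure Ω u μ := by
  -- Each distributional partial derivative is a functional on the C¹ test functions, bounded in the
  -- supremum norm by the total variation. Riesz representation gives two finite measures per entry,
  -- which become densities with respect to a common dominating measure.
  let S : Submodule ℝ (BoundedContinuousFunction (EuclideanSpace ℝ (Fin n)) ℝ) :=
    { carrier := {f | IsTest Ω f}
      add_mem' := fun hf hg => IsTest.add hf hg
      zero_mem' := IsTest.zero
      smul_mem' := fun c f hf => IsTest.const_smul c hf }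
  have hS : ∀ f : S, IsTest Ω (f : BoundedContinuousFunction (EuclideanSpace ℝ (Fin n)) ℝ) :=
    fun f => f.2
  let T : Fin N × Fin n → S →ₗ[ℝ] ℝ := fun k =>
    { toFun := fun f => -∫ x in Ω, u x k.1 * partialDeriv k.2
        (f : BoundedContinuousFunction (EuclideanSpace ℝ (Fin n)) ℝ) x
      map_add' := fun f g => by
        rw [← neg_add, ← integral_add ((hS f).integrable_mul_partialDeriv hu.1 _ _)
          ((hS g).integrable_mul_partialDeriv hu.1 _ _)]
        congr 1
        refine integral_congr_ae (Eventually.of_forall fun x => ?_)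
        have := (hS f).partialDeriv_add (hS g) k.2 x
        simp only [← mul_add]
        rw [← this]
        rfl
      map_smul' := fun c f => by
        rw [RingHom.id_apply, smul_eq_mul, mul_neg, ← integral_const_mul]
        congr 1
        refine integral_congr_ae (Eventually.of_forall fun x => ?_)
        have := (hS f).partialDeriv_comp_clm (c • ContinuousLinearMap.id ℝ ℝ) k.2 x
        change u x k.1 * partialDeriv k.2 (fun y =>
          (c • ContinuousLinearMap.id ℝ ℝ) ((f : BoundedContinuousFunction _ ℝ) y)) x = _
        rw [this]
        simp only [smul_apply, ContinuousLinearMap.id_apply, smul_eq_mul]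
        ring }
  have hT : ∀ k f, |T k f| ≤ (totalVar Ω u).toReal * ‖f‖ := fun k f => by
    change |-∫ x in Ω, _| ≤ _
    rw [abs_neg]
    exact integral_mul_partialDeriv_le hu (hS f)
      (fun x => (f : BoundedContinuousFunction (EuclideanSpace ℝ (Fin n)) ℝ).norm_coe_le_norm x) _ _
  choose μ₁ μ₂ hf₁ hf₂ hrep using fun k => exists_measures_of_bounded S (T k) (hT k)
  obtain ⟨ν, hν, hle⟩ : ∃ ν : Measure (EuclideanSpace ℝ (Fin n)), IsFiniteMeasure ν ∧
      ∀ k, μ₁ k + μ₂ k ≤ ν := ⟨∑ k, (μ₁ k + μ₂ k), inferInstance, fun k =>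
    Finset.single_le_sum (f := fun k => μ₁ k + μ₂ k) (fun _ _ => Measure.zero_le _)
      (Finset.mem_univ k)⟩
  have hac₁ : ∀ k, μ₁ k ≪ ν := fun k =>
    ((Measure.le_add_right le_rfl).trans (hle k)).absolutelyContinuous
  have hac₂ : ∀ k, μ₂ k ≪ ν := fun k =>
    ((Measure.le_add_left le_rfl).trans (hle k)).absolutelyContinuous
  let σ : EuclideanSpace ℝ (Fin n) → Mat N n := fun x =>
    WithLp.toLp 2 fun k => ((μ₁ k).rnDeriv ν x).toReal - ((μ₂ k).rnDeriv ν x).toReal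
  have hσ : Integrable σ ν := integrable_euclidean fun k =>
    Measure.integrable_toReal_rnDeriv.sub Measure.integrable_toReal_rnDeriv
  refine ⟨ν.withDensityᵥ σ, fun φ hφ i j => ?_⟩
  obtain ⟨hfin, τ, -, -, -, h1, h2⟩ := polar_withDensity hσ rfl
  obtain ⟨c, hc⟩ := hφ.exists_bound
  have hφm := hφ.contDiff.continuous
  rw [h2 φ (Integrable.of_bound hφm.aestronglyMeasurable c (Eventually.of_forall hc)), h1,
    integral_apply_euclidean (σ := fun x => φ x • σ x)
      (hσ.bdd_smul c hφm.aestronglyMeasurable (Eventually.of_forall hc))]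
  let f : S := ⟨BoundedContinuousFunction.ofNormedAddCommGroup φ hφm c hc, hφ⟩
  have h3 := hrep (i, j) f hφ.hasCompactSupport
  change - ∫ x in Ω, u x i * partialDeriv j φ x = ∫ x, φ x ∂(μ₁ (i, j)) - ∫ x, φ x ∂(μ₂ (i, j)) at h3
  have hd₁ : (μ₁ (i, j)).HaveLebesgueDecomposition ν :=
    Measure.haveLebesgueDecomposition_of_sigmaFinite _ _
  have hd₂ : (μ₂ (i, j)).HaveLebesgueDecomposition ν :=
    Measure.haveLebesgueDecomposition_of_sigmaFinite _ _
  rw [h3, ← integral_rnDeriv_smul (hac₁ (i, j)), ← integral_rnDeriv_smul (hac₂ (i, j)),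
    ← integral_sub]
  · refine integral_congr_ae (Eventually.of_forall fun x => ?_)
    simp only [σ, PiLp.smul_apply, smul_eq_mul]
    ring
  · exact Measure.integrable_toReal_rnDeriv.smul_bdd c hφm.aestronglyMeasurable
      (Eventually.of_forall hc)
  · exact Measure.integrable_toReal_rnDeriv.smul_bdd c hφm.aestronglyMeasurable
      (Eventually.of_forall hc)

/-- The polar decomposition of the gradient of a function of bounded variation. -/
lemma MemBV.exists_polar (hΩ : IsOpen Ω) (hu : MemBV Ω u) :
    IsFiniteMeasure (totalVarMeasure Ω u) ∧ totalVarMeasure Ω u Ωᶜ = 0 ∧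
      ∃ τ : EuclideanSpace ℝ (Fin n) → Mat N n, StronglyMeasurable τ ∧
        (∀ x, ‖τ x‖ ≤ 1) ∧ (∀ᵐ x ∂totalVarMeasure Ω u, ‖τ x‖ = 1) ∧
        ∀ Φ : EuclideanSpace ℝ (Fin n) → Mat N n, IsTest Ω Φ →
          ∫ x, inner ℝ (Φ x) (τ x) ∂totalVarMeasure Ω u
            = -∫ x in Ω, inner ℝ (u x) (matDiv Φ x) := by
  have hex := exists_isGradMeasure hu
  set μ := hex.choose with hμdef
  have hμ : IsGradMeasure Ω u μ := hex.choose_spec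
  have hgrad : totalVarMeasure Ω u = μ.variation.restrict Ω := by
    rw [totalVarMeasure, gradMeasure, dif_pos hex, VectorMeasure.variation_restrict hΩ.measurableSet]
  obtain ⟨ν, σ, hν, hσ, hμν⟩ := exists_eq_withDensity μ
  obtain ⟨hfin, τ₀, hτ₀, hτ₀1, hτ₀e, -, h₀⟩ := polar_withDensity hσ hμν
  -- A change on a null set makes τ strongly measurable while keeping its values in the closed unit
  -- ball everywhere.
  obtain ⟨τ, hτs, hτr, hττ⟩ := hτ₀.exists_stronglyMeasurable_range_subset
    (s := Metric.closedBall (0 : Mat N n) 1) measurableSet_closedBall ⟨0, by simp⟩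
    (Eventually.of_forall fun x => by simpa using hτ₀1 x)
  have hτ1 : ∀ x, ‖τ x‖ ≤ 1 := fun x => by simpa using hτr x
  have hτ : AEStronglyMeasurable τ μ.variation := hτs.aestronglyMeasurable
  have hτe : ∀ᵐ x ∂μ.variation, ‖τ x‖ = 1 := by
    filter_upwards [hτ₀e, hττ] with x hx hx' using by rwa [← hx']
  have h2 : ∀ f : EuclideanSpace ℝ (Fin n) → ℝ, Integrable f μ.variation →
      (∫ᵛ x, f x ∂•μ) = ∫ x, f x • τ x ∂μ.variation := fun f hf => by
    rw [h₀ f hf]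
    exact integral_congr_ae (by filter_upwards [hττ] with x hx using by rw [hx])
  refine ⟨by rw [hgrad]; infer_instance, ?_, τ, hτs, hτ1, ?_, fun Φ hΦ => ?_⟩
  · rw [hgrad, Measure.restrict_apply hΩ.measurableSet.compl]; simp
  · rw [hgrad]; exact ae_restrict_of_ae hτe
  · have hτi : Integrable τ μ.variation := Integrable.of_bound hτ 1 (Eventually.of_forall hτ1)
    have hint : ∀ k, Integrable (fun x => Φ x k * τ x k) μ.variation := fun k => by
      obtain ⟨c, hc⟩ := (hΦ.entry k).exists_bound
      exact ((EuclideanSpace.proj (𝕜 := ℝ) k).integrable_comp hτi).bdd_mul (c := c)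
        (hΦ.entry k).contDiff.continuous.aestronglyMeasurable (Eventually.of_forall hc)
    rw [hgrad, setIntegral_eq_integral_of_forall_compl_eq_zero
      (fun x hx => by rw [hΦ.eq_zero hx, inner_zero_left]), integral_inner_matDiv hu.1 hΦ,
      ← Finset.sum_neg_distrib]
    have h3 : ∀ x, inner ℝ (Φ x) (τ x) = ∑ k, Φ x k * τ x k := fun x => by
      rw [PiLp.inner_apply]
      exact Finset.sum_congr rfl fun k _ => by simp [mul_comm]
    simp only [h3]
    rw [integral_finsetSum _ fun k _ => hint k]
    refine Finset.sum_congr rfl fun k _ => ?_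
    have hk := hΦ.entry k
    obtain ⟨c, hc⟩ := hk.exists_bound
    have hcm := hk.contDiff.continuous.aestronglyMeasurable (μ := μ.variation)
    rw [← hμ _ hk k.1 k.2, h2 _ (Integrable.of_bound hcm c (Eventually.of_forall hc)),
      integral_apply_euclidean (σ := fun x => Φ x k • τ x)
        (hτi.bdd_smul c hcm (Eventually.of_forall hc))]
    rfl

end Divergence

/-! ### The exponent, the conjugate modular and weak gradients -/

section Exponent

variable {n N : ℕ}

/-- The standing assumptions on the domain and the exponent. -/
structure IsExponent (Ω : Set (EuclideanSpace ℝ (Fin n))) (p : EuclideanSpace ℝ (Fin n) → ℝ)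
    (pmax : ℝ) : Prop where
  isOpen : IsOpen Ω
  isBounded : Bornology.IsBounded Ω
  aemeasurable : AEMeasurable p (volume.restrict Ω)
  bounds : ∀ x ∈ Ω, 1 ≤ p x ∧ p x ≤ pmax
  semicontinuous : YSemicontinuous Ω p

variable {Ω : Set (EuclideanSpace ℝ (Fin n))} {p : EuclideanSpace ℝ (Fin n) → ℝ} {pmax : ℝ}

lemma diff_diff_critSet : Ω \ (Ω \ critSet Ω p) = critSet Ω p := by
  rw [sdiff_sdiff_right_self]
  exact inter_eq_self_of_subset_right fun x hx => hx.1

lemma IsExponent.isFiniteMeasure (h : IsExponent Ω p pmax) :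
    IsFiniteMeasure (volume.restrict Ω : Measure (EuclideanSpace ℝ (Fin n))) :=
  ⟨by rw [Measure.restrict_apply_univ]; exact h.isBounded.measure_lt_top⟩

/-- Applied to sequences in Y, Y-semicontinuity says that Y is relatively closed in Ω. -/
lemma IsExponent.isOpen_diff (h : IsExponent Ω p pmax) : IsOpen (Ω \ critSet Ω p) := by
  have : Ω \ critSet Ω p = Ω \ closure (critSet Ω p) := by
    refine subset_antisymm (fun x hx => ⟨hx.1, fun hc => hx.2 ⟨hx.1, ?_⟩⟩)
      (sdiff_subset_sdiff_right subset_closure)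
    obtain ⟨s, hs, hlim⟩ := mem_closure_iff_seq_limit.1 hc
    refine h.semicontinuous x hx.1 s (fun k => (hs k).1) hlim ?_
    simp only [(hs _).2]
    exact tendsto_const_nhds
  rw [this]
  exact h.isOpen.sdiff isClosed_closure

lemma IsExponent.measurableSet_critSet (h : IsExponent Ω p pmax) :
    MeasurableSet (critSet Ω p) := by
  rw [← diff_diff_critSet]
  exact h.isOpen.measurableSet.diff h.isOpen_diff.measurableSet

lemma IsExponent.one_lt (h : IsExponent Ω p pmax) {x : EuclideanSpace ℝ (Fin n)}
    (hx : x ∈ Ω \ critSet Ω p) : 1 < p x :=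
  lt_of_le_of_ne (h.bounds x hx.1).1 fun he => hx.2 ⟨hx.1, he.symm⟩

/-- A sequence in K with p → 1 would have a limit point in K at which p = 1 by Y-semicontinuity. The
conjugate exponent is therefore bounded on compact subsets of Ω∖Y, although it may blow up towards
Y. -/
lemma IsExponent.exists_lower_bound (h : IsExponent Ω p pmax) {K : Set (EuclideanSpace ℝ (Fin n))}
    (hK : IsCompact K) (hKV : K ⊆ Ω \ critSet Ω p) : ∃ p₀, 1 < p₀ ∧ ∀ x ∈ K, p₀ ≤ p x := by
  by_contra! hc
  have h1 : ∀ k : ℕ, ∃ x ∈ K, p x < 1 + 1 / ((k : ℝ) + 1) := fun k =>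
    hc _ (by have : 0 < 1 / ((k : ℝ) + 1) := by positivity
             linarith)
  choose s hsK hs using h1
  obtain ⟨x₀, hx₀, ns, hns, hlim⟩ := hK.tendsto_subseq hsK
  refine (hKV hx₀).2 ⟨(hKV hx₀).1, ?_⟩
  refine h.semicontinuous x₀ (hKV hx₀).1 _ (fun k => (hKV (hsK (ns k))).1) hlim ?_
  have h2 : Tendsto (fun k => p (s k)) atTop (𝓝 1) := by
    refine tendsto_of_tendsto_of_tendsto_of_le_of_le tendsto_const_nhds
      (by simpa using tendsto_const_nhds.add (tendsto_one_div_add_atTop_nhds_zero_nat (𝕜 := ℝ)))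
      (fun k => (h.bounds _ (hKV (hsK k)).1).1) (fun k => (hs k).le)
  exact h2.comp hns.tendsto_atTop

lemma IsExponent.aemeasurable_diff (h : IsExponent Ω p pmax) :
    AEMeasurable p (volume.restrict (Ω \ critSet Ω p)) :=
  h.aemeasurable.mono_measure (Measure.restrict_mono_set _ sdiff_subset)

lemma IsExponent.aemeasurable_conj (h : IsExponent Ω p pmax) :
    AEMeasurable (fun x => (p x).conjExponent) (volume.restrict (Ω \ critSet Ω p)) :=
  h.aemeasurable_diff.div (h.aemeasurable_diff.sub_const 1)

/-- The conjugate modular `∫_{Ω ∖ Y} |Φ|^q / q` with `1/p + 1/q = 1`. -/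
def conjModular (Ω : Set (EuclideanSpace ℝ (Fin n))) (p : EuclideanSpace ℝ (Fin n) → ℝ)
    (Φ : EuclideanSpace ℝ (Fin n) → Mat N n) : ℝ≥0∞ :=
  ∫⁻ x in Ω \ critSet Ω p,
    ENNReal.ofReal (‖Φ x‖ ^ (p x).conjExponent / (p x).conjExponent)

lemma rpow_div_le_one {a q : ℝ} (ha : 0 ≤ a) (ha1 : a ≤ 1) (hq : 1 ≤ q) : a ^ q / q ≤ 1 :=
  (div_le_self (Real.rpow_nonneg ha _) hq).trans (Real.rpow_le_one ha ha1 (by linarith))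

/-- A power of a number in [0, 1] does not exceed 1, however large the conjugate exponent becomes
near Y; so unit fields are always admissible. -/
lemma IsExponent.conjModular_le (h : IsExponent Ω p pmax)
    {Φ : EuclideanSpace ℝ (Fin n) → Mat N n} (hΦ : ∀ x, ‖Φ x‖ ≤ 1) :
    conjModular Ω p Φ ≤ volume Ω := by
  calc conjModular Ω p Φ ≤ ∫⁻ x in Ω \ critSet Ω p, 1 := by
        refine setLIntegral_mono' h.isOpen_diff.measurableSet fun x hx => ?_
        rw [← ENNReal.ofReal_one]
        refine ENNReal.ofReal_le_ofReal (rpow_div_le_one (norm_nonneg _) (hΦ x) ?_)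
        exact (Real.HolderConjugate.conjExponent (h.one_lt hx)).symm.lt.le
    _ ≤ volume Ω := by
        rw [setLIntegral_one]
        exact measure_mono sdiff_subset

lemma IsExponent.aemeasurable_conjModular (h : IsExponent Ω p pmax)
    {Φ : EuclideanSpace ℝ (Fin n) → Mat N n}
    (hΦ : AEStronglyMeasurable Φ (volume.restrict (Ω \ critSet Ω p))) :
    AEMeasurable (fun x => ENNReal.ofReal (‖Φ x‖ ^ (p x).conjExponent / (p x).conjExponent))
      (volume.restrict (Ω \ critSet Ω p)) :=
  ((hΦ.norm.aemeasurable.pow h.aemeasurable_conj).div h.aemeasurable_conj).ennreal_ofReal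

lemma IsExponent.aemeasurable_modular (h : IsExponent Ω p pmax)
    {G : EuclideanSpace ℝ (Fin n) → Mat N n}
    (hG : AEStronglyMeasurable G (volume.restrict (Ω \ critSet Ω p))) :
    AEMeasurable (fun x => ENNReal.ofReal (‖G x‖ ^ p x / p x))
      (volume.restrict (Ω \ critSet Ω p)) :=
  ((hG.norm.aemeasurable.pow h.aemeasurable_diff).div h.aemeasurable_diff).ennreal_ofReal

/-- The admissible fields in the dual description of the energy. -/
def dualSet (N : ℕ) (Ω : Set (EuclideanSpace ℝ (Fin n))) (p : EuclideanSpace ℝ (Fin n) → ℝ) :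
    Set (EuclideanSpace ℝ (Fin n) → Mat N n) :=
  {Φ | IsTest Ω Φ ∧ (∀ x ∈ critSet Ω p, ‖Φ x‖ ≤ 1) ∧ conjModular Ω p Φ ≠ ∞}

/-- The value of an admissible field in the dual description of the energy. -/
def dualVal (Ω : Set (EuclideanSpace ℝ (Fin n))) (p : EuclideanSpace ℝ (Fin n) → ℝ)
    (u : EuclideanSpace ℝ (Fin n) → EuclideanSpace ℝ (Fin N))
    (Φ : EuclideanSpace ℝ (Fin n) → Mat N n) : ℝ :=
  -(∫ x in Ω, inner ℝ (u x) (matDiv Φ x)) - (conjModular Ω p Φ).toReal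

lemma IsExponent.mem_dualSet (h : IsExponent Ω p pmax) {Φ : EuclideanSpace ℝ (Fin n) → Mat N n}
    (hΦ : IsTest Ω Φ) (h1 : ∀ x, ‖Φ x‖ ≤ 1) : Φ ∈ dualSet N Ω p :=
  ⟨hΦ, fun x _ => h1 x, ((h.conjModular_le h1).trans_lt h.isBounded.measure_lt_top).ne⟩

variable {u : EuclideanSpace ℝ (Fin n) → EuclideanSpace ℝ (Fin N)}
  {V : Set (EuclideanSpace ℝ (Fin n))}

lemma IsTest.setIntegral_mul_partialDeriv {φ : EuclideanSpace ℝ (Fin n) → ℝ} (hΩ : IsOpen Ω)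
    (hVΩ : V ⊆ Ω) (hφ : IsTest V φ) (i : Fin N) (j : Fin n) :
    ∫ x in V, u x i * partialDeriv j φ x = ∫ x in Ω, u x i * partialDeriv j φ x := by
  symm
  refine setIntegral_eq_of_subset_of_forall_sdiff_eq_zero hΩ.measurableSet hVΩ fun x hx => ?_
  rw [hφ.partialDeriv_eq_zero j hx.2, mul_zero]

lemma LocallyIntegrableOn.integrable_mul_test {G : EuclideanSpace ℝ (Fin n) → ℝ}
    (hV : IsOpen V) (hG : LocallyIntegrableOn G V) {φ : EuclideanSpace ℝ (Fin n) → ℝ}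
    (hφ : IsTest V φ) : IntegrableOn (fun x => φ x * G x) V := by
  obtain ⟨c, hc⟩ := hφ.exists_bound
  have hK : IsCompact (tsupport φ) := hφ.hasCompactSupport
  have h1 : IntegrableOn (fun x => φ x * G x) (tsupport φ) :=
    (hG.integrableOn_compact_subset hφ.tsupport_subset hK).bdd_mul (c := c)
      hφ.contDiff.continuous.aestronglyMeasurable (Eventually.of_forall hc)
  refine IntegrableOn.of_forall_sdiff_eq_zero h1 hV.measurableSet fun x hx => ?_
  rw [image_eq_zero_of_notMem_tsupport hx.2, zero_mul]

lemma locallyIntegrableOn_entry {G : EuclideanSpace ℝ (Fin n) → Mat N n}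
    (hG : LocallyIntegrableOn G V) (k : Fin N × Fin n) :
    LocallyIntegrableOn (fun x => G x k) V := fun x hx => by
  obtain ⟨s, hs, hi⟩ := hG x hx
  exact ⟨s, hs, (EuclideanSpace.proj (𝕜 := ℝ) k).integrable_comp hi⟩

lemma inner_mat (A B : Mat N n) : inner ℝ A B = ∑ k, A k * B k := by
  rw [PiLp.inner_apply]
  exact Finset.sum_congr rfl fun k _ => by simp [mul_comm]

lemma IsWeakGrad.integral_inner (hΩ : IsOpen Ω) (hV : IsOpen V) (hVΩ : V ⊆ Ω)
    (hu : IntegrableOn u Ω) {G : EuclideanSpace ℝ (Fin n) → Mat N n} (hG : IsWeakGrad V u G)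
    {Φ : EuclideanSpace ℝ (Fin n) → Mat N n} (hΦ : IsTest V Φ) :
    ∫ x in V, inner ℝ (Φ x) (G x) = -∫ x in Ω, inner ℝ (u x) (matDiv Φ x) := by
  rw [integral_inner_matDiv hu hΦ, ← Finset.sum_neg_distrib]
  simp only [inner_mat]
  rw [integral_finsetSum _ fun k _ => LocallyIntegrableOn.integrable_mul_test hV
    (locallyIntegrableOn_entry hG.1 k) (hΦ.entry k)]
  refine Finset.sum_congr rfl fun k _ => ?_
  rw [hG.2 _ (hΦ.entry k) k.1 k.2, (hΦ.entry k).setIntegral_mul_partialDeriv hΩ hVΩ]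

/-- The fundamental lemma of the calculus of variations, entry by entry. It makes the energy
independent of the chosen representative. -/
lemma IsWeakGrad.ae_eq (hV : IsOpen V) {G₁ G₂ : EuclideanSpace ℝ (Fin n) → Mat N n}
    (h₁ : IsWeakGrad V u G₁) (h₂ : IsWeakGrad V u G₂) : G₁ =ᵐ[volume.restrict V] G₂ := by
  have key : ∀ k, ∀ᵐ x ∂volume, x ∈ V → G₁ x k - G₂ x k = 0 := by
    intro k
    have l₁ := locallyIntegrableOn_entry h₁.1 k
    have l₂ := locallyIntegrableOn_entry h₂.1 k
    refine hV.ae_eq_zero_of_integral_contDiff_smul_eq_zero (l₁.sub l₂) fun g hg hgc hgV => ?_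
    have hgt : IsTest V g := ⟨hg.of_le (by simp), hgc, hgV⟩
    rw [← setIntegral_eq_integral_of_forall_compl_eq_zero (s := V)
      fun x hx => by rw [hgt.eq_zero hx, zero_smul]]
    simp only [smul_eq_mul, mul_sub]
    rw [integral_sub (LocallyIntegrableOn.integrable_mul_test hV l₁ hgt)
      (LocallyIntegrableOn.integrable_mul_test hV l₂ hgt), h₁.2 g hgt k.1 k.2, h₂.2 g hgt k.1 k.2,
      sub_self]
  rw [EventuallyEq, ae_restrict_iff' hV.measurableSet]
  filter_upwards [ae_all_iff.2 key] with x hx hxV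
  ext k
  exact sub_eq_zero.1 (hx k hxV)

lemma weakGrad_spec {G : EuclideanSpace ℝ (Fin n) → Mat N n} (hG : IsWeakGrad V u G) :
    IsWeakGrad V u (weakGrad V u) := by
  have h : ∃ G, IsWeakGrad V u G := ⟨G, hG⟩
  rw [weakGrad, dif_pos h]
  exact h.choose_spec

end Exponent

/-! ### Dual values do not exceed the energy -/

section UpperBound

variable {n N : ℕ} {Ω V : Set (EuclideanSpace ℝ (Fin n))} {p : EuclideanSpace ℝ (Fin n) → ℝ}
  {pmax : ℝ} {u : EuclideanSpace ℝ (Fin n) → EuclideanSpace ℝ (Fin N)}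

lemma le_one_add_rpow {a r rmax : ℝ} (ha : 0 ≤ a) (hr : 1 ≤ r) (hr' : r ≤ rmax) :
    a ≤ 1 + rmax * (a ^ r / r) := by
  have h1 : a ^ r ≤ rmax * (a ^ r / r) := by
    rw [mul_div_assoc', le_div_iff₀ (by linarith), mul_comm]
    exact mul_le_mul_of_nonneg_right hr' (Real.rpow_nonneg ha _)
  rcases le_total a 1 with h | h
  · have := Real.rpow_nonneg ha r
    linarith
  · have := Real.self_le_rpow_of_one_le h hr
    linarith

lemma IsExponent.integrableOn_of_modular (h : IsExponent Ω p pmax)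
    {G : EuclideanSpace ℝ (Fin n) → Mat N n}
    (hG : AEStronglyMeasurable G (volume.restrict (Ω \ critSet Ω p)))
    (hfin : ∫⁻ x in Ω \ critSet Ω p, ENNReal.ofReal (‖G x‖ ^ p x / p x) ≠ ∞) :
    IntegrableOn G (Ω \ critSet Ω p) := by
  have := h.isFiniteMeasure
  refine ⟨hG, ?_⟩
  calc ∫⁻ x in Ω \ critSet Ω p, ‖G x‖ₑ
      ≤ ∫⁻ x in Ω \ critSet Ω p,
        (1 + ENNReal.ofReal pmax * ENNReal.ofReal (‖G x‖ ^ p x / p x)) := by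
        refine setLIntegral_mono' h.isOpen_diff.measurableSet fun x hx => ?_
        have h1 := h.bounds x hx.1
        have h0 : 0 ≤ pmax := by linarith
        rw [← ofReal_norm, ← ENNReal.ofReal_one, ← ENNReal.ofReal_mul h0,
          ← ENNReal.ofReal_add zero_le_one]
        · exact ENNReal.ofReal_le_ofReal (le_one_add_rpow (norm_nonneg _) h1.1 h1.2)
        · exact mul_nonneg h0 (div_nonneg (Real.rpow_nonneg (norm_nonneg _) _) (by linarith))
    _ = volume (Ω \ critSet Ω p)
        + ENNReal.ofReal pmax * ∫⁻ x in Ω \ critSet Ω p, ENNReal.ofReal (‖G x‖ ^ p x / p x) := by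
        rw [lintegral_add_left measurable_const, lintegral_const_mul'' _ (h.aemeasurable_modular hG),
          setLIntegral_one]
    _ < ∞ := ENNReal.add_lt_top.2 ⟨(h.isBounded.subset sdiff_subset).measure_lt_top,
        ENNReal.mul_lt_top ENNReal.ofReal_lt_top hfin.lt_top⟩

/-- On an open set where there is a weak gradient, it is the density of the gradient measure. -/
lemma integral_inner_polar_eq (hΩ : IsOpen Ω) (hΩb : Bornology.IsBounded Ω) (hV : IsOpen V)
    (hVΩ : V ⊆ Ω) (hu : IntegrableOn u Ω) {lam : Measure (EuclideanSpace ℝ (Fin n))}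
    [IsFiniteMeasure lam] {τ : EuclideanSpace ℝ (Fin n) → Mat N n}
    (hτ : StronglyMeasurable τ) (hτ1 : ∀ x, ‖τ x‖ ≤ 1)
    (hrep : ∀ Φ : EuclideanSpace ℝ (Fin n) → Mat N n, IsTest Ω Φ →
      ∫ x, inner ℝ (Φ x) (τ x) ∂lam = -∫ x in Ω, inner ℝ (u x) (matDiv Φ x))
    {G : EuclideanSpace ℝ (Fin n) → Mat N n} (hG : IsWeakGrad V u G) (hGi : IntegrableOn G V)
    {Φ : EuclideanSpace ℝ (Fin n) → Mat N n} (hΦ : IsTest Ω Φ) :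
    ∫ x in V, inner ℝ (Φ x) (τ x) ∂lam = ∫ x in V, inner ℝ (Φ x) (G x) := by
  obtain ⟨R, hR⟩ := hΦ.exists_bound
  have hfin : IsFiniteMeasure (volume.restrict V : Measure (EuclideanSpace ℝ (Fin n))) :=
    ⟨by rw [Measure.restrict_apply_univ]; exact (hΩb.subset hVΩ).measure_lt_top⟩
  -- A test field on Ω need not have its support in V. It is approximated by test fields on V,
  -- almost everywhere for both measures at once, and the identity passes to the limit.
  obtain ⟨φ, hφ, hφR, hlim⟩ := exists_test_approx (lam + volume.restrict V) hV
    hΦ.contDiff.continuous.aestronglyMeasurable hR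
  rw [ae_add_measure_iff] at hlim
  have h1 : Tendsto (fun k => ∫ x in V, inner ℝ (φ k x) (τ x) ∂lam) atTop
      (𝓝 (∫ x in V, inner ℝ (Φ x) (τ x) ∂lam)) := by
    refine tendsto_integral_of_dominated_convergence (fun _ => R)
      (fun k => (hφ k).contDiff.continuous.aestronglyMeasurable.inner hτ.aestronglyMeasurable)
      (integrable_const R) (fun k => Eventually.of_forall fun x => ?_) ?_
    · refine (norm_inner_le_norm _ _).trans ?_
      calc ‖φ k x‖ * ‖τ x‖ ≤ R * 1 :=
            mul_le_mul (hφR k x) (hτ1 x) (norm_nonneg _) ((norm_nonneg _).trans (hφR k x))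
        _ = R := mul_one R
    · rw [ae_restrict_iff' hV.measurableSet]
      filter_upwards [hlim.1] with x hx hxV
      exact (hx hxV).inner tendsto_const_nhds
  have h2 : Tendsto (fun k => ∫ x in V, inner ℝ (φ k x) (G x)) atTop
      (𝓝 (∫ x in V, inner ℝ (Φ x) (G x))) := by
    refine tendsto_integral_of_dominated_convergence (fun x => R * ‖G x‖)
      (fun k => (hφ k).contDiff.continuous.aestronglyMeasurable.inner hGi.1)
      (hGi.norm.const_mul R) (fun k => Eventually.of_forall fun x => ?_) ?_
    · exact (norm_inner_le_norm _ _).trans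
        (mul_le_mul_of_nonneg_right (hφR k x) (norm_nonneg _))
    · filter_upwards [hlim.2, ae_restrict_mem hV.measurableSet] with x hx hxV
      exact (hx hxV).inner tendsto_const_nhds
  refine tendsto_nhds_unique (h1.congr fun k => ?_) h2
  rw [hG.integral_inner hΩ hV hVΩ hu (hφ k), ← hrep _ ((hφ k).mono hVΩ)]
  exact setIntegral_eq_integral_of_forall_compl_eq_zero fun x hx => by
    rw [(hφ k).eq_zero hx, inner_zero_left]

/-- The dual values are bounded by the energy. -/
lemma IsExponent.dualVal_le_energy (h : IsExponent Ω p pmax) (hu : MemBV Ω u)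
    (hex : ∃ G, IsWeakGrad (Ω \ critSet Ω p) u G) {Φ : EuclideanSpace ℝ (Fin n) → Mat N n}
    (hΦ : Φ ∈ dualSet N Ω p) : (dualVal Ω p u Φ : EReal) ≤ (energy Ω p u : EReal) := by
  rcases eq_or_ne (energy Ω p u) ∞ with htop | htop
  · rw [htop]; exact le_top
  obtain ⟨G₀, hG₀⟩ := hex
  have hG := weakGrad_spec hG₀
  set V := Ω \ critSet Ω p with hVdef
  set G := weakGrad V u with hGdef
  have hV : IsOpen V := h.isOpen_diff
  have hVΩ : V ⊆ Ω := sdiff_subset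
  have hY := h.measurableSet_critSet
  have hGm : AEStronglyMeasurable G (volume.restrict V) := hG.1.aestronglyMeasurable
  have hE : energy Ω p u = totalVarMeasure Ω u (critSet Ω p)
    + ∫⁻ x in V, ENNReal.ofReal (‖G x‖ ^ p x / p x) := rfl
  have hmod : ∫⁻ x in V, ENNReal.ofReal (‖G x‖ ^ p x / p x) ≠ ∞ :=
    fun hc => htop (by rw [hE, hc]; simp)
  have hGi : IntegrableOn G V := h.integrableOn_of_modular hGm hmod
  obtain ⟨hfin, -, τ, hτ, hτ1, -, hrep⟩ := hu.exists_polar h.isOpen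
  obtain ⟨hΦt, hΦY, hc⟩ := hΦ
  set lam := totalVarMeasure Ω u with hlam
  obtain ⟨R, hR⟩ := hΦt.exists_bound
  have hΦm : Continuous Φ := hΦt.contDiff.continuous
  have hint : Integrable (fun x => (inner ℝ (Φ x) (τ x) : ℝ)) lam := by
    refine Integrable.of_bound (hΦm.aestronglyMeasurable.inner hτ.aestronglyMeasurable) R
      (Eventually.of_forall fun x => (norm_inner_le_norm _ _).trans ?_)
    calc ‖Φ x‖ * ‖τ x‖ ≤ R * 1 :=
            mul_le_mul (hR x) (hτ1 x) (norm_nonneg _) ((norm_nonneg _).trans (hR x))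
        _ = R := mul_one R
  have hsplit : ∫ x, inner ℝ (Φ x) (τ x) ∂lam
      = ∫ x in critSet Ω p, inner ℝ (Φ x) (τ x) ∂lam + ∫ x in V, inner ℝ (Φ x) (τ x) ∂lam := by
    rw [← setIntegral_union (disjoint_sdiff_right) hV.measurableSet hint.integrableOn
      hint.integrableOn, union_sdiff_cancel (fun x hx => hx.1)]
    symm
    exact setIntegral_eq_integral_of_forall_compl_eq_zero fun x hx => by
      rw [hΦt.eq_zero hx, inner_zero_left]
  have hYle : ∫ x in critSet Ω p, inner ℝ (Φ x) (τ x) ∂lam ≤ (lam (critSet Ω p)).toReal := by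
    calc ∫ x in critSet Ω p, inner ℝ (Φ x) (τ x) ∂lam ≤ ∫ x in critSet Ω p, (1 : ℝ) ∂lam := by
          refine setIntegral_mono_on hint.integrableOn integrableOn_const hY fun x hx => ?_
          refine (real_inner_le_norm _ _).trans ?_
          exact mul_le_one₀ (hΦY x hx) (norm_nonneg _) (hτ1 x)
      _ = _ := by simp [Measure.real]
  -- Young's inequality, in extended nonnegative form so that the modulars need not be treated as
  -- Bochner integrals.
  have hVle : ENNReal.ofReal (∫ x in V, inner ℝ (Φ x) (G x))
      ≤ (∫⁻ x in V, ENNReal.ofReal (‖G x‖ ^ p x / p x)) + conjModular Ω p Φ := by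
    have hint2 : Integrable (fun x => ‖Φ x‖ * ‖G x‖) (volume.restrict V) :=
      hGi.norm.bdd_mul (c := R) hΦm.norm.aestronglyMeasurable
        (Eventually.of_forall fun x => by simpa using hR x)
    calc ENNReal.ofReal (∫ x in V, inner ℝ (Φ x) (G x))
        ≤ ENNReal.ofReal (∫ x in V, ‖Φ x‖ * ‖G x‖) := by
          refine ENNReal.ofReal_le_ofReal (integral_mono_ae ?_ hint2 ?_)
          · refine hint2.mono (hΦm.aestronglyMeasurable.inner hGi.1)
              (Eventually.of_forall fun x => ?_)
            rw [Real.norm_of_nonneg (by positivity : 0 ≤ ‖Φ x‖ * ‖G x‖)]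
            exact norm_inner_le_norm _ _
          · exact Eventually.of_forall fun x => real_inner_le_norm _ _
      _ = ∫⁻ x in V, ENNReal.ofReal (‖Φ x‖ * ‖G x‖) :=
          ofReal_integral_eq_lintegral_ofReal hint2 (Eventually.of_forall fun x => by positivity)
      _ ≤ ∫⁻ x in V, (ENNReal.ofReal (‖G x‖ ^ p x / p x)
          + ENNReal.ofReal (‖Φ x‖ ^ (p x).conjExponent / (p x).conjExponent)) := by
          refine setLIntegral_mono' hV.measurableSet fun x hx => ?_
          have hq := Real.HolderConjugate.conjExponent (h.one_lt hx)
          rw [← ENNReal.ofReal_add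
            (div_nonneg (Real.rpow_nonneg (norm_nonneg _) _) hq.nonneg)
            (div_nonneg (Real.rpow_nonneg (norm_nonneg _) _) hq.symm.nonneg), mul_comm]
          exact ENNReal.ofReal_le_ofReal
            (Real.young_inequality_of_nonneg (norm_nonneg _) (norm_nonneg _) hq)
      _ = _ := lintegral_add_left' (h.aemeasurable_modular hGm) _
  have hVle' : ∫ x in V, inner ℝ (Φ x) (G x)
      ≤ (∫⁻ x in V, ENNReal.ofReal (‖G x‖ ^ p x / p x)).toReal + (conjModular Ω p Φ).toReal := by
    rw [← ENNReal.toReal_add hmod hc]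
    exact (ENNReal.ofReal_le_iff_le_toReal (ENNReal.add_ne_top.2 ⟨hmod, hc⟩)).1 hVle
  have hfinal : dualVal Ω p u Φ ≤ (energy Ω p u).toReal := by
    rw [dualVal, ← hrep Φ hΦt, hsplit,
      integral_inner_polar_eq h.isOpen h.isBounded hV hVΩ hu.1 hτ hτ1 hrep hG hGi hΦt, hE,
      ENNReal.toReal_add (measure_ne_top _ _) hmod]
    linarith
  calc (dualVal Ω p u Φ : EReal) ≤ ((energy Ω p u).toReal : EReal) := EReal.coe_le_coe_iff.2 hfinal
    _ = (energy Ω p u : EReal) := EReal.coe_ennreal_toReal htop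

end UpperBound

/-! ### Extension of the dual bound to bounded measurable fields -/

section LowerBound

variable {n N : ℕ} {Ω V : Set (EuclideanSpace ℝ (Fin n))} {p : EuclideanSpace ℝ (Fin n) → ℝ}
  {pmax : ℝ} {u : EuclideanSpace ℝ (Fin n) → EuclideanSpace ℝ (Fin N)}

/-- Fields with norm at most 1 are admissible and cost at most the volume of Ω. The field -Φ is
tested because of the sign in the dual value. -/
lemma IsExponent.memBV_of_dualVal_le (h : IsExponent Ω p pmax) (hu : IntegrableOn u Ω) {M : ℝ}
    (hM : ∀ Φ ∈ dualSet N Ω p, dualVal Ω p u Φ ≤ M) : MemBV Ω u := by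
  refine ⟨hu, lt_of_le_of_lt (iSup_le fun Φ => iSup_le fun hΦ => iSup_le fun h1 => ?_)
    (ENNReal.ofReal_lt_top (r := M + (volume Ω).toReal))⟩
  have h2 := hM _ (h.mem_dualSet hΦ.neg fun x => by rw [norm_neg]; exact h1 x)
  have h3 : (conjModular Ω p fun x => -Φ x).toReal ≤ (volume Ω).toReal :=
    ENNReal.toReal_mono h.isBounded.measure_lt_top.ne
      (h.conjModular_le fun x => by rw [norm_neg]; exact h1 x)
  refine ENNReal.ofReal_le_ofReal ?_
  simp only [dualVal, hΦ.matDiv_neg, inner_neg_right, integral_neg, neg_neg] at h2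
  linarith

lemma rpow_div_le_max {a R q q₀ : ℝ} (ha : 0 ≤ a) (haR : a ≤ R) (hq : 1 ≤ q) (hq₀ : q ≤ q₀) :
    a ^ q / q ≤ max 1 R ^ q₀ :=
  calc a ^ q / q ≤ a ^ q := div_le_self (Real.rpow_nonneg ha _) hq
    _ ≤ max 1 R ^ q := Real.rpow_le_rpow ha (haR.trans (le_max_right _ _)) (by linarith)
    _ ≤ max 1 R ^ q₀ := Real.rpow_le_rpow_of_exponent_le (le_max_left _ _) hq₀

lemma conjExponent_le {r r₀ : ℝ} (h₀ : 1 < r₀) (hr : r₀ ≤ r) :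
    r.conjExponent ≤ r₀.conjExponent := by
  rw [Real.conjExponent, Real.conjExponent, div_le_div_iff₀ (by linarith) (by linarith)]
  nlinarith

/-- The ideal field is τ on Y, which yields TV(u)(Y), together with F on L. The two pieces are
approximated by test fields supported in disjoint open sets, so the sum is admissible and neither
bound interferes with the other. -/
lemma IsExponent.critSet_add_integral_le (h : IsExponent Ω p pmax) {M : ℝ}
    (hM : ∀ Φ ∈ dualSet N Ω p, dualVal Ω p u Φ ≤ M)
    {lam : Measure (EuclideanSpace ℝ (Fin n))} [IsFiniteMeasure lam]
    {τ : EuclideanSpace ℝ (Fin n) → Mat N n}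
    (hτ : StronglyMeasurable τ) (hτ1 : ∀ x, ‖τ x‖ ≤ 1) (hτe : ∀ᵐ x ∂lam, ‖τ x‖ = 1)
    (hrep : ∀ Φ : EuclideanSpace ℝ (Fin n) → Mat N n, IsTest Ω Φ →
      ∫ x, inner ℝ (Φ x) (τ x) ∂lam = -∫ x in Ω, inner ℝ (u x) (matDiv Φ x))
    {L : Set (EuclideanSpace ℝ (Fin n))} (hL : IsCompact L) (hLV : L ⊆ Ω \ critSet Ω p)
    {F : EuclideanSpace ℝ (Fin n) → Mat N n}
    (hF : AEStronglyMeasurable F (lam + volume.restrict Ω)) {R : ℝ} (hR : ∀ x, ‖F x‖ ≤ R)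
    (hF0 : ∀ x ∉ L, F x = 0) :
    (lam (critSet Ω p)).toReal + ∫ x, inner ℝ (F x) (τ x) ∂lam
      ≤ M + (conjModular Ω p F).toReal := by
  have hfinΩ := h.isFiniteMeasure
  have hR0 : 0 ≤ R := (norm_nonneg _).trans (hR 0)
  have hY := h.measurableSet_critSet
  -- The relatively compact neighbourhood V' of L carries the approximations of F; there the
  -- conjugate exponent is bounded. The complement U of its closure in Ω contains Y.
  obtain ⟨V', hV'o, hLV', hV'V, hV'c⟩ :=
    exists_open_between_and_isCompact_closure hL h.isOpen_diff hLV
  obtain ⟨p₀, hp₀, hp₀V⟩ := h.exists_lower_bound hV'c hV'V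
  have hV'Ω : V' ⊆ Ω := subset_closure.trans (hV'V.trans sdiff_subset)
  set U := Ω \ closure V' with hU
  have hUo : IsOpen U := h.isOpen.sdiff isClosed_closure
  have hYU : critSet Ω p ⊆ U := fun x hx => ⟨hx.1, fun hc => (hV'V hc).2 hx⟩
  have hFlam : AEStronglyMeasurable F lam :=
    hF.mono_ac (Measure.absolutelyContinuous_of_le (Measure.le_add_right le_rfl))
  set F₁ : EuclideanSpace ℝ (Fin n) → Mat N n := (critSet Ω p).indicator τ with hF₁
  have hF₁R : ∀ x, ‖F₁ x‖ ≤ 1 := fun x => (norm_indicator_le_norm_self τ x).trans (hτ1 x)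
  have hF₁0 : ∀ x ∉ critSet Ω p, F₁ x = 0 := fun x hx => indicator_of_notMem hx _
  have hF₁m : AEStronglyMeasurable F₁ (lam + volume.restrict Ω) :=
    (hτ.indicator hY).aestronglyMeasurable
  obtain ⟨φ, hφ, hφ1, hφlim⟩ := exists_test_approx (lam + volume.restrict Ω) hUo hF₁m hF₁R
  obtain ⟨ψ, hψ, hψR, hψlim⟩ := exists_test_approx (lam + volume.restrict Ω) hV'o hF hR
  set Φ : ℕ → EuclideanSpace ℝ (Fin n) → Mat N n := fun k x => φ k x + ψ k x with hΦ
  have hΦt : ∀ k, IsTest Ω (Φ k) := fun k =>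
    ((hφ k).mono sdiff_subset).add ((hψ k).mono hV'Ω)
  have hΦm : ∀ k, Continuous (Φ k) := fun k => (hΦt k).contDiff.continuous
  have hlim : ∀ᵐ x ∂(lam + volume.restrict Ω), Tendsto (fun k => Φ k x) atTop (𝓝 (F₁ x + F x)) := by
    filter_upwards [hφlim, hψlim] with x hx₁ hx₂
    refine Tendsto.add ?_ ?_
    · by_cases hxU : x ∈ U
      · exact hx₁ hxU
      · simp only [(hφ _).eq_zero hxU, hF₁0 x fun hc => hxU (hYU hc)]
        exact tendsto_const_nhds
    · by_cases hxV : x ∈ V'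
      · exact hx₂ hxV
      · simp only [(hψ _).eq_zero hxV, hF0 x fun hc => hxV (hLV' hc)]
        exact tendsto_const_nhds
  have hlim₁ := ae_mono (Measure.le_add_right le_rfl : lam ≤ lam + volume.restrict Ω) hlim
  have hlim₂ := ae_mono (Measure.le_add_left le_rfl : volume.restrict Ω ≤ lam + volume.restrict Ω)
    hlim
  have hV'0 : ∀ k, ∀ x ∈ V', Φ k x = ψ k x := fun k x hx => by
    simp [hΦ, (hφ k).eq_zero fun hc : x ∈ U => hc.2 (subset_closure hx)]
  have hU0 : ∀ k, ∀ x ∉ V', Φ k x = φ k x := fun k x hx => by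
    simp [hΦ, (hψ k).eq_zero hx]
  have hΦR : ∀ k x, ‖Φ k x‖ ≤ max 1 R := fun k x => by
    by_cases hx : x ∈ V'
    · rw [hV'0 k x hx]; exact (hψR k x).trans (le_max_right _ _)
    · rw [hU0 k x hx]; exact (hφ1 k x).trans (le_max_left _ _)
  have hVsub : volume.restrict (Ω \ critSet Ω p) ≤ volume.restrict Ω :=
    Measure.restrict_mono_set _ sdiff_subset
  have hVfin : IsFiniteMeasure (volume.restrict (Ω \ critSet Ω p)) :=
    isFiniteMeasure_of_le _ hVsub
  -- In V' the exponent is bounded by the conjugate of p₀; outside V' only the part with norm at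
  -- most 1 is present, so large exponents near Y do no harm. This dominates the conjugate modulars.
  have hbound : ∀ k, ∀ x ∈ Ω \ critSet Ω p,
      ‖Φ k x‖ ^ (p x).conjExponent / (p x).conjExponent ≤ max 1 R ^ p₀.conjExponent := by
    intro k x hx
    have hq := (Real.HolderConjugate.conjExponent (h.one_lt hx)).symm.lt.le
    by_cases hxV : x ∈ V'
    · rw [hV'0 k x hxV]
      exact rpow_div_le_max (norm_nonneg _) (hψR k x) hq
        (conjExponent_le hp₀ (hp₀V x (subset_closure hxV)))
    · rw [hU0 k x hxV]
      refine (rpow_div_le_one (norm_nonneg _) (hφ1 k x) hq).trans ?_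
      exact Real.one_le_rpow (le_max_left _ _) (Real.HolderConjugate.conjExponent hp₀).symm.nonneg
  have hcost : Tendsto (fun k => conjModular Ω p (Φ k)) atTop (𝓝 (conjModular Ω p F)) := by
    refine tendsto_lintegral_of_dominated_convergence'
      (fun _ => ENNReal.ofReal (max 1 R ^ p₀.conjExponent))
      (fun k => h.aemeasurable_conjModular (hΦm k).aestronglyMeasurable) (fun k => ?_) ?_ ?_
    · filter_upwards [ae_restrict_mem h.isOpen_diff.measurableSet] with x hx
      exact ENNReal.ofReal_le_ofReal (hbound k x hx)
    · rw [lintegral_const]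
      exact ENNReal.mul_ne_top ENNReal.ofReal_ne_top (measure_ne_top _ _)
    · filter_upwards [ae_restrict_mem h.isOpen_diff.measurableSet, ae_mono hVsub hlim₂] with x hx hx'
      rw [hF₁0 x hx.2, zero_add] at hx'
      have hq := (Real.HolderConjugate.conjExponent (h.one_lt hx)).symm
      exact ENNReal.tendsto_ofReal
        ((hx'.norm.rpow_const (Or.inr hq.nonneg)).div_const _)
  have hcostlt : ∀ k, conjModular Ω p (Φ k) ≤
      ENNReal.ofReal (max 1 R ^ p₀.conjExponent) * volume (Ω \ critSet Ω p) := by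
    intro k
    rw [← setLIntegral_const]
    exact setLIntegral_mono' h.isOpen_diff.measurableSet fun x hx =>
      ENNReal.ofReal_le_ofReal (hbound k x hx)
  have htop : ENNReal.ofReal (max 1 R ^ p₀.conjExponent) * volume (Ω \ critSet Ω p) ≠ ∞ :=
    ENNReal.mul_ne_top ENNReal.ofReal_ne_top (h.isBounded.subset sdiff_subset).measure_lt_top.ne
  have hFtop : conjModular Ω p F ≠ ∞ :=
    ((le_of_tendsto' hcost hcostlt).trans_lt htop.lt_top).ne
  have hmem : ∀ k, Φ k ∈ dualSet N Ω p := by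
    refine fun k => ⟨hΦt k, fun x hx => ?_, ((hcostlt k).trans_lt htop.lt_top).ne⟩
    rw [hU0 k x fun hc => (hV'V (subset_closure hc)).2 hx]
    exact hφ1 k x
  have hdual : ∀ k, ∫ x, inner ℝ (Φ k x) (τ x) ∂lam ≤ M + (conjModular Ω p (Φ k)).toReal := by
    intro k
    have := hM _ (hmem k)
    rw [dualVal, ← hrep _ (hΦt k)] at this
    linarith
  have hτm : AEStronglyMeasurable τ lam := hτ.aestronglyMeasurable
  have hintlim : Tendsto (fun k => ∫ x, inner ℝ (Φ k x) (τ x) ∂lam) atTop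
      (𝓝 (∫ x, inner ℝ (F₁ x + F x) (τ x) ∂lam)) := by
    refine tendsto_integral_of_dominated_convergence (fun _ => max 1 R)
      (fun k => (hΦm k).aestronglyMeasurable.inner hτm)
      (integrable_const _) (fun k => Eventually.of_forall fun x => ?_) ?_
    · refine (norm_inner_le_norm _ _).trans ?_
      calc ‖Φ k x‖ * ‖τ x‖ ≤ max 1 R * 1 :=
            mul_le_mul (hΦR k x) (hτ1 x) (norm_nonneg _) (zero_le_one.trans (le_max_left _ _))
        _ = max 1 R := mul_one _
    · filter_upwards [hlim₁] with x hx using hx.inner tendsto_const_nhds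
  have hbd : ∀ {A : EuclideanSpace ℝ (Fin n) → Mat N n} {c : ℝ}, AEStronglyMeasurable A lam →
      (∀ x, ‖A x‖ ≤ c) → Integrable (fun x => (inner ℝ (A x) (τ x) : ℝ)) lam := fun {A c} hA hc =>
    Integrable.of_bound (hA.inner hτm) c (Eventually.of_forall fun x =>
      (norm_inner_le_norm _ _).trans ((mul_le_of_le_one_right (norm_nonneg _) (hτ1 x)).trans (hc x)))
  have hsplit : ∫ x, inner ℝ (F₁ x + F x) (τ x) ∂lam
      = (lam (critSet Ω p)).toReal + ∫ x, inner ℝ (F x) (τ x) ∂lam := by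
    simp only [inner_add_left]
    rw [integral_add (hbd (hτ.indicator hY).aestronglyMeasurable hF₁R) (hbd hFlam hR)]
    congr 1
    have h1 : (fun x => (inner ℝ (F₁ x) (τ x) : ℝ))
        =ᵐ[lam] (critSet Ω p).indicator fun _ => (1 : ℝ) := by
      filter_upwards [hτe] with x hx
      by_cases hxY : x ∈ critSet Ω p
      · simp [hF₁, hxY, hx]
      · simp [hF₁, hxY]
    rw [integral_congr_ae h1, integral_indicator_const _ hY]
    simp [Measure.real]
  rw [← hsplit]
  refine le_of_tendsto_of_tendsto' hintlim (tendsto_const_nhds.add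
    ((ENNReal.tendsto_toReal hFtop).comp hcost)) hdual

end LowerBound

/-! ### Absolute continuity of the gradient off the critical set -/

section Density

variable {n N : ℕ} {Ω V : Set (EuclideanSpace ℝ (Fin n))} {p : EuclideanSpace ℝ (Fin n) → ℝ}
  {pmax : ℝ} {u : EuclideanSpace ℝ (Fin n) → EuclideanSpace ℝ (Fin N)}

/-- The data of a polar decomposition for which the dual values are bounded by `M`. -/
structure DualBounded (Ω : Set (EuclideanSpace ℝ (Fin n))) (p : EuclideanSpace ℝ (Fin n) → ℝ)
    (lam : Measure (EuclideanSpace ℝ (Fin n))) (τ : EuclideanSpace ℝ (Fin n) → Mat N n)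
    (M : ℝ) : Prop where
  measurable : StronglyMeasurable τ
  norm_le : ∀ x, ‖τ x‖ ≤ 1
  norm_eq : ∀ᵐ x ∂lam, ‖τ x‖ = 1
  le : ∀ {L : Set (EuclideanSpace ℝ (Fin n))}, IsCompact L → L ⊆ Ω \ critSet Ω p →
    ∀ {F : EuclideanSpace ℝ (Fin n) → Mat N n}, StronglyMeasurable F →
    ∀ {R : ℝ}, (∀ x, ‖F x‖ ≤ R) → (∀ x ∉ L, F x = 0) →
    (lam (critSet Ω p)).toReal + ∫ x, inner ℝ (F x) (τ x) ∂lam ≤ M + (conjModular Ω p F).toReal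

variable {lam : Measure (EuclideanSpace ℝ (Fin n))} [IsFiniteMeasure lam]
  {τ : EuclideanSpace ℝ (Fin n) → Mat N n} {M : ℝ}

/-- On a compact part of a Lebesgue null set the field kτ has conjugate modular zero but gains k
times the mass of that part. As k is arbitrary, the mass vanishes. -/
lemma IsExponent.absolutelyContinuous (h : IsExponent Ω p pmax) (hd : DualBounded Ω p lam τ M) :
    lam.restrict (Ω \ critSet Ω p) ≪ volume := by
  refine Measure.AbsolutelyContinuous.mk fun s hs h0 => ?_
  rw [Measure.restrict_apply hs]
  obtain ⟨L, -, hLc, hLV, hLex⟩ := exists_compact_exhaustion h.isOpen_diff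
  refine measure_mono_null (t := ⋃ m, s ∩ L m) (fun x hx => ?_) (measure_iUnion_null fun m => ?_)
  · obtain ⟨m, hm⟩ := hLex x hx.2
    exact mem_iUnion.2 ⟨m, hx.1, hm⟩
  have hA : MeasurableSet (s ∩ L m) := hs.inter (hLc m).measurableSet
  obtain ⟨K, hK⟩ : ∃ K : ℝ, ∀ k : ℕ, (k : ℝ) * (lam (s ∩ L m)).toReal ≤ K := by
    refine ⟨M, fun k => ?_⟩
    have h1 := hd.le (hLc m) (hLV m) (F := (s ∩ L m).indicator fun x => (k : ℝ) • τ x)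
      ((hd.measurable.const_smul (k : ℝ)).indicator hA) (R := k) (fun x => ?_)
      (fun x hx => indicator_of_notMem (fun hc => hx hc.2) _)
    · have h2 : conjModular Ω p ((s ∩ L m).indicator fun x => (k : ℝ) • τ x) = 0 := by
        rw [conjModular]
        refine (lintegral_congr_ae (g := fun _ => 0) ?_).trans (by simp)
        have h3 : ∀ᵐ x ∂volume.restrict (Ω \ critSet Ω p), x ∉ s :=
          ae_restrict_of_ae (measure_eq_zero_iff_ae_notMem.1 h0)
        filter_upwards [h3, ae_restrict_mem h.isOpen_diff.measurableSet] with x hx hxV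
        have hq := (Real.HolderConjugate.conjExponent (h.one_lt hxV)).symm
        rw [indicator_of_notMem (fun hc => hx hc.1), norm_zero, Real.zero_rpow hq.ne_zero]
        simp
      have h4 : ∫ x, inner ℝ ((s ∩ L m).indicator (fun x => (k : ℝ) • τ x) x) (τ x) ∂lam
          = (k : ℝ) * (lam (s ∩ L m)).toReal := by
        rw [integral_congr_ae (g := (s ∩ L m).indicator fun _ => (k : ℝ)),
          integral_indicator_const _ hA, smul_eq_mul, mul_comm]
        · rfl
        · filter_upwards [hd.norm_eq] with x hx1
          by_cases hxA : x ∈ s ∩ L m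
          · rw [indicator_of_mem hxA, indicator_of_mem hxA, real_inner_smul_left,
              real_inner_self_eq_norm_sq, hx1]
            simp
          · rw [indicator_of_notMem hxA, indicator_of_notMem hxA, inner_zero_left]
      rw [h2, h4] at h1
      have := ENNReal.toReal_nonneg (a := lam (critSet Ω p))
      simp only [ENNReal.toReal_zero, add_zero] at h1
      linarith
    · refine (norm_indicator_le_norm_self _ _).trans ?_
      rw [norm_smul, Real.norm_natCast]
      exact mul_le_of_le_one_right (Nat.cast_nonneg k) (hd.norm_le x)
  by_contra hne
  have hpos : 0 < (lam (s ∩ L m)).toReal := ENNReal.toReal_pos hne (measure_ne_top _ _)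
  obtain ⟨k, hk⟩ := exists_nat_gt (K / (lam (s ∩ L m)).toReal)
  rw [div_lt_iff₀ hpos] at hk
  exact absurd (hK k) (not_le.2 hk)

/-- The density of the gradient measure on the set where the exponent exceeds `1`. -/
def gradDensity (V : Set (EuclideanSpace ℝ (Fin n))) (lam : Measure (EuclideanSpace ℝ (Fin n)))
    (τ : EuclideanSpace ℝ (Fin n) → Mat N n) (x : EuclideanSpace ℝ (Fin n)) : Mat N n :=
  ((lam.restrict V).rnDeriv volume x).toReal • τ x

omit [IsFiniteMeasure lam] in
lemma stronglyMeasurable_gradDensity (hτ : StronglyMeasurable τ) :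
    StronglyMeasurable (gradDensity V lam τ) :=
  (Measure.measurable_rnDeriv _ _).ennreal_toReal.stronglyMeasurable.smul hτ

/-- The identity ‖τ‖ = 1 holds almost everywhere for the variation measure only; for Lebesgue
measure it survives where the density is nonzero. -/
lemma norm_gradDensity (hac : lam.restrict V ≪ volume) (hτe : ∀ᵐ x ∂lam, ‖τ x‖ = 1) :
    ∀ᵐ x, ((lam.restrict V).rnDeriv volume x).toReal = ‖gradDensity V lam τ x‖ ∧
      (gradDensity V lam τ x ≠ 0 → ‖τ x‖ = 1) := by
  have h1 : ∀ᵐ x ∂lam.restrict V, ‖τ x‖ = 1 := ae_restrict_of_ae hτe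
  rw [← Measure.withDensity_rnDeriv_eq _ _ hac,
    ae_withDensity_iff (Measure.measurable_rnDeriv _ _)] at h1
  filter_upwards [h1, (lam.restrict V).rnDeriv_lt_top volume] with x hx hx'
  have h2 : (lam.restrict V).rnDeriv volume x = 0 ∨ ‖τ x‖ = 1 := or_iff_not_imp_left.2 hx
  rcases h2 with h2 | h2
  · simp [gradDensity, h2]
  · simp [gradDensity, norm_smul, h2]

lemma integrable_gradDensity (hτ : StronglyMeasurable τ) (hτ1 : ∀ x, ‖τ x‖ ≤ 1) :
    Integrable (gradDensity V lam τ) :=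
  (Measure.integrable_toReal_rnDeriv (μ := lam.restrict V)).smul_bdd 1 hτ.aestronglyMeasurable
    (Eventually.of_forall hτ1)

lemma isWeakGrad_gradDensity (hΩ : IsOpen Ω) (hVΩ : V ⊆ Ω)
    (hτ : StronglyMeasurable τ) (hτ1 : ∀ x, ‖τ x‖ ≤ 1)
    (hrep : ∀ Φ : EuclideanSpace ℝ (Fin n) → Mat N n, IsTest Ω Φ →
      ∫ x, inner ℝ (Φ x) (τ x) ∂lam = -∫ x in Ω, inner ℝ (u x) (matDiv Φ x))
    (hac : lam.restrict V ≪ volume) : IsWeakGrad V u (gradDensity V lam τ) := by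
  refine ⟨(integrable_gradDensity hτ hτ1).integrableOn.locallyIntegrableOn, fun φ hφ i j => ?_⟩
  have h1 := hrep _ ((hφ.mono hVΩ).comp_clm
    ((ContinuousLinearMap.id ℝ ℝ).smulRight (EuclideanSpace.single (i, j) (1 : ℝ) : Mat N n)))
  have h2 : ∀ x, matDiv (fun y => ((ContinuousLinearMap.id ℝ ℝ).smulRight
      (EuclideanSpace.single (i, j) (1 : ℝ) : Mat N n)) (φ y)) x
      = EuclideanSpace.single i (partialDeriv j φ x) := hφ.matDiv_single i j
  have h3 : ∀ x, inner ℝ (((ContinuousLinearMap.id ℝ ℝ).smulRight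
      (EuclideanSpace.single (i, j) (1 : ℝ) : Mat N n)) (φ x)) (τ x) = φ x * τ x (i, j) := by
    intro x
    rw [ContinuousLinearMap.smulRight_apply, real_inner_smul_left,
      EuclideanSpace.inner_single_left]
    simp
  have h4 : ∀ x, inner ℝ (u x) (EuclideanSpace.single i (partialDeriv j φ x))
      = u x i * partialDeriv j φ x := by
    intro x
    rw [EuclideanSpace.inner_single_right]
    simp [mul_comm]
  simp only [h2, h3, h4] at h1
  rw [hφ.setIntegral_mul_partialDeriv hΩ hVΩ, ← h1,
    setIntegral_eq_integral_of_forall_compl_eq_zero fun x hx => by rw [hφ.eq_zero hx, zero_mul],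
    ← setIntegral_eq_integral_of_forall_compl_eq_zero (s := V) (μ := lam)
      fun x hx => by rw [hφ.eq_zero hx, zero_mul],
    ← integral_rnDeriv_smul hac]
  refine integral_congr_ae (Eventually.of_forall fun x => ?_)
  simp only [gradDensity, PiLp.smul_apply, smul_eq_mul]
  ring

end Density

/-! ### Recovering the energy from the dual values -/

section EnergyBound

variable {n N : ℕ} {Ω V : Set (EuclideanSpace ℝ (Fin n))} {p : EuclideanSpace ℝ (Fin n) → ℝ}
  {pmax : ℝ} {u : EuclideanSpace ℝ (Fin n) → EuclideanSpace ℝ (Fin N)}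
  {lam : Measure (EuclideanSpace ℝ (Fin n))} [IsFiniteMeasure lam]
  {τ : EuclideanSpace ℝ (Fin n) → Mat N n} {M : ℝ}

/-- The bound for the energy density on sets where everything is bounded. -/
lemma IsExponent.modular_indicator_le (h : IsExponent Ω p pmax) (hd : DualBounded Ω p lam τ M)
    {p' : EuclideanSpace ℝ (Fin n) → ℝ} (hp' : Measurable p')
    (hpp' : ∀ᵐ x ∂volume.restrict (Ω \ critSet Ω p), p x = p' x)
    {L A : Set (EuclideanSpace ℝ (Fin n))} (hL : IsCompact L) (hLV : L ⊆ Ω \ critSet Ω p)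
    (hA : MeasurableSet A) (hAL : A ⊆ L) {b : ℝ}
    (hAb : ∀ x ∈ A, ‖gradDensity (Ω \ critSet Ω p) lam τ x‖ ≤ b)
    (hAp : ∀ x ∈ A, 1 ≤ p' x ∧ p' x ≤ pmax) :
    (lam (critSet Ω p)).toReal ≤ M ∧
    ∫⁻ x in Ω \ critSet Ω p, A.indicator
      (fun x => ENNReal.ofReal (‖gradDensity (Ω \ critSet Ω p) lam τ x‖ ^ p x / p x)) x
      ≤ ENNReal.ofReal (M - (lam (critSet Ω p)).toReal) := by
  have hac := h.absolutelyContinuous hd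
  have hVm := h.isOpen_diff.measurableSet
  set V := Ω \ critSet Ω p with hVdef
  set G := gradDensity V lam τ with hGdef
  have hGm : StronglyMeasurable G := stronglyMeasurable_gradDensity hd.measurable
  have hVfin : IsFiniteMeasure (volume.restrict V) :=
    ⟨by rw [Measure.restrict_apply_univ]
        exact (h.isBounded.subset sdiff_subset).measure_lt_top⟩
  have hG : ∀ᵐ x, ((lam.restrict V).rnDeriv volume x).toReal = ‖G x‖ ∧ (G x ≠ 0 → ‖τ x‖ = 1) :=
    norm_gradDensity hac hd.norm_eq
  have hb1 : 1 ≤ max 1 b := le_max_left _ _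
  -- The equality case of Young's inequality. The cut-off to A makes the field bounded, and the
  -- Borel representative p' makes it strongly measurable.
  set F : EuclideanSpace ℝ (Fin n) → Mat N n :=
    A.indicator fun x => ‖G x‖ ^ (p' x - 1) • τ x with hF
  have hFm : StronglyMeasurable F :=
    (((hGm.norm.measurable.pow (hp'.sub_const 1)).stronglyMeasurable).smul hd.measurable).indicator hA
  have hFR : ∀ x, ‖F x‖ ≤ max 1 b ^ (pmax - 1) := by
    intro x
    by_cases hx : x ∈ A
    · rw [hF, indicator_of_mem hx, norm_smul, Real.norm_of_nonneg (Real.rpow_nonneg (norm_nonneg _) _)]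
      refine (mul_le_of_le_one_right (Real.rpow_nonneg (norm_nonneg _) _) (hd.norm_le x)).trans ?_
      have h1 := hAp x hx
      calc ‖G x‖ ^ (p' x - 1) ≤ max 1 b ^ (p' x - 1) := Real.rpow_le_rpow (norm_nonneg _)
            ((hAb x hx).trans (le_max_right _ _)) (by linarith)
        _ ≤ max 1 b ^ (pmax - 1) := Real.rpow_le_rpow_of_exponent_le hb1 (by linarith)
    · rw [hF, indicator_of_notMem hx, norm_zero]
      positivity
  have hmain := hd.le hL hLV hFm hFR fun x hx => indicator_of_notMem (fun hc => hx (hAL hc)) _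
  set g : EuclideanSpace ℝ (Fin n) → ℝ := A.indicator fun x => ‖G x‖ ^ p' x with hg
  have hgm : Measurable g := (hGm.norm.measurable.pow hp').indicator hA
  have hg0 : ∀ x, 0 ≤ g x := fun x => indicator_nonneg (fun x _ => Real.rpow_nonneg (norm_nonneg _) _) x
  have hgR : ∀ x, g x ≤ max 1 b ^ pmax := by
    intro x
    by_cases hx : x ∈ A
    · rw [hg, indicator_of_mem hx]
      have h1 := hAp x hx
      calc ‖G x‖ ^ p' x ≤ max 1 b ^ p' x := Real.rpow_le_rpow (norm_nonneg _)
            ((hAb x hx).trans (le_max_right _ _)) (by linarith)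
        _ ≤ max 1 b ^ pmax := Real.rpow_le_rpow_of_exponent_le hb1 (by linarith)
    · rw [hg, indicator_of_notMem hx]
      positivity
  have hint : ∀ r : EuclideanSpace ℝ (Fin n) → ℝ, AEMeasurable r (volume.restrict V) →
      (∀ x ∈ V, 1 ≤ r x) → Integrable (fun x => g x / r x) (volume.restrict V) := by
    intro r hr hr1
    refine Integrable.of_bound (hgm.aemeasurable.div hr).aestronglyMeasurable (max 1 b ^ pmax) ?_
    filter_upwards [ae_restrict_mem hVm] with x hx
    rw [Real.norm_of_nonneg (div_nonneg (hg0 x) (zero_le_one.trans (hr1 x hx)))]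
    exact (div_le_self (hg0 x) (hr1 x hx)).trans (hgR x)
  have hi1 := hint p h.aemeasurable_diff fun x hx => (h.one_lt hx).le
  have hi2 := hint _ h.aemeasurable_conj fun x hx =>
    (Real.HolderConjugate.conjExponent (h.one_lt hx)).symm.lt.le
  have hF1 : ∫ x, inner ℝ (F x) (τ x) ∂lam = ∫ x in V, g x := by
    rw [← setIntegral_eq_integral_of_forall_compl_eq_zero (s := V) (μ := lam) fun x hx => by
        rw [hF, indicator_of_notMem (fun hc => hx (hLV (hAL hc))), inner_zero_left],
      setIntegral_eq_integral_of_forall_compl_eq_zero (s := V) (f := g) fun x hx => by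
        rw [hg, indicator_of_notMem (fun hc => hx (hLV (hAL hc)))],
      ← integral_rnDeriv_smul hac]
    refine integral_congr_ae ?_
    filter_upwards [hG] with x hx
    rw [hx.1, smul_eq_mul]
    by_cases hxA : x ∈ A
    · rw [hF, hg, indicator_of_mem hxA, indicator_of_mem hxA, real_inner_smul_left,
        real_inner_self_eq_norm_sq]
      by_cases h0 : G x = 0
      · have := hAp x hxA
        rw [h0, norm_zero, zero_mul, Real.zero_rpow (by linarith)]
      · rw [hx.2 h0, one_pow, mul_one]
        nth_rewrite 1 [← Real.rpow_one ‖G x‖]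
        rw [← Real.rpow_add (norm_pos_iff.2 h0)]
        congr 1
        ring
    · rw [hF, hg, indicator_of_notMem hxA, indicator_of_notMem hxA, inner_zero_left, mul_zero]
  have hF2 : conjModular Ω p F = ENNReal.ofReal (∫ x in V, g x / (p x).conjExponent) := by
    rw [ofReal_integral_eq_lintegral_ofReal hi2]
    · refine lintegral_congr_ae ?_
      filter_upwards [ae_restrict_of_ae hG, hpp', ae_restrict_mem hVm] with x hx hxp hxV
      have hq := Real.HolderConjugate.conjExponent (h.one_lt hxV)
      congr 2
      by_cases hxA : x ∈ A
      · rw [hF, hg, indicator_of_mem hxA, indicator_of_mem hxA, norm_smul,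
          Real.norm_of_nonneg (Real.rpow_nonneg (norm_nonneg _) _), ← hxp]
        by_cases h0 : G x = 0
        · rw [h0, norm_zero, Real.zero_rpow hq.sub_one_ne_zero, zero_mul,
            Real.zero_rpow hq.symm.ne_zero, Real.zero_rpow hq.ne_zero]
        · rw [hx.2 h0, mul_one, ← Real.rpow_mul (norm_nonneg _), hq.sub_one_mul_conj]
      · rw [hF, hg, indicator_of_notMem hxA, indicator_of_notMem hxA, norm_zero,
          Real.zero_rpow hq.symm.ne_zero]
    · filter_upwards [ae_restrict_mem hVm] with x hx
      exact div_nonneg (hg0 x) (Real.HolderConjugate.conjExponent (h.one_lt hx)).symm.nonneg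
  have hnn : 0 ≤ ∫ x in V, g x / (p x).conjExponent := setIntegral_nonneg hVm fun x hx =>
    div_nonneg (hg0 x) (Real.HolderConjugate.conjExponent (h.one_lt hx)).symm.nonneg
  have hnn' : 0 ≤ ∫ x in V, g x / p x := setIntegral_nonneg hVm fun x hx =>
    div_nonneg (hg0 x) (Real.HolderConjugate.conjExponent (h.one_lt hx)).nonneg
  -- Since 1/p + 1/q = 1, the gain ∫ |G|^p minus the cost ∫ |G|^p/q leaves the modular ∫ |G|^p/p.
  -- The integrals are finite because A bounds G.
  have hsum : ∫ x in V, g x = (∫ x in V, g x / p x) + ∫ x in V, g x / (p x).conjExponent := by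
    rw [← integral_add hi1 hi2]
    refine setIntegral_congr_fun hVm fun x hx => ?_
    have hq := Real.HolderConjugate.conjExponent (h.one_lt hx)
    simp only [div_eq_mul_inv]
    rw [← mul_add, hq.inv_add_inv_eq_one, mul_one]
  rw [hF1, hF2, ENNReal.toReal_ofReal hnn, hsum] at hmain
  refine ⟨by linarith, ?_⟩
  calc ∫⁻ x in V, A.indicator (fun x => ENNReal.ofReal (‖G x‖ ^ p x / p x)) x
      = ∫⁻ x in V, ENNReal.ofReal (g x / p x) := by
        refine lintegral_congr_ae ?_
        filter_upwards [hpp'] with x hxp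
        by_cases hxA : x ∈ A
        · rw [hg, indicator_of_mem hxA, indicator_of_mem hxA, hxp]
        · rw [hg, indicator_of_notMem hxA, indicator_of_notMem hxA]
          simp
    _ = ENNReal.ofReal (∫ x in V, g x / p x) := by
        rw [ofReal_integral_eq_lintegral_ofReal hi1]
        filter_upwards [ae_restrict_mem hVm] with x hx
        exact div_nonneg (hg0 x) (Real.HolderConjugate.conjExponent (h.one_lt hx)).nonneg
    _ ≤ _ := ENNReal.ofReal_le_ofReal (by linarith)

/-- Almost every point of Ω∖Y lies in all but finitely many of the sets A m, on which the density is
bounded, so Fatou's lemma removes the cut-off. -/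
lemma IsExponent.modular_gradDensity_le (h : IsExponent Ω p pmax)
    (hd : DualBounded Ω p lam τ M) :
    (lam (critSet Ω p)).toReal ≤ M ∧
    ∫⁻ x in Ω \ critSet Ω p,
      ENNReal.ofReal (‖gradDensity (Ω \ critSet Ω p) lam τ x‖ ^ p x / p x)
      ≤ ENNReal.ofReal (M - (lam (critSet Ω p)).toReal) := by
  obtain ⟨p', hp', hpp'⟩ := h.aemeasurable_diff
  obtain ⟨L, hLmono, hLc, hLV, hLex⟩ := exists_compact_exhaustion h.isOpen_diff
  have hVm := h.isOpen_diff.measurableSet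
  set V := Ω \ critSet Ω p with hVdef
  set G := gradDensity V lam τ with hGdef
  have hGm : StronglyMeasurable G := stronglyMeasurable_gradDensity hd.measurable
  set A : ℕ → Set (EuclideanSpace ℝ (Fin n)) := fun m =>
    L m ∩ ({x | ‖G x‖ ≤ m} ∩ {x | 1 ≤ p' x ∧ p' x ≤ pmax}) with hA
  have hAm : ∀ m, MeasurableSet (A m) := fun m =>
    (hLc m).measurableSet.inter ((measurableSet_le hGm.norm.measurable measurable_const).inter
      ((measurableSet_le measurable_const hp').inter (measurableSet_le hp' measurable_const)))
  have key := fun m => h.modular_indicator_le hd hp' hpp' (hLc m) (hLV m) (hAm m)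
    (fun x hx => hx.1) (b := m) (fun x hx => hx.2.1) fun x hx => hx.2.2
  refine ⟨(key 0).1, ?_⟩
  set f : EuclideanSpace ℝ (Fin n) → ℝ≥0∞ := fun x => ENNReal.ofReal (‖G x‖ ^ p x / p x) with hf
  have hfm : AEMeasurable f (volume.restrict V) :=
    h.aemeasurable_modular hGm.aestronglyMeasurable
  calc ∫⁻ x in V, f x = ∫⁻ x in V, liminf (fun m => (A m).indicator f x) atTop := by
        refine lintegral_congr_ae ?_
        filter_upwards [hpp', ae_restrict_mem hVm] with x hxp hxV
        symm
        refine Tendsto.liminf_eq (tendsto_const_nhds.congr' ?_)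
        obtain ⟨m₀, hm₀⟩ := hLex x hxV
        filter_upwards [eventually_ge_atTop m₀, eventually_ge_atTop ⌈‖G x‖⌉₊] with m h1 h2
        rw [indicator_of_mem]
        have := h.bounds x hxV.1
        exact ⟨hLmono h1 hm₀, Nat.ceil_le.1 h2, by rw [← hxp]; exact this.1,
          by rw [← hxp]; exact this.2⟩
    _ ≤ liminf (fun m => ∫⁻ x in V, (A m).indicator f x) atTop :=
        lintegral_liminf_le' fun m => hfm.indicator (hAm m)
    _ ≤ liminf (fun _ : ℕ => ENNReal.ofReal (M - (lam (critSet Ω p)).toReal)) atTop :=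
        liminf_le_liminf (Eventually.of_forall fun m => (key m).2)
    _ = _ := liminf_const _

/-- A bound for all dual values bounds the energy. -/
lemma IsExponent.energy_le (h : IsExponent Ω p pmax) (hu : IntegrableOn u Ω)
    (hM : ∀ Φ ∈ dualSet N Ω p, dualVal Ω p u Φ ≤ M) :
    MemBV Ω u ∧ HasGradLpVar (Ω \ critSet Ω p) p u ∧ energy Ω p u ≤ ENNReal.ofReal M := by
  have hBV := h.memBV_of_dualVal_le hu hM
  obtain ⟨hfin, -, τ, hτ, hτ1, hτe, hrep⟩ := hBV.exists_polar h.isOpen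
  have hd : DualBounded Ω p (totalVarMeasure Ω u) τ M :=
    { measurable := hτ
      norm_le := hτ1
      norm_eq := hτe
      le := fun hL hLV _ hF _ hR hF0 =>
        h.critSet_add_integral_le hM hτ hτ1 hτe hrep hL hLV hF.aestronglyMeasurable hR hF0 }
  obtain ⟨hY, hmod⟩ := h.modular_gradDensity_le hd
  have hG : IsWeakGrad (Ω \ critSet Ω p) u
      (gradDensity (Ω \ critSet Ω p) (totalVarMeasure Ω u) τ) :=
    isWeakGrad_gradDensity h.isOpen sdiff_subset hτ hτ1 hrep (h.absolutelyContinuous hd)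
  have hGm : StronglyMeasurable (gradDensity (Ω \ critSet Ω p) (totalVarMeasure Ω u) τ) :=
    stronglyMeasurable_gradDensity hτ
  set G := gradDensity (Ω \ critSet Ω p) (totalVarMeasure Ω u) τ with hGdef
  refine ⟨hBV, ⟨G, hG, hGm.aestronglyMeasurable, 1, one_pos, ?_⟩, ?_⟩
  · calc ∫⁻ x in Ω \ critSet Ω p, ENNReal.ofReal ((‖G x‖ / 1) ^ p x)
        ≤ ∫⁻ x in Ω \ critSet Ω p, ENNReal.ofReal pmax * ENNReal.ofReal (‖G x‖ ^ p x / p x) := by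
          refine setLIntegral_mono' h.isOpen_diff.measurableSet fun x hx => ?_
          have h1 := h.bounds x hx.1
          rw [← ENNReal.ofReal_mul (by linarith), div_one]
          refine ENNReal.ofReal_le_ofReal ?_
          rw [mul_div_assoc', le_div_iff₀ (by linarith), mul_comm]
          exact mul_le_mul_of_nonneg_right h1.2 (Real.rpow_nonneg (norm_nonneg _) _)
      _ = ENNReal.ofReal pmax * ∫⁻ x in Ω \ critSet Ω p, ENNReal.ofReal (‖G x‖ ^ p x / p x) :=
          lintegral_const_mul'' _ (h.aemeasurable_modular hGm.aestronglyMeasurable)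
      _ < ∞ := ENNReal.mul_lt_top ENNReal.ofReal_lt_top (hmod.trans_lt ENNReal.ofReal_lt_top)
  · have h1 : ∫⁻ x in Ω \ critSet Ω p,
        ENNReal.ofReal (‖weakGrad (Ω \ critSet Ω p) u x‖ ^ p x / p x)
        = ∫⁻ x in Ω \ critSet Ω p, ENNReal.ofReal (‖G x‖ ^ p x / p x) := by
      refine lintegral_congr_ae ?_
      filter_upwards [(weakGrad_spec hG).ae_eq h.isOpen_diff hG] with x hx
      rw [hx]
    rw [energy, h1]
    calc _ ≤ ENNReal.ofReal (totalVarMeasure Ω u (critSet Ω p)).toReal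
          + ENNReal.ofReal (M - (totalVarMeasure Ω u (critSet Ω p)).toReal) := by
          refine add_le_add ?_ hmod
          rw [ENNReal.ofReal_toReal (measure_ne_top _ _)]
      _ = ENNReal.ofReal M := by
          rw [← ENNReal.ofReal_add ENNReal.toReal_nonneg (by linarith)]
          congr 1
          ring

end EnergyBound

/-! ### The dual formula, convexity and lower semicontinuity -/

section Dual

variable {n N : ℕ} {Ω V : Set (EuclideanSpace ℝ (Fin n))} {p : EuclideanSpace ℝ (Fin n) → ℝ}
  {pmax : ℝ}

lemma IsExponent.integrableOn (h : IsExponent Ω p pmax) (u : L2 N Ω) : IntegrableOn u Ω := by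
  have := h.isFiniteMeasure
  exact (Lp.memLp u).integrable one_le_two

lemma IsExponent.zero_mem_dualSet (h : IsExponent Ω p pmax) : (fun _ => 0) ∈ dualSet N Ω p :=
  h.mem_dualSet IsTest.zero fun x => by simp

/-- The dual values are affine functions on `L²`. -/
lemma IsExponent.exists_dualVal_eq (h : IsExponent Ω p pmax)
    {Φ : EuclideanSpace ℝ (Fin n) → Mat N n} (hΦ : Φ ∈ dualSet N Ω p) :
    ∃ (w : L2 N Ω) (c : ℝ), 0 ≤ c ∧ ∀ u : L2 N Ω, dualVal Ω p u Φ = inner ℝ u w - c := by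
  have hfin := h.isFiniteMeasure
  obtain ⟨C, hC⟩ := hΦ.1.exists_bound_matDiv
  have hmem : MemLp (matDiv Φ) 2 (volume.restrict Ω) :=
    MemLp.of_bound hΦ.1.continuous_matDiv.aestronglyMeasurable C (Eventually.of_forall hC)
  refine ⟨-hmem.toLp, (conjModular Ω p Φ).toReal, ENNReal.toReal_nonneg, fun u => ?_⟩
  rw [inner_neg_right, L2.inner_def, dualVal]
  congr 2
  refine integral_congr_ae ?_
  filter_upwards [hmem.coeFn_toLp] with x hx
  rw [hx]

/-- The dual description of the energy functional. -/
lemma IsExponent.psi_eq_iSup (h : IsExponent Ω p pmax) (u : L2 N Ω) :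
    Psi Ω p u = ⨆ Φ : dualSet N Ω p, (dualVal Ω p u Φ : EReal) := by
  apply le_antisymm
  -- The zero field makes the supremum nonnegative. This excludes ⊥ and identifies a finite supremum
  -- M with `ENNReal.ofReal M`.
  · have h0 : (0 : EReal) ≤ ⨆ Φ : dualSet N Ω p, (dualVal Ω p u Φ : EReal) := by
      refine le_iSup_of_le ⟨_, h.zero_mem_dualSet⟩ ?_
      have h1 : conjModular Ω p (fun _ => (0 : Mat N n)) = 0 := by
        refine (setLIntegral_congr_fun h.isOpen_diff.measurableSet (g := fun _ => 0)
          fun x hx => ?_).trans (by simp)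
        have hq := (Real.HolderConjugate.conjExponent (h.one_lt hx)).symm
        simp only [norm_zero]
        rw [Real.zero_rpow hq.ne_zero]
        simp
      have h2 : ∀ x, matDiv (fun _ => (0 : Mat N n)) x = 0 := fun x =>
        (IsTest.zero (V := (∅ : Set (EuclideanSpace ℝ (Fin n))))).matDiv_eq_zero (notMem_empty x)
      simp [dualVal, h1, h2]
    induction hs : ⨆ Φ : dualSet N Ω p, (dualVal Ω p u Φ : EReal) with
    | bot => simp [hs] at h0
    | top => exact le_top
    | coe M =>
      rw [hs] at h0
      have hM : ∀ Φ ∈ dualSet N Ω p, dualVal Ω p u Φ ≤ M := fun Φ hΦ => by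
        rw [← EReal.coe_le_coe_iff, ← hs]
        exact le_iSup (fun Φ : dualSet N Ω p => (dualVal Ω p u Φ : EReal)) ⟨Φ, hΦ⟩
      obtain ⟨h1, h2, h3⟩ := h.energy_le (h.integrableOn u) hM
      rw [Psi, if_pos ⟨h1, h2⟩]
      refine (EReal.coe_ennreal_le_coe_ennreal_iff.2 h3).trans ?_
      rw [EReal.coe_ennreal_ofReal, max_eq_left (by exact_mod_cast h0)]
  · refine iSup_le fun Φ => ?_
    rw [Psi]
    split_ifs with hc
    · obtain ⟨G, hG, -⟩ := hc.2
      exact h.dualVal_le_energy hc.1 ⟨G, hG⟩ Φ.2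
    · exact le_top

lemma psi_nonneg (u : L2 N Ω) : 0 ≤ Psi Ω p u := by
  rw [Psi]
  split_ifs
  · exact EReal.coe_ennreal_nonneg _
  · exact le_top

lemma IsExponent.psi_zero (h : IsExponent Ω p pmax) : Psi Ω p (0 : L2 N Ω) = 0 := by
  refine le_antisymm ?_ (psi_nonneg _)
  rw [h.psi_eq_iSup]
  refine iSup_le fun Φ => ?_
  obtain ⟨w, c, hc, hw⟩ := h.exists_dualVal_eq Φ.2
  rw [hw, inner_zero_left, zero_sub]
  exact_mod_cast neg_nonpos.2 hc

lemma IsExponent.isConvex_psi (h : IsExponent Ω p pmax) : IsConvex (Psi (N := N) Ω p) := by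
  intro u v t ht0 ht1
  rw [h.psi_eq_iSup (_ + _)]
  refine iSup_le fun Φ => ?_
  obtain ⟨w, c, -, hw⟩ := h.exists_dualVal_eq Φ.2
  have h1 : dualVal Ω p ((1 - t) • u + t • v : L2 N Ω) Φ
      = (1 - t) * dualVal Ω p u Φ + t * dualVal Ω p v Φ := by
    rw [hw, hw, hw, inner_add_left, real_inner_smul_left, real_inner_smul_left]
    ring
  have h2 : ∀ z : L2 N Ω, (dualVal Ω p z Φ : EReal) ≤ Psi Ω p z := fun z => by
    rw [h.psi_eq_iSup]
    exact le_iSup (fun Φ : dualSet N Ω p => (dualVal Ω p z Φ : EReal)) Φ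
  rw [h1, EReal.coe_add, EReal.coe_mul, EReal.coe_mul]
  exact add_le_add
    (mul_le_mul_of_nonneg_left (h2 u) (EReal.coe_nonneg.2 (sub_nonneg.2 ht1.le)))
    (mul_le_mul_of_nonneg_left (h2 v) (EReal.coe_nonneg.2 ht0.le))

lemma IsExponent.lowerSemicontinuous_psi (h : IsExponent Ω p pmax) :
    LowerSemicontinuous (Psi (N := N) Ω p) := by
  have : Psi (N := N) Ω p = fun u : L2 N Ω => ⨆ Φ : dualSet N Ω p, (dualVal Ω p u Φ : EReal) :=
    funext fun u => h.psi_eq_iSup u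
  rw [this]
  refine lowerSemicontinuous_iSup fun Φ => Continuous.lowerSemicontinuous ?_
  obtain ⟨w, c, -, hw⟩ := h.exists_dualVal_eq Φ.2
  simp only [hw]
  exact continuous_coe_real_ereal.comp
    ((continuous_id.inner continuous_const).sub continuous_const)

end Dual

/-! ### Density of the domain and comparison with the variable exponent space -/

section TestFunctions

variable {n N : ℕ} {Ω V : Set (EuclideanSpace ℝ (Fin n))} {p : EuclideanSpace ℝ (Fin n) → ℝ}
  {pmax : ℝ}

lemma IsTest.integral_mul_partialDeriv {φ ψ : EuclideanSpace ℝ (Fin n) → ℝ} (hφ : IsTest Ω φ)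
    (hψ : IsTest Ω ψ) (j : Fin n) :
    ∫ x in Ω, φ x * partialDeriv j ψ x = -∫ x in Ω, partialDeriv j φ x * ψ x := by
  rw [setIntegral_eq_integral_of_forall_compl_eq_zero fun x hx => by
      rw [hφ.eq_zero hx, zero_mul],
    setIntegral_eq_integral_of_forall_compl_eq_zero fun x hx => by rw [hψ.eq_zero hx, mul_zero]]
  have h1 := hφ.contDiff.continuous
  have h2 := hψ.contDiff.continuous
  refine integral_mul_fderiv_eq_neg_fderiv_mul_of_integrable ?_ ?_ ?_
    (fun x _ => hφ.contDiff.differentiable one_ne_zero x)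
    (fun x _ => hψ.contDiff.differentiable one_ne_zero x)
  · exact ((hφ.continuous_partialDeriv j).mul h2).integrable_of_hasCompactSupport
      hψ.hasCompactSupport.mul_left
  · exact (h1.mul (hψ.continuous_partialDeriv j)).integrable_of_hasCompactSupport
      hφ.hasCompactSupport.mul_right
  · exact (h1.mul h2).integrable_of_hasCompactSupport hφ.hasCompactSupport.mul_right

/-- The Jacobi matrix. -/
def jacobi (φ : EuclideanSpace ℝ (Fin n) → EuclideanSpace ℝ (Fin N))
    (x : EuclideanSpace ℝ (Fin n)) : Mat N n :=
  WithLp.toLp 2 fun k => partialDeriv k.2 φ x k.1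

lemma IsTest.exists_bound_jacobi {φ : EuclideanSpace ℝ (Fin n) → EuclideanSpace ℝ (Fin N)}
    (hφ : IsTest Ω φ) : Continuous (jacobi φ) ∧ ∃ C, ∀ x, ‖jacobi φ x‖ ≤ C := by
  have hc : Continuous (jacobi φ) := by
    refine (PiLp.continuous_toLp 2 _).comp (continuous_pi fun k => ?_)
    exact (EuclideanSpace.proj (𝕜 := ℝ) k.1).continuous.comp (hφ.continuous_partialDeriv k.2)
  refine ⟨hc, HasCompactSupport.exists_bound_of_continuous (f := jacobi φ) ?_ hc⟩
  refine HasCompactSupport.intro hφ.hasCompactSupport fun x hx => ?_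
  have : IsTest (tsupport φ) φ := ⟨hφ.contDiff, hφ.hasCompactSupport, subset_rfl⟩
  ext k
  simp [jacobi, this.partialDeriv_eq_zero _ hx]

lemma IsTest.integral_inner_matDiv_eq {φ : EuclideanSpace ℝ (Fin n) → EuclideanSpace ℝ (Fin N)}
    (hφ : IsTest Ω φ) {Φ : EuclideanSpace ℝ (Fin n) → Mat N n} (hΦ : IsTest Ω Φ) :
    ∫ x in Ω, inner ℝ (φ x) (matDiv Φ x) = -∫ x in Ω, inner ℝ (jacobi φ x) (Φ x) := by
  have hφi : IntegrableOn φ Ω :=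
    (hφ.contDiff.continuous.integrable_of_hasCompactSupport hφ.hasCompactSupport).integrableOn
  have hφk : ∀ i : Fin N, IsTest Ω fun x => φ x i := fun i => hφ.comp_clm (EuclideanSpace.proj i)
  have hφd : ∀ (i : Fin N) (j : Fin n) x, partialDeriv j (fun y => φ y i) x
      = partialDeriv j φ x i := fun i j x => hφ.partialDeriv_comp_clm (EuclideanSpace.proj i) j x
  rw [integral_inner_matDiv hφi hΦ]
  simp only [inner_mat, jacobi]
  rw [integral_finsetSum, ← Finset.sum_neg_distrib]
  · refine Finset.sum_congr rfl fun k _ => ?_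
    rw [(hφk k.1).integral_mul_partialDeriv (hΦ.entry k) k.2]
    simp only [hφd]
  · intro k _
    have h1 : Continuous fun x => partialDeriv k.2 φ x k.1 :=
      (EuclideanSpace.proj (𝕜 := ℝ) k.1).continuous.comp (hφ.continuous_partialDeriv k.2)
    exact ((h1.mul (hΦ.entry k).contDiff.continuous).integrable_of_hasCompactSupport
      (hΦ.entry k).hasCompactSupport.mul_left).integrableOn

/-- For smooth φ the divergence can be moved onto φ. Off Y, Young's inequality is absorbed by the
conjugate modular; on Y the field has norm at most 1. So test functions have finite energy. -/
lemma IsExponent.exists_dualVal_le_of_isTest (h : IsExponent Ω p pmax)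
    {φ : EuclideanSpace ℝ (Fin n) → EuclideanSpace ℝ (Fin N)} (hφ : IsTest Ω φ) :
    ∃ M : ℝ, ∀ Φ ∈ dualSet N Ω p, dualVal Ω p φ Φ ≤ M := by
  obtain ⟨hJc, C, hC⟩ := hφ.exists_bound_jacobi
  have hC0 : 0 ≤ C := (norm_nonneg _).trans (hC 0)
  -- C serves the points of Y, and max(1, C)^pmax bounds |Dφ|^p/p at the remaining points.
  set B : ℝ := C + max 1 C ^ pmax with hB
  have hΩtop : volume Ω ≠ ∞ := h.isBounded.measure_lt_top.ne
  refine ⟨B * (volume Ω).toReal, fun Φ hΦ => ?_⟩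
  have hB0 : 0 ≤ B := by positivity
  have hint : IntegrableOn (fun x => ‖jacobi φ x‖ * ‖Φ x‖) Ω :=
    ((hJc.norm.mul hΦ.1.contDiff.continuous.norm).integrable_of_hasCompactSupport
      hΦ.1.hasCompactSupport.norm.mul_left).integrableOn
  have hint' : IntegrableOn (fun x => (inner ℝ (jacobi φ x) (Φ x) : ℝ)) Ω :=
    Integrable.mono hint (hJc.inner hΦ.1.contDiff.continuous).aestronglyMeasurable
      (Eventually.of_forall fun x => by
        rw [Real.norm_of_nonneg (by positivity : 0 ≤ ‖jacobi φ x‖ * ‖Φ x‖)]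
        exact norm_inner_le_norm _ _)
  have hV : MeasurableSet (Ω \ critSet Ω p) := h.isOpen_diff.measurableSet
  have key : ENNReal.ofReal (∫ x in Ω, inner ℝ (jacobi φ x) (Φ x))
      ≤ ENNReal.ofReal B * volume Ω + conjModular Ω p Φ := by
    calc ENNReal.ofReal (∫ x in Ω, inner ℝ (jacobi φ x) (Φ x))
        ≤ ENNReal.ofReal (∫ x in Ω, ‖jacobi φ x‖ * ‖Φ x‖) :=
          ENNReal.ofReal_le_ofReal (integral_mono hint' hint fun x => real_inner_le_norm _ _)
      _ = ∫⁻ x in Ω, ENNReal.ofReal (‖jacobi φ x‖ * ‖Φ x‖) :=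
          ofReal_integral_eq_lintegral_ofReal hint (Eventually.of_forall fun x => by positivity)
      _ ≤ ∫⁻ x in Ω, (ENNReal.ofReal B + (Ω \ critSet Ω p).indicator (fun x =>
            ENNReal.ofReal (‖Φ x‖ ^ (p x).conjExponent / (p x).conjExponent)) x) := by
          refine setLIntegral_mono' h.isOpen.measurableSet fun x hx => ?_
          by_cases hxV : x ∈ Ω \ critSet Ω p
          · have hq := Real.HolderConjugate.conjExponent (h.one_lt hxV)
            rw [indicator_of_mem hxV, ← ENNReal.ofReal_add hB0
              (div_nonneg (Real.rpow_nonneg (norm_nonneg _) _) hq.symm.nonneg)]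
            refine ENNReal.ofReal_le_ofReal ?_
            have h1 := Real.young_inequality_of_nonneg (norm_nonneg (jacobi φ x))
              (norm_nonneg (Φ x)) hq
            have h2 := rpow_div_le_max (norm_nonneg _) (hC x) (h.bounds x hx).1 (h.bounds x hx).2
            linarith
          · have hxY : x ∈ critSet Ω p := by
              by_contra hc
              exact hxV ⟨hx, hc⟩
            rw [indicator_of_notMem hxV, add_zero]
            refine ENNReal.ofReal_le_ofReal ?_
            have h1 : ‖jacobi φ x‖ * ‖Φ x‖ ≤ C * 1 :=
              mul_le_mul (hC x) (hΦ.2.1 x hxY) (norm_nonneg _) hC0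
            have h2 : 0 ≤ max 1 C ^ pmax := by positivity
            linarith
      _ = _ := by
          rw [lintegral_add_left measurable_const, lintegral_const, Measure.restrict_apply_univ,
            lintegral_indicator hV, Measure.restrict_restrict hV,
            inter_eq_self_of_subset_left sdiff_subset]
          rfl
  have htop : ENNReal.ofReal B * volume Ω ≠ ∞ := ENNReal.mul_ne_top ENNReal.ofReal_ne_top hΩtop
  have key' := (ENNReal.ofReal_le_iff_le_toReal (ENNReal.add_ne_top.2 ⟨htop, hΦ.2.2⟩)).1 key
  rw [ENNReal.toReal_add htop hΦ.2.2, ENNReal.toReal_mul, ENNReal.toReal_ofReal hB0] at key'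
  rw [dualVal, hφ.integral_inner_matDiv_eq hΦ.1]
  linarith

lemma dualVal_congr {u v : EuclideanSpace ℝ (Fin n) → EuclideanSpace ℝ (Fin N)}
    (h : u =ᵐ[volume.restrict Ω] v) (Φ : EuclideanSpace ℝ (Fin n) → Mat N n) :
    dualVal Ω p u Φ = dualVal Ω p v Φ := by
  rw [dualVal, dualVal, integral_congr_ae]
  filter_upwards [h] with x hx
  rw [hx]

/-- The classes of test functions. -/
def testSubmodule (N : ℕ) (Ω : Set (EuclideanSpace ℝ (Fin n))) : Submodule ℝ (L2 N Ω) where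
  carrier := {u | ∃ φ, IsTest Ω φ ∧ u =ᵐ[volume.restrict Ω] φ}
  add_mem' := by
    rintro u v ⟨φ, hφ, hu⟩ ⟨ψ, hψ, hv⟩
    exact ⟨_, hφ.add hψ, (Lp.coeFn_add u v).trans (hu.add hv)⟩
  zero_mem' := ⟨_, IsTest.zero, Lp.coeFn_zero _ _ _⟩
  smul_mem' := by
    rintro c u ⟨φ, hφ, hu⟩
    exact ⟨_, hφ.const_smul c, (Lp.coeFn_smul c u).trans (hu.const_smul c)⟩

/-- An element of the orthogonal complement vanishes by the fundamental lemma of the calculus of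
variations, applied to each component. -/
lemma IsExponent.dense_testSubmodule (h : IsExponent Ω p pmax) :
    Dense (testSubmodule N Ω : Set (L2 N Ω)) := by
  rw [Submodule.dense_iff_topologicalClosure_eq_top, Submodule.topologicalClosure_eq_top_iff,
    Submodule.eq_bot_iff]
  intro w hw
  have hfin := h.isFiniteMeasure
  have hwi := h.integrableOn w
  have key : ∀ i : Fin N, ∀ᵐ x, x ∈ Ω → w x i = 0 := by
    intro i
    refine h.isOpen.ae_eq_zero_of_integral_contDiff_smul_eq_zero
      (IntegrableOn.locallyIntegrableOn ((EuclideanSpace.proj (𝕜 := ℝ) i).integrable_comp hwi))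
      fun g hg hgc hgΩ => ?_
    have hgt : IsTest Ω g := ⟨hg.of_le (by simp), hgc, hgΩ⟩
    have hφ : IsTest Ω fun x => g x • (EuclideanSpace.single i (1 : ℝ) : EuclideanSpace ℝ (Fin N)) :=
      hgt.comp_clm ((ContinuousLinearMap.id ℝ ℝ).smulRight
        (EuclideanSpace.single i (1 : ℝ) : EuclideanSpace ℝ (Fin N)))
    obtain ⟨C, hC⟩ := hφ.exists_bound
    have hmem := MemLp.of_bound (p := 2) (μ := volume.restrict Ω)
      hφ.contDiff.continuous.aestronglyMeasurable C (Eventually.of_forall hC)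
    have h1 := (Submodule.mem_orthogonal _ _).1 hw hmem.toLp ⟨_, hφ, hmem.coeFn_toLp⟩
    rw [← setIntegral_eq_integral_of_forall_compl_eq_zero (s := Ω)
      fun x hx => by rw [hgt.eq_zero hx, zero_smul], ← h1, L2.inner_def]
    refine integral_congr_ae ?_
    filter_upwards [hmem.coeFn_toLp] with x hx
    rw [hx, real_inner_smul_left, EuclideanSpace.inner_single_left]
    simp
  rw [Lp.eq_zero_iff_ae_eq_zero, EventuallyEq, ae_restrict_iff' h.isOpen.measurableSet]
  filter_upwards [ae_all_iff.2 key] with x hx hxΩ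
  ext i
  exact hx i hxΩ

lemma IsExponent.isEnergy_psi (h : IsExponent Ω p pmax) : IsEnergy (Psi (N := N) Ω p) where
  nonneg := psi_nonneg
  zero := h.psi_zero
  convex := h.isConvex_psi
  lsc := h.lowerSemicontinuous_psi
  dense := by
    refine h.dense_testSubmodule.mono ?_
    rintro u ⟨φ, hφ, hu⟩
    obtain ⟨M, hM⟩ := h.exists_dualVal_le_of_isTest hφ
    have : Psi Ω p u ≤ (M : EReal) := by
      rw [h.psi_eq_iSup]
      refine iSup_le fun Φ => EReal.coe_le_coe_iff.2 ?_
      rw [dualVal_congr hu]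
      exact hM _ Φ.2
    exact (this.trans_lt (EReal.coe_lt_top M)).ne

/-- On the bounded set Ω one has |u|^p ≤ 1 + |u|² if p ≤ 2, so membership in L^{p(·)} is automatic
for u ∈ L². -/
lemma IsExponent.psiBV_eq (h : IsExponent Ω p pmax) (hp2 : ∀ x ∈ Ω, p x ≤ 2) :
    PsiBV (N := N) Ω p = Psi (N := N) Ω p := by
  have hfin := h.isFiniteMeasure
  funext u
  have hu : MemLpVar (Ω \ critSet Ω p) p u := by
    have hsub : volume.restrict (Ω \ critSet Ω p) ≤ volume.restrict Ω :=
      Measure.restrict_mono_set _ sdiff_subset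
    refine ⟨(Lp.memLp u).1.mono_measure hsub, 1, one_pos, ?_⟩
    have hsq : Integrable (fun x => ‖u x‖ ^ 2) (volume.restrict Ω) :=
      (memLp_two_iff_integrable_sq_norm (Lp.memLp u).1).1 (Lp.memLp u)
    calc ∫⁻ x in Ω \ critSet Ω p, ENNReal.ofReal ((‖u x‖ / 1) ^ p x)
        ≤ ∫⁻ x in Ω \ critSet Ω p, ENNReal.ofReal (1 + ‖u x‖ ^ 2) := by
          refine setLIntegral_mono' h.isOpen_diff.measurableSet fun x hx =>
            ENNReal.ofReal_le_ofReal ?_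
          rw [div_one]
          have h1 := h.bounds x hx.1
          rcases le_total ‖u x‖ 1 with h2 | h2
          · have := Real.rpow_le_one (norm_nonneg (u x)) h2 (zero_le_one.trans h1.1)
            have := sq_nonneg ‖u x‖
            linarith
          · have := Real.rpow_le_rpow_of_exponent_le h2 (hp2 x hx.1)
            rw [Real.rpow_two] at this
            linarith
      _ < ∞ := (((integrable_const 1).add hsq).mono_measure hsub).lintegral_lt_top
  have hiff : MemBVVar Ω p u ↔ MemBV Ω u ∧ HasGradLpVar (Ω \ critSet Ω p) p u := by
    rw [MemBVVar]
    exact ⟨fun hc => ⟨hc.1, hc.2.2⟩, fun hc => ⟨hc.1, hu, hc.2⟩⟩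
  by_cases hc : MemBV Ω u ∧ HasGradLpVar (Ω \ critSet Ω p) p u
  · rw [PsiBV, Psi, if_pos hc, if_pos (hiff.2 hc)]
  · rw [PsiBV, Psi, if_neg hc, if_neg fun hb => hc (hiff.1 hb)]

end TestFunctions

end CriticalFlow

end

/-! ### Conclusion: the abstract theory applied to the functional -/

theorem mainTheorem3 (n N : ℕ) (Ω : Set (EuclideanSpace ℝ (Fin n)))
    (hΩ_open : IsOpen Ω) (hΩ_bdd : Bornology.IsBounded Ω)
    (p : EuclideanSpace ℝ (Fin n) → ℝ) (pmax : ℝ)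
    (hp_meas : AEMeasurable p (volume.restrict Ω))
    (hp_bounds : ∀ x ∈ Ω, 1 ≤ p x ∧ p x ≤ pmax)
    (hp_Y : CriticalFlow.YSemicontinuous Ω p) :
    CriticalFlow.IsProper (CriticalFlow.Psi (N := N) Ω p) ∧
    CriticalFlow.IsConvex (CriticalFlow.Psi (N := N) Ω p) ∧
    LowerSemicontinuous (CriticalFlow.Psi (N := N) Ω p) ∧
    Dense {u : CriticalFlow.L2 N Ω | CriticalFlow.Psi Ω p u ≠ ⊤} ∧
    ((∀ x ∈ Ω, p x ≤ 2) →
      CriticalFlow.PsiBV (N := N) Ω p = CriticalFlow.Psi (N := N) Ω p) ∧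
    ∀ u₀ : CriticalFlow.L2 N Ω, ∃ u : ℝ → CriticalFlow.L2 N Ω,
      CriticalFlow.IsSemigroupSolution (CriticalFlow.Psi Ω p) u₀ u ∧
      ∀ v : ℝ → CriticalFlow.L2 N Ω,
        CriticalFlow.IsSemigroupSolution (CriticalFlow.Psi Ω p) u₀ v →
        ∀ t : ℝ, 0 ≤ t → v t = u t := by
  have h : CriticalFlow.IsExponent Ω p pmax := ⟨hΩ_open, hΩ_bdd, hp_meas, hp_bounds, hp_Y⟩
  have hE := h.isEnergy_psi (N := N)
  refine ⟨⟨fun u hu => ?_, 0, ?_⟩, hE.convex, hE.lsc, hE.dense, h.psiBV_eq, fun u₀ =>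
    ⟨fun t => CriticalFlow.flow (CriticalFlow.Psi Ω p) t u₀,
      CriticalFlow.IsSemigroupSolution.flow hE u₀, fun v hv t ht =>
        CriticalFlow.IsSemigroupSolution.unique hE
          (CriticalFlow.IsSemigroupSolution.flow hE u₀) hv ht⟩⟩
  · have := hE.nonneg u
    rw [hu] at this
    simp at this
  · rw [hE.zero]
    exact EReal.zero_ne_top
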